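/- Fix integers $d,m\ge 1$, $T>0$, $0<\alpha<\tfrac12$ and $\beta,\mu\in(0,1]$ with $\beta>\alpha>1-\mu$. $|\cdot|$ denotes Euclidean norms (for matrices: the Euclidean norm of the entries). **Spaces.** For $f:[0,T]\to\mathbb R^d$, $\lambda\ge 1$, $0<r\le1$, $0<\delta\le 1$ put $\|f\|_\infty=\sup_{[0,T]}|f|$, $$\|f\|_{\alpha,\lambda}=\sup_{t\in[0,T]}e^{-\lambda t}\Big(|f(t)|+\int_0^t\frac{|f(t)-f(s)|}{(t-s)^{\alpha+1}}ds\Big),\qquad \|f\|_{r}=\|f\|_\infty+\sup_{0\le s<t\le T}\frac{|f(t)-f(s)|}{(t-s)^r},$$ let $\|f\|_{\alpha,\infty}$ be the first expression with $\lambda$ replaced by $0$, and $\Delta(f)=\sup_{u\in[0,T]}\int_0^u\frac{|f(u)-f(s)|^\delta}{(u-s)^{\alpha+1}}ds\in[0,\infty]$. $W_0^{\alpha,\infty}(0,T;\mathbb R^d)$ is the set of measurable $f$ with $\|f\|_{\alpha,\infty}<\infty$, $C^{r}(0,T;\mathbb R^d)$ the set of $f$ with $\|f\|_{r}<\infty$,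 and $W_T^{1-\alpha,\infty}(0,T;\mathbb R^m)$ the set of measurable $g:[0,T]\to\mathbb R^m$ with $$\sup_{0<s<t<T}\Big(\frac{|g(t)-g(s)|}{(t-s)^{1-\alpha}}+\int_s^t\frac{|g(y)-g(s)|}{(y-s)^{2-\alpha}}dy\Big)<\infty .$$ **Integral.** Let $$D^{\alpha}_{0+}f(x)=\frac1{\Gamma(1-\alpha)}\Big(\frac{f(x)}{x^\alpha}+\alpha\int_0^x\frac{f(x)-f(y)}{(x-y)^{\alpha+1}}dy\Big),$$ $$D^{1-\alpha}_{t-}g_{t-}(x)=\frac{(-1)^{1-\alpha}}{\Gamma(\alpha)}\Big(\frac{g(x)-g(t-)}{(t-x)^{1-\alpha}}+(1-\alpha)\int_x^t\frac{g(x)-g(y)}{(y-x)^{2-\alpha}}dy\Big),$$ $$\Lambda_\alpha(g)=\frac1{\Gamma(1-\alpha)}\sup_{0<s<t<T}|D^{1-\alpha}_{t-}g_{t-}(s)|.$$ For scalar functions the generalized Stieltjes integral is $\int_0^T f\,dg=(-1)^\alpha\int_0^T D^\alpha_{0+}f(x)\,D^{1-\alpha}_{T-}g_{T-}(x)\,dx$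 (with $(-1)^\alpha(-1)^{1-\alpha}=-1$), and $\int_0^t f\,dg=\int_0^T f\mathbf 1_{(0,t)}\,dg$; for matrix-valued integrands and vector-valued $g$ it is defined through components. Put $G^{(\sigma)}_t(f)=\int_0^t\sigma(t,s,f(s))\,dg_s$, $t\in[0,T]$. **(H1).** $\sigma:[0,T]^2\times\mathbb R^d\to\mathbb R^{d\times m}$ is measurable, the derivatives $\partial_{x_i}\sigma$, $\partial_t\sigma$, $\partial^2_{x_i,t}\sigma=\partial_{x_i}(\partial_t\sigma)$ exist, and there are $\delta\in(0,1]$, a constant $K$ and, for every $N\ge0$, $K_N>0$ such that for all $t,s,t_1,t_2,s_1,s_2\in[0,T]$, $x,y\in\mathbb R^d$, $i=1,\dots,d$: 1. $|\sigma(t,s,x)-\sigma(t,s,y)|+|\partial_t\sigma(t,s,x)-\partial_t\sigma(t,s,y)|\le K|x-y|$; 2. $|\partial_{x_i}\sigma(t,s,x)-\partial_{x_i}\sigma(t,s,y)|+|\partial^2_{x_i,t}\sigma(t,s,x)-\partial^2_{x_i,t}\sigma(t,s,y)|\le K_N|x-y|^\delta$ if $|x|,|y|\le N$; 3. $|\sigma(t_1,s,x)-\sigma(t_2,s,x)|+|\partial_{x_i}\sigma(t_1,s,x)-\partial_{x_i}\sigma(t_2,s,x)|\le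 K|t_1-t_2|^\mu$; 4. $|\sigma(t,s_1,x)-\sigma(t,s_2,x)|+|\partial_t\sigma(t,s_1,x)-\partial_t\sigma(t,s_2,x)|\le K|s_1-s_2|^\beta$; 5. $|\partial^2_{x_i,t}\sigma(t,s_1,x)-\partial^2_{x_i,t}\sigma(t,s_2,x)|+|\partial_{x_i}\sigma(t,s_1,x)-\partial_{x_i}\sigma(t,s_2,x)|\le K|s_1-s_2|^\beta$. **Proposition.** Let $g\in W_T^{1-\alpha,\infty}(0,T;\mathbb R^m)$ and let $\sigma$ satisfy (H1). (i) If $f\in W_0^{\alpha,\infty}(0,T;\mathbb R^d)$, then the integrals defining $G^{(\sigma)}(f)$ exist, and $G^{(\sigma)}(f)\in C^{1-\alpha}(0,T;\mathbb R^d)\subseteq W_0^{\alpha,\infty}(0,T;\mathbb R^d)$. Moreover, for all $\lambda\ge1$, $$\|G^{(\sigma)}(f)\|_{1-\alpha}\le\Lambda_\alpha(g)\,d^{(3)}(1+\|f\|_{\alpha,\infty}),\qquad \|G^{(\sigma)}(f)\|_{\alpha,\lambda}\le\frac{\Lambda_\alpha(g)\,d^{(4)}}{\lambda^{1-2\alpha}}(1+\|f\|_{\alpha,\lambda}),$$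 where the positive constants $d^{(3)},d^{(4)}$ depend only on $d,m,\alpha,\beta,\mu,K,T$ and $|\sigma(0,0,0)|$. (ii) If $f,h\in W_0^{\alpha,\infty}(0,T;\mathbb R^d)$ satisfy $\|f\|_\infty\le N$ and $\|h\|_\infty\le N$, then for all $\lambda\ge1$ $$\|G^{(\sigma)}(f)-G^{(\sigma)}(h)\|_{\alpha,\lambda}\le\frac{\Lambda_\alpha(g)\,d'_N}{\lambda^{1-2\alpha}}\,(1+\Delta(f)+\Delta(h))\,\|f-h\|_{\alpha,\lambda},$$ where the positive constant $d'_N$ depends only on $d,m,\alpha,\beta,\mu,N,K,K_N$ and $T$. (The right-hand side is read as $0$ if one of its factors is $0$, even when $\Delta(f)+\Delta(h)=\infty$.) -/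

import Mathlib

open MeasureTheory Set

open scoped ENNReal

noncomputable section

namespace VolterraYoung

/-- Euclidean space `ℝ^d` with the Euclidean norm. -/
abbrev Vec (d : ℕ) : Type := EuclideanSpace ℝ (Fin d)

/-- Real `d × m` matrices with the Euclidean (Frobenius) norm; the entry `(i, j)` of `A` is
`A (i, j)`. -/
abbrev Mat (d m : ℕ) : Type := EuclideanSpace ℝ (Fin d × Fin m)

/-! Functions on `[0,T]` are represented by functions on `ℝ` of which only the values on `[0,T]`
are used. All norms take values in `[0,∞]`. -/

section Spaces

variable {E : Type*} [NormedAddCommGroup E]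

/-- `|f(t)| + ∫_0^t |f(t) - f(s)| / (t-s)^(α+1) ds`. -/
def wDensity (α : ℝ) (f : ℝ → E) (t : ℝ) : ℝ≥0∞ :=
  ‖f t‖ₑ + ∫⁻ s in Ioo 0 t, ENNReal.ofReal (‖f t - f s‖ / (t - s) ^ (α + 1))

/-- The norm `‖f‖_{α,∞}`. -/
def wNorm (α T : ℝ) (f : ℝ → E) : ℝ≥0∞ :=
  ⨆ t ∈ Icc 0 T, wDensity α f t

/-- The norm `‖f‖_{α,λ}`, with the exponential weight `exp(-λ t)`. -/
def wExpNorm (α lam T : ℝ) (f : ℝ → E) : ℝ≥0∞ :=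
  ⨆ t ∈ Icc 0 T, ENNReal.ofReal (Real.exp (-lam * t)) * wDensity α f t

/-- The space `W_0^{α,∞}(0,T;E)`. -/
def MemW [MeasurableSpace E] (α T : ℝ) (f : ℝ → E) : Prop :=
  Measurable ((Icc 0 T).domRestrict f) ∧ wNorm α T f < ∞

/-- The norm `‖f‖_∞ = sup_{s ∈ [0,T]} |f(s)|`. -/
def supNorm (T : ℝ) (f : ℝ → E) : ℝ≥0∞ :=
  ⨆ s ∈ Icc 0 T, ‖f s‖ₑ

/-- The Hölder norm `‖f‖_r = ‖f‖_∞ + sup_{0 ≤ s < t ≤ T} |f(t) - f(s)| / (t-s)^r`. -/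
def holderNorm (r T : ℝ) (f : ℝ → E) : ℝ≥0∞ :=
  supNorm T f +
    ⨆ (s : ℝ) (t : ℝ) (_ : 0 ≤ s ∧ s < t ∧ t ≤ T), ENNReal.ofReal (‖f t - f s‖ / (t - s) ^ r)

/-- The space `C^r(0,T;E)` of Hölder continuous functions. -/
def MemHolder (r T : ℝ) (f : ℝ → E) : Prop :=
  holderNorm r T f < ∞

/-- `Δ(f) = sup_{u ∈ [0,T]} ∫_0^u |f(u) - f(s)|^δ / (u-s)^(α+1) ds`, possibly infinite. -/
def deltaFun (α δ T : ℝ) (f : ℝ → E) : ℝ≥0∞ :=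
  ⨆ u ∈ Icc 0 T, ∫⁻ s in Ioo 0 u, ENNReal.ofReal (‖f u - f s‖ ^ δ / (u - s) ^ (α + 1))

/-- The norm `‖g‖_{1-α,∞,T}`. -/
def integratorNorm (α T : ℝ) (g : ℝ → E) : ℝ≥0∞ :=
  ⨆ (s : ℝ) (t : ℝ) (_ : 0 < s ∧ s < t ∧ t < T),
    (ENNReal.ofReal (‖g t - g s‖ / (t - s) ^ (1 - α)) +
      ∫⁻ y in Ioo s t, ENNReal.ofReal (‖g y - g s‖ / (y - s) ^ (2 - α)))

/-- The space `W_T^{1-α,∞}(0,T;E)`. -/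
def MemIntegrator [MeasurableSpace E] (α T : ℝ) (g : ℝ → E) : Prop :=
  Measurable ((Icc 0 T).domRestrict g) ∧ integratorNorm α T g < ∞

end Spaces

section FractionalCalculus

variable {E : Type*} [NormedAddCommGroup E] [NormedSpace ℝ E]

/-- The left-sided Weyl derivative `(D^a_{0+} f)(x)` of order `a ∈ (0,1)`. -/
def weylLeft (a : ℝ) (f : ℝ → E) (x : ℝ) : E :=
  (Real.Gamma (1 - a))⁻¹ •
    ((x ^ a)⁻¹ • f x + a • ∫ y in (0 : ℝ)..x, ((x - y) ^ (a + 1))⁻¹ • (f x - f y))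

/-- The right-sided Weyl derivative `(D^a_{b-} f)(x)` of order `a ∈ (0,1)`, without the
unimodular factor `(-1)^a`. -/
def weylRight (a b : ℝ) (f : ℝ → E) (x : ℝ) : E :=
  (Real.Gamma (1 - a))⁻¹ •
    (((b - x) ^ a)⁻¹ • f x + a • ∫ y in x..b, ((y - x) ^ (a + 1))⁻¹ • (f x - f y))

/-- The function `g_{b-}(x) = g(x) - g(b-)`, where `g(b-)` is the left limit of `g` at `b`. -/
def subLeftLim (g : ℝ → E) (b : ℝ) (x : ℝ) : E :=
  g x - Function.leftLim g b

/-- `Λ_α(g) = Γ(1-α)⁻¹ sup_{0<s<t<T} |(D^{1-α}_{t-} g_{t-})(s)|`. -/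
def Lam (α T : ℝ) (g : ℝ → E) : ℝ≥0∞ :=
  ENNReal.ofReal (Real.Gamma (1 - α))⁻¹ *
    ⨆ (s : ℝ) (t : ℝ) (_ : 0 < s ∧ s < t ∧ t < T), ‖weylRight (1 - α) t (subLeftLim g t) s‖ₑ

/-- The product of fractional derivatives in the generalized Stieltjes integral over `(0,T)`. -/
def stieltjesIntegrand (α T : ℝ) (f g : ℝ → ℝ) (x : ℝ) : ℝ :=
  weylLeft α f x * weylRight (1 - α) T (subLeftLim g T) x

/-- The generalized (Zähle) Stieltjes integral
`∫_0^T f dg = (-1)^α ∫_0^T (D^α_{0+} f)(x) (D^{1-α}_{T-} g_{T-})(x) dx`. The factors `(-1)^α` and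
`(-1)^{1-α}`, the latter omitted in `weylRight`, multiply to `-1`. -/
def stieltjes (α T : ℝ) (f g : ℝ → ℝ) : ℝ :=
  -∫ x in (0 : ℝ)..T, stieltjesIntegrand α T f g x

/-- The generalized Stieltjes integral `∫_0^T f dg` exists: both fractional derivatives are given
by convergent integrals almost everywhere, `g` has a left limit at `T`, and the product of the
derivatives is integrable on `(0,T)`. -/
def StieltjesExists (α T : ℝ) (f g : ℝ → ℝ) : Prop :=
  (∀ᵐ x ∂volume.restrict (Ioo 0 T),
      IntegrableOn (fun y => (f x - f y) / (x - y) ^ (α + 1)) (Ioo 0 x)) ∧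
  (∀ᵐ x ∂volume.restrict (Ioo 0 T),
      IntegrableOn (fun y => (g x - g y) / (y - x) ^ (2 - α)) (Ioo x T)) ∧
  (∃ l : ℝ, Filter.Tendsto g (nhdsWithin T (Iio T)) (nhds l)) ∧
  IntegrableOn (stieltjesIntegrand α T f g) (Ioo 0 T)

end FractionalCalculus

variable {d m : ℕ}

/-- The integrand `s ↦ σ(t,s,f(s)) 1_{(0,t)}(s)`. -/
def volterraIntegrand (σ : ℝ → ℝ → Vec d → Mat d m) (f : ℝ → Vec d) (t : ℝ) : ℝ → Mat d m :=
  (Ioo 0 t).indicator fun s => σ t s (f s)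

/-- `G_t^{(σ)}(f) = ∫_0^t σ(t,s,f(s)) dg_s`, with `i`-th component
`∑_j ∫_0^T σ_{ij}(t,s,f(s)) 1_{(0,t)}(s) dg^j_s`. -/
def volterra (α T : ℝ) (σ : ℝ → ℝ → Vec d → Mat d m) (g : ℝ → Vec m) (f : ℝ → Vec d)
    (t : ℝ) : Vec d :=
  WithLp.toLp 2 fun i => ∑ j : Fin m,
    stieltjes α T (fun s => volterraIntegrand σ f t s (i, j)) (fun s => g s j)

/-- All the scalar integrals that define `G_t^{(σ)}(f)` exist. -/
def VolterraExists (α T : ℝ) (σ : ℝ → ℝ → Vec d → Mat d m) (g : ℝ → Vec m) (f : ℝ → Vec d)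
    (t : ℝ) : Prop :=
  ∀ (i : Fin d) (j : Fin m),
    StieltjesExists α T (fun s => volterraIntegrand σ f t s (i, j)) (fun s => g s j)

/-- The partial derivative `∂_t σ(t,s,x)` on `[0,T]` (one-sided at the end points). -/
def dt (T : ℝ) (σ : ℝ → ℝ → Vec d → Mat d m) (t s : ℝ) (x : Vec d) : Mat d m :=
  derivWithin (fun τ => σ τ s x) (Icc 0 T) t

/-- The partial derivative `∂_{x_i} σ(t,s,x)`. -/
def dx (i : Fin d) (σ : ℝ → ℝ → Vec d → Mat d m) (t s : ℝ) (x : Vec d) : Mat d m :=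
  lineDeriv ℝ (σ t s) x (EuclideanSpace.single i 1)

/-- Hypothesis (H1) on `σ : [0,T]² × ℝ^d → ℝ^{d×m}`, with exponents `β, μ, δ`, global constant `K`
and local constants `K_N = KN N`. The mixed derivative `∂²_{x_i,t} σ` is `∂_{x_i}(∂_t σ)`. -/
structure HypH1 (T β μ δ K : ℝ) (KN : ℝ → ℝ) (σ : ℝ → ℝ → Vec d → Mat d m) : Prop where
  beta_pos : 0 < β
  beta_le : β ≤ 1
  mu_pos : 0 < μ
  mu_le : μ ≤ 1
  delta_pos : 0 < δ
  delta_le : δ ≤ 1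
  KN_pos : ∀ N, 0 ≤ N → 0 < KN N
  meas : Measurable fun p : Icc (0 : ℝ) T × Icc (0 : ℝ) T × Vec d =>
    σ (p.1 : ℝ) (p.2.1 : ℝ) p.2.2
  exists_dx : ∀ t ∈ Icc 0 T, ∀ s ∈ Icc 0 T, ∀ x, ∀ i : Fin d,
    LineDifferentiableAt ℝ (σ t s) x (EuclideanSpace.single i 1)
  exists_dt : ∀ t ∈ Icc 0 T, ∀ s ∈ Icc 0 T, ∀ x,
    DifferentiableWithinAt ℝ (fun τ => σ τ s x) (Icc 0 T) t
  exists_dxdt : ∀ t ∈ Icc 0 T, ∀ s ∈ Icc 0 T, ∀ x, ∀ i : Fin d,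
    LineDifferentiableAt ℝ (dt T σ t s) x (EuclideanSpace.single i 1)
  lip_x : ∀ t ∈ Icc 0 T, ∀ s ∈ Icc 0 T, ∀ x y,
    ‖σ t s x - σ t s y‖ + ‖dt T σ t s x - dt T σ t s y‖ ≤ K * ‖x - y‖
  holder_x : ∀ N, 0 ≤ N → ∀ t ∈ Icc 0 T, ∀ s ∈ Icc 0 T, ∀ x y, ‖x‖ ≤ N → ‖y‖ ≤ N →
    ∀ i : Fin d,
    ‖dx i σ t s x - dx i σ t s y‖ + ‖dx i (dt T σ) t s x - dx i (dt T σ) t s y‖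
      ≤ KN N * ‖x - y‖ ^ δ
  holder_t : ∀ t₁ ∈ Icc 0 T, ∀ t₂ ∈ Icc 0 T, ∀ s ∈ Icc 0 T, ∀ x, ∀ i : Fin d,
    ‖σ t₁ s x - σ t₂ s x‖ + ‖dx i σ t₁ s x - dx i σ t₂ s x‖ ≤ K * |t₁ - t₂| ^ μ
  holder_s : ∀ t ∈ Icc 0 T, ∀ s₁ ∈ Icc 0 T, ∀ s₂ ∈ Icc 0 T, ∀ x,
    ‖σ t s₁ x - σ t s₂ x‖ + ‖dt T σ t s₁ x - dt T σ t s₂ x‖ ≤ K * |s₁ - s₂| ^ β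
  holder_s_dx : ∀ t ∈ Icc 0 T, ∀ s₁ ∈ Icc 0 T, ∀ s₂ ∈ Icc 0 T, ∀ x, ∀ i : Fin d,
    ‖dx i (dt T σ) t s₁ x - dx i (dt T σ) t s₂ x‖ + ‖dx i σ t s₁ x - dx i σ t s₂ x‖
      ≤ K * |s₁ - s₂| ^ β

end VolterraYoung

end

open MeasureTheory Set

open scoped ENNReal

noncomputable section

namespace VolterraYoung

/-! ### Explicit integrals of powers on intervals and half-lines -/

section Powers

/-! Everything rests on one inequality: `|∫ u dg| ≤ Λ_α(g) * weylMass α T u`. The left Weyl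
derivative of `u` is at most `Γ(1-α)⁻¹` times the mass density, the right derivative of `g_{T-}` is
at most `Γ(1-α) Λ_α(g)`, and the Gamma factors cancel (`lintegral_stieltjesIntegrand_le`). From
there on only integrals of nonnegative functions are estimated.

For a Volterra integrand `φ_t`, the difference `1_{(0,t)} φ_t - 1_{(0,s)} φ_s` is, off one point,
`φ_t` on `(s,t)` plus `φ_t - φ_s` on `(0,s)`. Truncation to an interval costs weights of order `-α`
at both end points (`weylMass_indicator_le`). Suppose one function `Ψ` dominates the size and the
fractional increments of every `φ_t`, and `(t-s)^μ Ψ` those of `φ_t - φ_s` (`VolterraBound`). Then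
`G_t - G_s` is controlled by `∫_s^t Ψ k + (t-s)^μ ∫_0^s Ψ k`, where `k` is the end point kernel. If
`Ψ` is bounded, the first integral is `O((t-s)^(1-α))`, and `μ > 1-α` makes the second no worse:
this is the Hölder bound. If `Ψ(r) ≤ M exp(λr)`, the exponentially weighted kernel integral is
bounded by both `C (t-s)^(1-α)` and `C λ^(α-1)`. Using the first for `t-s < 1/λ` and the second
beyond, integration against `(t-s)^(-α-1)` produces the factor `λ^(2α-1)`.

It remains to find `Ψ`. For `σ(t,r,f(r))`, linear growth and regularity in `(s,x)` give a multiple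
of `1 + wDensity α f` (`HypH1.volterraBound`). For the difference of two such integrands, a
four-point estimate (`norm_mixed_difference_le`) gives a multiple of `(1 + Δ(f) + Δ(h)) * wDensity α
(f-h)` (`HypH1.volterraBound_sub`). Increments in both variables come from the mean value inequality
in `t`, which transfers the spatial regularity of `∂_t σ`. -/

theorem setLIntegral_comp_sub_right (f : ℝ → ℝ≥0∞) {s : Set ℝ} (hs : MeasurableSet s) (c : ℝ) :
    ∫⁻ x in (fun x => x - c) ⁻¹' s, f (x - c) = ∫⁻ x in s, f x := by
  rw [← lintegral_indicator hs, ← lintegral_indicator (hs.preimage (measurable_sub_const c)),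
    ← lintegral_sub_right_eq_self (s.indicator f) c]
  rfl

theorem setLIntegral_comp_sub_left (f : ℝ → ℝ≥0∞) {s : Set ℝ} (hs : MeasurableSet s) (c : ℝ) :
    ∫⁻ x in (fun x => c - x) ⁻¹' s, f (c - x) = ∫⁻ x in s, f x := by
  rw [← lintegral_indicator hs, ← lintegral_indicator (hs.preimage (measurable_const_sub c)),
    ← lintegral_sub_left_eq_self (s.indicator f) c]
  rfl

theorem setLIntegral_Ioo_comp_sub_right (f : ℝ → ℝ≥0∞) (a b : ℝ) :
    ∫⁻ x in Ioo a b, f (x - a) = ∫⁻ x in Ioo 0 (b - a), f x := by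
  rw [← setLIntegral_comp_sub_right f measurableSet_Ioo a]
  congr 2
  ext x; simp

theorem setLIntegral_Ioo_comp_sub_left (f : ℝ → ℝ≥0∞) (a b : ℝ) :
    ∫⁻ x in Ioo a b, f (b - x) = ∫⁻ x in Ioo 0 (b - a), f x := by
  rw [← setLIntegral_comp_sub_left f measurableSet_Ioo b]
  congr 2
  ext x; simp

theorem setLIntegral_Ioo_rpow {γ u : ℝ} (hγ : γ < 1) (hu : 0 ≤ u) :
    ∫⁻ x in Ioo 0 u, ENNReal.ofReal (x ^ (-γ)) = ENNReal.ofReal (u ^ (1 - γ) / (1 - γ)) := by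
  have hi : IntervalIntegrable (fun x : ℝ => x ^ (-γ)) volume 0 u :=
    intervalIntegral.intervalIntegrable_rpow' (by linarith)
  rw [intervalIntegrable_iff_integrableOn_Ioo_of_le hu] at hi
  rw [← ofReal_integral_eq_lintegral_ofReal hi]
  · rw [← integral_Ioc_eq_integral_Ioo, ← intervalIntegral.integral_of_le hu,
      integral_rpow (Or.inl (by linarith))]
    rw [Real.zero_rpow (by linarith)]
    congr 1
    rw [sub_zero]; ring_nf
  · filter_upwards [ae_restrict_mem measurableSet_Ioo] with x hx
    exact Real.rpow_nonneg hx.1.le _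

theorem setLIntegral_Ioo_sub_right_rpow {γ a b : ℝ} (hγ : γ < 1) (h : a ≤ b) :
    ∫⁻ x in Ioo a b, ENNReal.ofReal ((x - a) ^ (-γ))
      = ENNReal.ofReal ((b - a) ^ (1 - γ) / (1 - γ)) := by
  rw [setLIntegral_Ioo_comp_sub_right (fun x => ENNReal.ofReal (x ^ (-γ))),
    setLIntegral_Ioo_rpow hγ (by linarith)]

theorem setLIntegral_Ioo_sub_left_rpow {γ a b : ℝ} (hγ : γ < 1) (h : a ≤ b) :
    ∫⁻ x in Ioo a b, ENNReal.ofReal ((b - x) ^ (-γ))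
      = ENNReal.ofReal ((b - a) ^ (1 - γ) / (1 - γ)) := by
  rw [setLIntegral_Ioo_comp_sub_left (fun x => ENNReal.ofReal (x ^ (-γ))),
    setLIntegral_Ioo_rpow hγ (by linarith)]

theorem setLIntegral_Ioi_rpow {γ v : ℝ} (hγ : 0 < γ) (hv : 0 < v) :
    ∫⁻ x in Ioi v, ENNReal.ofReal (x ^ (-(γ + 1))) = ENNReal.ofReal (v ^ (-γ) / γ) := by
  have hi := integrableOn_Ioi_rpow_of_lt (a := -(γ + 1)) (by linarith) hv
  rw [← ofReal_integral_eq_lintegral_ofReal hi, integral_Ioi_rpow_of_lt (by linarith) hv]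
  · congr 1
    rw [show -(γ + 1) + 1 = -γ by ring, neg_div_neg_eq]
  · filter_upwards [ae_restrict_mem measurableSet_Ioi] with x hx
    exact Real.rpow_nonneg (hv.trans hx).le _

theorem setLIntegral_Ioi_sub_right_rpow {γ t y : ℝ} (hγ : 0 < γ) (h : y < t) :
    ∫⁻ x in Ioi t, ENNReal.ofReal ((x - y) ^ (-(γ + 1)))
      = ENNReal.ofReal ((t - y) ^ (-γ) / γ) := by
  rw [← setLIntegral_Ioi_rpow hγ (sub_pos.2 h),
    ← setLIntegral_comp_sub_right (fun x => ENNReal.ofReal (x ^ (-(γ + 1)))) measurableSet_Ioi y]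
  congr 2
  ext x; simp

theorem setLIntegral_Iio_sub_left_rpow {γ s x : ℝ} (hγ : 0 < γ) (h : s < x) :
    ∫⁻ y in Iio s, ENNReal.ofReal ((x - y) ^ (-(γ + 1)))
      = ENNReal.ofReal ((x - s) ^ (-γ) / γ) := by
  rw [← setLIntegral_Ioi_rpow hγ (sub_pos.2 h),
    ← setLIntegral_comp_sub_left (fun x => ENNReal.ofReal (x ^ (-(γ + 1)))) measurableSet_Ioi x]
  congr 2
  ext x; simp

theorem ofReal_norm_div_rpow {E : Type*} [NormedAddCommGroup E] (a : E) {r : ℝ} (hr : 0 ≤ r)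
    (p : ℝ) : ENNReal.ofReal (‖a‖ / r ^ p) = ‖a‖ₑ * ENNReal.ofReal (r ^ (-p)) := by
  rw [div_eq_mul_inv, ← Real.rpow_neg hr, ENNReal.ofReal_mul (norm_nonneg a), ofReal_norm]

theorem measurable_ofReal_rpow_sub (p : ℝ) :
    Measurable fun q : ℝ × ℝ => ENNReal.ofReal ((q.1 - q.2) ^ p) :=
  ((measurable_fst.sub measurable_snd).pow_const p).ennreal_ofReal

theorem measurable_ofReal_const_sub_rpow (c p : ℝ) :
    Measurable fun y : ℝ => ENNReal.ofReal ((c - y) ^ p) :=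
  ((measurable_const_sub c).pow_const p).ennreal_ofReal

theorem measurable_ofReal_sub_const_rpow (c p : ℝ) :
    Measurable fun x : ℝ => ENNReal.ofReal ((x - c) ^ p) :=
  ((measurable_sub_const c).pow_const p).ennreal_ofReal

end Powers

/-! ### The fractional mass and the cost of truncation -/

section Mass

variable {E : Type*} [NormedAddCommGroup E]

/-- The integrand of `weylMass`. -/
def weylMassDensity (α : ℝ) (u : ℝ → E) (x : ℝ) : ℝ≥0∞ :=
  ‖u x‖ₑ * ENNReal.ofReal (x ^ (-α)) +
    ∫⁻ y in Ioo 0 x, ‖u x - u y‖ₑ * ENNReal.ofReal ((x - y) ^ (-(α + 1)))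

/-- The norm `∫_0^T (|u(x)| x^(-α) + ∫_0^x |u(x) - u(y)| (x-y)^(-α-1) dy) dx`, which controls the
`L¹` norm of the Weyl derivative of `u`. -/
def weylMass (α T : ℝ) (u : ℝ → E) : ℝ≥0∞ :=
  ∫⁻ x in Ioo 0 T, weylMassDensity α u x

theorem weylMassDensity_mono {F : Type*} [NormedAddCommGroup F] {α x : ℝ} {u : ℝ → E} {v : ℝ → F}
    (h : ‖u x‖ₑ ≤ ‖v x‖ₑ) (h' : ∀ y, ‖u x - u y‖ₑ ≤ ‖v x - v y‖ₑ) :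
    weylMassDensity α u x ≤ weylMassDensity α v x := by
  unfold weylMassDensity
  gcongr
  exact h' _

theorem weylMass_mono {F : Type*} [NormedAddCommGroup F] {α T : ℝ} {u : ℝ → E} {v : ℝ → F}
    (h : ∀ x, ‖u x‖ₑ ≤ ‖v x‖ₑ) (h' : ∀ x y, ‖u x - u y‖ₑ ≤ ‖v x - v y‖ₑ) :
    weylMass α T u ≤ weylMass α T v :=
  lintegral_mono fun x => weylMassDensity_mono (h x) (h' x)

theorem weylMass_congr_ae {α T : ℝ} {u v : ℝ → E} (h : u =ᵐ[volume] v) :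
    weylMass α T u = weylMass α T v := by
  refine lintegral_congr_ae (ae_restrict_of_ae ?_)
  filter_upwards [h] with x hx
  unfold weylMassDensity
  rw [hx]
  congr 1
  refine lintegral_congr_ae (ae_restrict_of_ae ?_)
  filter_upwards [h] with y hy
  rw [hy]

variable [MeasurableSpace E] [BorelSpace E]

/-- Truncating a function to an interval `(s,t)` costs the boundary terms `(x-s)^(-α)` and
`(t-x)^(-α)`. -/
theorem weylMass_indicator_le {α T s t : ℝ} (hα : 0 < α) (hs : 0 ≤ s)
    {φ : ℝ → E} (hφ : Measurable ((Ioo s t).indicator φ)) :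
    weylMass α T ((Ioo s t).indicator φ) ≤
      ∫⁻ x in Ioo s t, (ENNReal.ofReal (1 + α⁻¹) * (‖φ x‖ₑ * (ENNReal.ofReal ((x - s) ^ (-α)) +
        ENNReal.ofReal ((t - x) ^ (-α)))) +
        ∫⁻ y in Ioo s x, ‖φ x - φ y‖ₑ * ENNReal.ofReal ((x - y) ^ (-(α + 1)))) := by
  set u := (Ioo s t).indicator φ with hu
  have hu0 : ∀ x, x ∉ Ioo s t → u x = 0 := fun x hx => indicator_of_notMem hx _
  have hu1 : ∀ x, x ∈ Ioo s t → u x = φ x := fun x hx => indicator_of_mem hx _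
  have hαi : 0 < α⁻¹ := inv_pos.2 hα
  -- contribution of `x ∈ (s,t)`
  have hmid : ∀ x ∈ Ioo s t, weylMassDensity α u x ≤
      ENNReal.ofReal (1 + α⁻¹) * (‖φ x‖ₑ * ENNReal.ofReal ((x - s) ^ (-α))) +
        ∫⁻ y in Ioo s x, ‖φ x - φ y‖ₑ * ENNReal.ofReal ((x - y) ^ (-(α + 1))) := by
    intro x hx
    have hxs : 0 < x - s := sub_pos.2 hx.1
    have h1 : ENNReal.ofReal (x ^ (-α)) ≤ ENNReal.ofReal ((x - s) ^ (-α)) := by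
      apply ENNReal.ofReal_le_ofReal
      exact Real.rpow_le_rpow_of_nonpos hxs (by linarith) (by linarith)
    -- For `y ≤ s` the truncated function vanishes, so the increment is `φ x` itself and `∫_{-∞}^s
    -- (x-y)^(-α-1) dy = (x-s)^(-α)/α`.
    have h2 : ∫⁻ y in Ioo 0 x, ‖u x - u y‖ₑ * ENNReal.ofReal ((x - y) ^ (-(α + 1))) ≤
        ‖φ x‖ₑ * ENNReal.ofReal ((x - s) ^ (-α) / α) +
          ∫⁻ y in Ioo s x, ‖φ x - φ y‖ₑ * ENNReal.ofReal ((x - y) ^ (-(α + 1))) := by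
      have hsub : Ioo 0 x ⊆ Iic s ∪ Ioo s x := fun y hy => by
        rcases le_or_gt y s with h | h
        · exact Or.inl h
        · exact Or.inr ⟨h, hy.2⟩
      refine (lintegral_mono_set hsub).trans ((lintegral_union_le _ _ _).trans ?_)
      refine add_le_add (le_of_eq ?_) (le_of_eq ?_)
      · rw [← setLIntegral_Iio_sub_left_rpow hα hx.1, ← lintegral_const_mul _
          (measurable_ofReal_const_sub_rpow _ _),
          setLIntegral_congr Iio_ae_eq_Iic]
        refine setLIntegral_congr_fun measurableSet_Iic fun y hy => ?_
        rw [hu1 x hx, hu0 y (fun h => absurd h.1 (not_lt.2 hy)), sub_zero]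
      · refine setLIntegral_congr_fun measurableSet_Ioo fun y hy => ?_
        rw [hu1 x hx, hu1 y ⟨hy.1, hy.2.trans hx.2⟩]
    unfold weylMassDensity
    refine (add_le_add (mul_le_mul_right h1 _) h2).trans (le_of_eq ?_)
    rw [hu1 x hx, ← add_assoc, ENNReal.ofReal_add zero_le_one hαi.le, div_eq_inv_mul,
      ENNReal.ofReal_mul hαi.le, ENNReal.ofReal_one]
    ring
  -- contribution of `x ≥ t`
  have hend : ∀ x ∈ Ici t, weylMassDensity α u x ≤
      ∫⁻ y in Ioo s t, ‖φ y‖ₑ * ENNReal.ofReal ((x - y) ^ (-(α + 1))) := by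
    intro x hx
    unfold weylMassDensity
    rw [hu0 x (fun h => absurd h.2 (not_lt.2 hx)), enorm_zero, zero_mul, zero_add,
      ← lintegral_indicator measurableSet_Ioo, ← lintegral_indicator measurableSet_Ioo]
    refine lintegral_mono fun y => ?_
    by_cases hy : y ∈ Ioo s t
    · have hy' : y ∈ Ioo 0 x := ⟨hs.trans_lt hy.1, hy.2.trans_le hx⟩
      rw [indicator_of_mem hy, indicator_of_mem hy', hu1 y hy, zero_sub, enorm_neg]
    · rw [indicator_of_notMem hy]
      refine (indicator_apply_le' (fun _ => ?_) fun _ => le_rfl)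
      rw [hu0 y hy]; simp
  have hlow : ∀ x ∈ Iic s, weylMassDensity α u x = 0 := by
    intro x hx
    unfold weylMassDensity
    rw [hu0 x (fun h => absurd h.1 (not_lt.2 hx)), enorm_zero, zero_mul, zero_add]
    rw [setLIntegral_congr_fun (g := fun _ => 0) measurableSet_Ioo fun y hy => ?_]
    · simp
    · rw [hu0 y (fun h => absurd h.1 (not_lt.2 (hy.2.le.trans hx)))]; simp
  have hmeas2 : Measurable (fun q : ℝ × ℝ => ‖u q.2‖ₑ * ENNReal.ofReal ((q.1 - q.2) ^ (-(α + 1)))) :=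
    ((hφ.comp measurable_snd).enorm).mul (measurable_ofReal_rpow_sub _)
  -- By Tonelli, each `y ∈ (s,t)` is weighted by `∫_t^∞ (x-y)^(-α-1) dx = (t-y)^(-α)/α`. Only the
  -- truncation `u` is known to be measurable, so `φ` is replaced by `u` before the order of
  -- integration is exchanged.
  have hswap : ∫⁻ x in Ici t, ∫⁻ y in Ioo s t, ‖φ y‖ₑ * ENNReal.ofReal ((x - y) ^ (-(α + 1)))
      ≤ ∫⁻ y in Ioo s t, ENNReal.ofReal (1 + α⁻¹) * (‖φ y‖ₑ * ENNReal.ofReal ((t - y) ^ (-α))) := by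
    calc ∫⁻ x in Ici t, ∫⁻ y in Ioo s t, ‖φ y‖ₑ * ENNReal.ofReal ((x - y) ^ (-(α + 1)))
        = ∫⁻ x in Ici t, ∫⁻ y in Ioo s t, ‖u y‖ₑ * ENNReal.ofReal ((x - y) ^ (-(α + 1))) := by
          refine lintegral_congr fun x => setLIntegral_congr_fun measurableSet_Ioo fun y hy => ?_
          rw [hu1 y hy]
      _ = ∫⁻ y in Ioo s t, ∫⁻ x in Ici t, ‖u y‖ₑ * ENNReal.ofReal ((x - y) ^ (-(α + 1))) :=
          lintegral_lintegral_swap hmeas2.aemeasurable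
      _ ≤ _ := by
          refine setLIntegral_mono' measurableSet_Ioo fun y hy => ?_
          rw [lintegral_const_mul _ (measurable_ofReal_sub_const_rpow _ _),
            ← setLIntegral_congr (Ioi_ae_eq_Ici), setLIntegral_Ioi_sub_right_rpow hα hy.2, hu1 y hy,
            mul_left_comm, div_eq_inv_mul, ENNReal.ofReal_mul hαi.le]
          gcongr
          linarith
  have hsub : Ioo 0 T ⊆ Iic s ∪ (Ioo s t ∪ Ici t) := fun x _ => by
    rcases le_or_gt x s with h | h
    · exact Or.inl h
    · rcases lt_or_ge x t with h' | h'
      · exact Or.inr (Or.inl ⟨h, h'⟩)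
      · exact Or.inr (Or.inr h')
  unfold weylMass
  calc ∫⁻ x in Ioo 0 T, weylMassDensity α u x
      ≤ (∫⁻ x in Iic s, weylMassDensity α u x) + ((∫⁻ x in Ioo s t, weylMassDensity α u x) +
          ∫⁻ x in Ici t, weylMassDensity α u x) :=
        (lintegral_mono_set hsub).trans ((lintegral_union_le _ _ _).trans
          (add_le_add le_rfl (lintegral_union_le _ _ _)))
    _ ≤ 0 + ((∫⁻ x in Ioo s t, (ENNReal.ofReal (1 + α⁻¹) * (‖φ x‖ₑ * ENNReal.ofReal ((x - s) ^ (-α))) +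
        ∫⁻ y in Ioo s x, ‖φ x - φ y‖ₑ * ENNReal.ofReal ((x - y) ^ (-(α + 1))))) +
        ∫⁻ y in Ioo s t, ENNReal.ofReal (1 + α⁻¹) * (‖φ y‖ₑ * ENNReal.ofReal ((t - y) ^ (-α)))) := by
        refine add_le_add ?_ (add_le_add ?_ ?_)
        · rw [setLIntegral_congr_fun (g := fun _ => 0) measurableSet_Iic hlow]; simp
        · exact setLIntegral_mono' measurableSet_Ioo hmid
        · exact (setLIntegral_mono' measurableSet_Ici hend).trans hswap
    _ = _ := by
        have hm : Measurable fun y =>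
            ENNReal.ofReal (1 + α⁻¹) * (‖u y‖ₑ * ENNReal.ofReal ((t - y) ^ (-α))) :=
          measurable_const.mul (hφ.enorm.mul
            (measurable_ofReal_const_sub_rpow _ _))
        rw [zero_add, setLIntegral_congr_fun (g := fun y =>
            ENNReal.ofReal (1 + α⁻¹) * (‖u y‖ₑ * ENNReal.ofReal ((t - y) ^ (-α))))
            (f := fun y => ENNReal.ofReal (1 + α⁻¹) * (‖φ y‖ₑ * ENNReal.ofReal ((t - y) ^ (-α))))
            measurableSet_Ioo (fun y hy => by simp only; rw [hu1 y hy]),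
          ← lintegral_add_right _ hm]
        refine setLIntegral_congr_fun measurableSet_Ioo fun y hy => ?_
        rw [hu1 y hy]
        ring

variable [SecondCountableTopology E]

theorem measurable_enorm_sub_mul_rpow {u : ℝ → E} (hu : Measurable u) (p : ℝ) :
    Measurable fun q : ℝ × ℝ => ‖u q.1 - u q.2‖ₑ * ENNReal.ofReal ((q.1 - q.2) ^ p) :=
  (((hu.comp measurable_fst).sub (hu.comp measurable_snd)).enorm).mul
    (measurable_ofReal_rpow_sub p)

theorem measurable_enorm_const_sub_mul_rpow {u : ℝ → E} (hu : Measurable u) (x p : ℝ) :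
    Measurable fun y : ℝ => ‖u x - u y‖ₑ * ENNReal.ofReal ((x - y) ^ p) :=
  (measurable_enorm_sub_mul_rpow hu p).comp measurable_prodMk_left

theorem measurable_setLIntegral_Ioo {F : ℝ × ℝ → ℝ≥0∞} (hF : Measurable F) (a : ℝ) :
    Measurable fun x => ∫⁻ y in Ioo a x, F (x, y) := by
  have : (fun x => ∫⁻ y in Ioo a x, F (x, y))
      = fun x => ∫⁻ y, ({q : ℝ × ℝ | a < q.2 ∧ q.2 < q.1}.indicator F) (x, y) := by
    funext x
    rw [← lintegral_indicator measurableSet_Ioo]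
    rfl
  rw [this]
  refine Measurable.lintegral_prod_right (hF.indicator ?_)
  exact (measurableSet_lt measurable_const measurable_snd).inter
    (measurableSet_lt measurable_snd measurable_fst)

theorem measurable_weylMassDensity {α : ℝ} {u : ℝ → E} (hu : Measurable u) :
    Measurable (weylMassDensity α u) :=
  (hu.enorm.mul (measurable_id.pow_const _).ennreal_ofReal).add
    (measurable_setLIntegral_Ioo (measurable_enorm_sub_mul_rpow hu _) 0)

theorem weylMass_add_le {α T : ℝ} {u v : ℝ → E} (hu : Measurable u) :
    weylMass α T (fun x => u x + v x) ≤ weylMass α T u + weylMass α T v := by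
  unfold weylMass
  rw [← lintegral_add_left (measurable_weylMassDensity hu)]
  refine lintegral_mono fun x => ?_
  have h2 : ∫⁻ y in Ioo 0 x, ‖u x + v x - (u y + v y)‖ₑ * ENNReal.ofReal ((x - y) ^ (-(α + 1)))
      ≤ (∫⁻ y in Ioo 0 x, ‖u x - u y‖ₑ * ENNReal.ofReal ((x - y) ^ (-(α + 1)))) +
        ∫⁻ y in Ioo 0 x, ‖v x - v y‖ₑ * ENNReal.ofReal ((x - y) ^ (-(α + 1))) := by
    rw [← lintegral_add_left (measurable_enorm_const_sub_mul_rpow hu x (-(α + 1)))]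
    refine lintegral_mono fun y => ?_
    rw [← add_mul, add_sub_add_comm]
    gcongr
    exact enorm_add_le _ _
  have h1 : ‖u x + v x‖ₑ * ENNReal.ofReal (x ^ (-α)) ≤
      ‖u x‖ₑ * ENNReal.ofReal (x ^ (-α)) + ‖v x‖ₑ * ENNReal.ofReal (x ^ (-α)) := by
    rw [← add_mul]
    gcongr
    exact enorm_add_le _ _
  refine (add_le_add h1 h2).trans (le_of_eq ?_)
  unfold weylMassDensity
  ring

theorem weylMass_sub_le {α T : ℝ} {u v : ℝ → E} (hu : Measurable u) :
    weylMass α T (fun x => u x - v x) ≤ weylMass α T u + weylMass α T v := by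
  have h : weylMass α T (fun x => -v x) ≤ weylMass α T v := by
    refine weylMass_mono (fun x => by simp) fun x y => ?_
    rw [← neg_sub', enorm_neg]
  simpa [sub_eq_add_neg] using (weylMass_add_le hu).trans (add_le_add le_rfl h)

end Mass

/-! ### Left Weyl derivatives controlled by the mass -/

section WeylLeft

variable {α T : ℝ}

theorem enorm_weylLeft_le (hα0 : 0 ≤ α) (hα1 : α ≤ 1) (u : ℝ → ℝ) {x : ℝ} (hx : 0 < x) :
    ‖weylLeft α u x‖ₑ ≤ ENNReal.ofReal (Real.Gamma (1 - α))⁻¹ * weylMassDensity α u x := by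
  have hG : 0 ≤ (Real.Gamma (1 - α))⁻¹ := inv_nonneg.2 (Real.Gamma_nonneg_of_nonneg (by linarith))
  unfold weylLeft weylMassDensity
  rw [enorm_smul, Real.enorm_of_nonneg hG]
  gcongr
  refine (enorm_add_le _ _).trans (add_le_add ?_ ?_)
  · rw [enorm_smul, Real.enorm_of_nonneg (inv_nonneg.2 (Real.rpow_nonneg hx.le _)),
      Real.rpow_neg hx.le, mul_comm]
  · rw [enorm_smul, Real.enorm_of_nonneg hα0]
    calc ENNReal.ofReal α * _ ≤ 1 * _ := by
          gcongr
          exact ENNReal.ofReal_le_one.2 hα1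
      _ ≤ _ := by
          rw [one_mul, intervalIntegral.integral_of_le hx.le, integral_Ioc_eq_integral_Ioo]
          refine (enorm_integral_le_lintegral_enorm _).trans (le_of_eq ?_)
          refine setLIntegral_congr_fun measurableSet_Ioo fun y hy => ?_
          have : 0 ≤ x - y := by linarith [hy.2]
          rw [enorm_smul, Real.enorm_of_nonneg (inv_nonneg.2 (Real.rpow_nonneg this _)),
            Real.rpow_neg this, mul_comm]

theorem aestronglyMeasurable_weylLeft {u : ℝ → ℝ} (hu : Measurable u) :
    AEStronglyMeasurable (weylLeft α u) (volume.restrict (Ioo 0 T)) := by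
  have hF : Measurable fun q : ℝ × ℝ => {q : ℝ × ℝ | 0 < q.2 ∧ q.2 < q.1}.indicator
      (fun q : ℝ × ℝ => ((q.1 - q.2) ^ (α + 1))⁻¹ * (u q.1 - u q.2)) q := by
    refine Measurable.indicator ?_ ((measurableSet_lt measurable_const measurable_snd).inter
      (measurableSet_lt measurable_snd measurable_fst))
    fun_prop
  have hI := hF.stronglyMeasurable.integral_prod_right' (ν := (volume : Measure ℝ))
  have : AEStronglyMeasurable (fun x => (Real.Gamma (1 - α))⁻¹ * ((x ^ α)⁻¹ * u x + α *
      ∫ y, {q : ℝ × ℝ | 0 < q.2 ∧ q.2 < q.1}.indicator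
        (fun q : ℝ × ℝ => ((q.1 - q.2) ^ (α + 1))⁻¹ * (u q.1 - u q.2)) (x, y)))
      (volume.restrict (Ioo 0 T)) := by
    have := hI.measurable
    exact Measurable.aestronglyMeasurable (by fun_prop)
  refine this.congr ?_
  filter_upwards [ae_restrict_mem measurableSet_Ioo] with x hx
  unfold weylLeft
  simp only [smul_eq_mul]
  rw [intervalIntegral.integral_of_le hx.1.le, integral_Ioc_eq_integral_Ioo,
    ← integral_indicator measurableSet_Ioo]
  rfl

theorem ae_integrableOn_weylLeft {u : ℝ → ℝ} (hu : Measurable u) (hR : weylMass α T u < ∞) :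
    ∀ᵐ x ∂volume.restrict (Ioo 0 T),
      IntegrableOn (fun y => (u x - u y) / (x - y) ^ (α + 1)) (Ioo 0 x) := by
  have h := ae_lt_top (measurable_weylMassDensity hu) hR.ne
  filter_upwards [h] with x hx
  refine ⟨Measurable.aestronglyMeasurable (by fun_prop), ?_⟩
  refine lt_of_le_of_lt (le_of_eq ?_) (lt_of_le_of_lt le_add_self hx)
  refine setLIntegral_congr_fun measurableSet_Ioo fun y hy => ?_
  have : 0 ≤ x - y := by linarith [hy.2]
  simp only
  rw [div_eq_mul_inv, enorm_mul, ← Real.rpow_neg this,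
    Real.enorm_of_nonneg (Real.rpow_nonneg this _)]

/-- Additivity can fail where a singular integral diverges, since its value is then the default `0`.
Finite mass makes these points a null set. -/
theorem ae_weylLeft_sub {u v : ℝ → ℝ} (hu : Measurable u) (hv : Measurable v)
    (hRu : weylMass α T u < ∞) (hRv : weylMass α T v < ∞) :
    ∀ᵐ x ∂volume.restrict (Ioo 0 T),
      weylLeft α (fun x => u x - v x) x = weylLeft α u x - weylLeft α v x := by
  filter_upwards [ae_integrableOn_weylLeft hu hRu, ae_integrableOn_weylLeft hv hRv,
    ae_restrict_mem measurableSet_Ioo] with x h1 h2 hx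
  unfold weylLeft
  simp only [smul_eq_mul]
  rw [intervalIntegral.integral_of_le hx.1.le, intervalIntegral.integral_of_le hx.1.le,
    intervalIntegral.integral_of_le hx.1.le, integral_Ioc_eq_integral_Ioo,
    integral_Ioc_eq_integral_Ioo, integral_Ioc_eq_integral_Ioo]
  have : ∫ y in Ioo 0 x, ((x - y) ^ (α + 1))⁻¹ * (u x - v x - (u y - v y)) =
      (∫ y in Ioo 0 x, ((x - y) ^ (α + 1))⁻¹ * (u x - u y)) -
        ∫ y in Ioo 0 x, ((x - y) ^ (α + 1))⁻¹ * (v x - v y) := by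
    rw [← integral_sub]
    · congr 1; ext y; ring
    · exact h1.congr_fun (fun y _ => by simp only; ring) measurableSet_Ioo
    · exact h2.congr_fun (fun y _ => by simp only; ring) measurableSet_Ioo
  rw [this]
  ring

end WeylLeft

/-! ### The integrator: left limits and the right Weyl derivative -/

section Integrator

variable {E : Type*} [NormedAddCommGroup E] {α T : ℝ}

theorem integratorNorm_pointwise (g : ℝ → E) {s t : ℝ} (hs : 0 < s) (hst : s < t) (ht : t < T) :
    ENNReal.ofReal (‖g t - g s‖ / (t - s) ^ (1 - α)) +
      ∫⁻ y in Ioo s t, ENNReal.ofReal (‖g y - g s‖ / (y - s) ^ (2 - α)) ≤ integratorNorm α T g := by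
  unfold integratorNorm
  exact le_iSup_of_le s (le_iSup_of_le t (le_iSup_of_le ⟨hs, hst, ht⟩ le_rfl))

theorem integratorNorm_mono {F : Type*} [NormedAddCommGroup F] {g : ℝ → E} {g' : ℝ → F}
    (h : ∀ s t, ‖g t - g s‖ ≤ ‖g' t - g' s‖) : integratorNorm α T g ≤ integratorNorm α T g' := by
  unfold integratorNorm
  refine iSup_mono fun s => iSup_mono fun t => iSup_mono fun hst => ?_
  have h1 : 0 < t - s := sub_pos.2 hst.2.1
  refine add_le_add (ENNReal.ofReal_le_ofReal ?_)
    (setLIntegral_mono' measurableSet_Ioo fun y hy => ENNReal.ofReal_le_ofReal ?_)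
  · exact div_le_div_of_nonneg_right (h s t) (Real.rpow_nonneg h1.le _)
  · exact div_le_div_of_nonneg_right (h s y) (Real.rpow_nonneg (sub_nonneg.2 hy.1.le) _)

theorem norm_sub_le_of_integratorNorm {g : ℝ → E} (hg : integratorNorm α T g < ∞) {s t : ℝ}
    (hs : 0 < s) (hst : s < t) (ht : t < T) :
    ‖g t - g s‖ ≤ (integratorNorm α T g).toReal * (t - s) ^ (1 - α) := by
  have h := le_self_add.trans (integratorNorm_pointwise (α := α) g hs hst ht)
  rw [ENNReal.ofReal_le_iff_le_toReal hg.ne] at h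
  exact (div_le_iff₀ (Real.rpow_pos_of_pos (sub_pos.2 hst) _)).1 h

/-- The supremum in `integratorNorm` runs over `t < T` only; monotone convergence along `t n ↑ T`
reaches the end point. -/
theorem setLIntegral_le_integratorNorm (g : ℝ → E) {x : ℝ} (hx : 0 < x) (hxT : x < T) :
    ∫⁻ y in Ioo x T, ENNReal.ofReal (‖g y - g x‖ / (y - x) ^ (2 - α)) ≤ integratorNorm α T g := by
  obtain ⟨t, ht, htm, htT⟩ := exists_seq_strictMono_tendsto' hxT
  have hU : Ioo x T = ⋃ n, Ioo x (t n) := by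
    ext y
    simp only [mem_Ioo, mem_iUnion]
    constructor
    · rintro ⟨h1, h2⟩
      obtain ⟨n, hn⟩ := (htT.eventually (lt_mem_nhds h2)).exists
      exact ⟨n, h1, hn⟩
    · rintro ⟨n, h1, h2⟩
      exact ⟨h1, h2.trans (htm n).2⟩
  rw [hU, setLIntegral_iUnion_of_directed]
  · exact iSup_le fun n => le_add_self.trans
      (integratorNorm_pointwise (α := α) g hx (htm n).1 (htm n).2)
  · exact Monotone.directed_le fun i j hij => Ioo_subset_Ioo_right (ht.monotone hij)

theorem measurable_indicator_of_domRestrict {F : Type*} [MeasurableSpace F] [Zero F] {s : Set ℝ}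
    (hs : MeasurableSet s) {f : ℝ → F} (hf : Measurable (s.domRestrict f)) :
    Measurable (s.indicator f) := by
  refine measurable_of_restrict_of_restrict_compl hs ?_ ?_
  · rwa [show s.domRestrict (s.indicator f) = s.domRestrict f from
      funext fun x => indicator_of_mem x.2 f]
  · rw [show sᶜ.domRestrict (s.indicator f) = fun _ => 0 from
      funext fun x => indicator_of_notMem x.2 f]
    exact measurable_const

theorem weylRight_subLeftLim [NormedSpace ℝ E] (g : ℝ → E) (b x : ℝ) :
    weylRight (1 - α) b (subLeftLim g b) x = (Real.Gamma α)⁻¹ •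
      (((b - x) ^ (1 - α))⁻¹ • (g x - Function.leftLim g b) +
        (1 - α) • ∫ y in x..b, ((y - x) ^ (2 - α))⁻¹ • (g x - g y)) := by
  unfold weylRight subLeftLim
  rw [show 1 - α + 1 = 2 - α by ring, show 1 - (1 - α) = α by ring]
  simp only [sub_sub_sub_cancel_right]

variable [MeasurableSpace E]

theorem MemIntegrator.exists_tendsto [CompleteSpace E] (hα : α < 1) {g : ℝ → E}
    (hg : MemIntegrator α T g) {t : ℝ} (ht : 0 < t) (htT : t ≤ T) :
    ∃ l, Filter.Tendsto g (nhdsWithin t (Iio t)) (nhds l) := by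
  refine cauchy_map_iff_exists_tendsto.1 (Metric.cauchy_iff.2 ⟨inferInstance, fun ε hε => ?_⟩)
  have hc : Filter.Tendsto (fun r : ℝ => (integratorNorm α T g).toReal * r ^ (1 - α))
      (nhdsWithin 0 (Ioi 0)) (nhds 0) := by
    have : ContinuousAt (fun r : ℝ => (integratorNorm α T g).toReal * r ^ (1 - α)) 0 :=
      continuousAt_const.mul (Real.continuousAt_rpow_const _ _ (Or.inr (by linarith)))
    have h0 := this.tendsto
    simp only [Real.zero_rpow (show (1 - α) ≠ 0 by linarith), mul_zero] at h0
    exact h0.mono_left nhdsWithin_le_nhds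
  obtain ⟨r, hr0, hr⟩ := mem_nhdsGT_iff_exists_Ioo_subset.1 (hc.eventually (gt_mem_nhds hε))
  have hr0 : 0 < r := hr0
  -- The Hölder bound holds only between points of the open interval `(0,T)`; the term `t / 2` keeps
  -- `a` positive.
  set a := max (t / 2) (t - r) with ha
  have hat : a < t := max_lt (by linarith) (by linarith)
  have ha0 : 0 < a := lt_max_of_lt_left (by linarith)
  have har : t - r ≤ a := le_max_right _ _
  refine ⟨g '' Ioo a t, Filter.image_mem_map (Ioo_mem_nhdsLT hat), ?_⟩
  have key : ∀ x ∈ Ioo a t, ∀ y ∈ Ioo a t, x < y → ‖g y - g x‖ < ε := fun x hx y hy hxy =>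
    (norm_sub_le_of_integratorNorm hg.2 (ha0.trans hx.1) hxy (hy.2.trans_le htT)).trans_lt
      (hr ⟨sub_pos.2 hxy, by linarith [hx.1, hy.2]⟩)
  rintro _ ⟨x, hx, rfl⟩ _ ⟨y, hy, rfl⟩
  rcases lt_trichotomy x y with h | h | h
  · rw [dist_comm, dist_eq_norm]; exact key x hx y hy h
  · rw [h, dist_self]; exact hε
  · rw [dist_eq_norm]; exact key y hy x hx h

theorem MemIntegrator.tendsto_leftLim [CompleteSpace E] (hα : α < 1) {g : ℝ → E}
    (hg : MemIntegrator α T g) {t : ℝ} (ht : 0 < t) (htT : t ≤ T) :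
    Filter.Tendsto g (nhdsWithin t (Iio t)) (nhds (Function.leftLim g t)) := by
  obtain ⟨l, hl⟩ := hg.exists_tendsto hα ht htT
  rwa [leftLim_eq_of_tendsto hl]

/-- Inside `(0,T)` the integrator is Hölder continuous, so `g(t-)` is `g(t)`. At `T` itself the left
limit exists but may differ from `g(T)`. -/
theorem MemIntegrator.leftLim_eq (hα : α < 1) {g : ℝ → E}
    (hg : MemIntegrator α T g) {t : ℝ} (ht : 0 < t) (htT : t < T) :
    Function.leftLim g t = g t := by
  refine leftLim_eq_of_tendsto ?_
  rw [tendsto_iff_norm_sub_tendsto_zero]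
  have hc : Filter.Tendsto (fun s : ℝ => (integratorNorm α T g).toReal * (t - s) ^ (1 - α))
      (nhdsWithin t (Iio t)) (nhds 0) := by
    have : ContinuousAt (fun s : ℝ => (integratorNorm α T g).toReal * (t - s) ^ (1 - α)) t :=
      continuousAt_const.mul ((continuousAt_const.sub continuousAt_id).rpow_const
        (Or.inr (by linarith)))
    have h0 := this.tendsto
    simp only [sub_self, Real.zero_rpow (show (1 - α) ≠ 0 by linarith), mul_zero] at h0
    exact h0.mono_left nhdsWithin_le_nhds
  refine squeeze_zero' (Filter.Eventually.of_forall fun _ => norm_nonneg _) ?_ hc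
  filter_upwards [Ioo_mem_nhdsLT ht] with s hs
  rw [norm_sub_rev]
  exact norm_sub_le_of_integratorNorm hg.2 hs.1 hs.2 htT

variable [NormedSpace ℝ E]

/-- Since `g(t-) = g(t)` for `t < T`, the two terms of the Weyl derivative are dominated by the two
terms of `integratorNorm`. -/
theorem MemIntegrator.Lam_lt_top (hα0 : 0 < α) (hα : α < 1) {g : ℝ → E}
    (hg : MemIntegrator α T g) : Lam α T g < ∞ := by
  refine ENNReal.mul_lt_top ENNReal.ofReal_lt_top (lt_of_le_of_lt ?_
    (ENNReal.mul_lt_top (ENNReal.ofReal_lt_top (r := (Real.Gamma α)⁻¹)) hg.2))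
  refine iSup_le fun s => iSup_le fun t => iSup_le fun hst => ?_
  have hts : 0 < t - s := sub_pos.2 hst.2.1
  rw [weylRight_subLeftLim, hg.leftLim_eq hα (hst.1.trans hst.2.1) hst.2.2, enorm_smul,
    Real.enorm_of_nonneg (inv_nonneg.2 (Real.Gamma_pos_of_pos hα0).le)]
  gcongr
  refine le_trans ?_ (integratorNorm_pointwise (α := α) g hst.1 hst.2.1 hst.2.2)
  refine (enorm_add_le _ _).trans (add_le_add ?_ ?_)
  · rw [ofReal_norm_div_rpow _ hts.le, enorm_smul, ← Real.rpow_neg hts.le,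
      Real.enorm_of_nonneg (Real.rpow_nonneg hts.le _), mul_comm, ← enorm_neg, neg_sub]
  · rw [enorm_smul, Real.enorm_of_nonneg (by linarith)]
    calc ENNReal.ofReal (1 - α) * _ ≤ 1 * _ := by
          gcongr
          exact ENNReal.ofReal_le_one.2 (by linarith)
      _ ≤ _ := by
          rw [one_mul, intervalIntegral.integral_of_le hst.2.1.le, integral_Ioc_eq_integral_Ioo]
          refine (enorm_integral_le_lintegral_enorm _).trans (le_of_eq ?_)
          refine setLIntegral_congr_fun measurableSet_Ioo fun y hy => ?_
          have : 0 ≤ y - s := by linarith [hy.1]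
          rw [ofReal_norm_div_rpow _ this, enorm_smul, ← Real.rpow_neg this,
            Real.enorm_of_nonneg (Real.rpow_nonneg this _), mul_comm, ← enorm_neg, neg_sub]

variable [BorelSpace E] [SecondCountableTopology E]

theorem MemIntegrator.integrableOn {g : ℝ → E} (hg : MemIntegrator α T g) {x : ℝ} (hx : 0 < x)
    (hxT : x < T) : IntegrableOn (fun y => ((y - x) ^ (2 - α))⁻¹ • (g x - g y)) (Ioo x T) := by
  have hm := measurable_indicator_of_domRestrict measurableSet_Icc hg.1
  constructor
  · have : Measurable fun y => ((y - x) ^ (2 - α))⁻¹ • (g x - (Icc 0 T).indicator g y) := by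
      fun_prop
    refine this.aestronglyMeasurable.congr ?_
    filter_upwards [ae_restrict_mem measurableSet_Ioo] with y hy
    rw [indicator_of_mem (show y ∈ Icc 0 T from ⟨(hx.trans hy.1).le, hy.2.le⟩)]
  · refine lt_of_le_of_lt (le_of_eq ?_) (lt_of_le_of_lt
      (setLIntegral_le_integratorNorm (α := α) g hx hxT) hg.2)
    refine setLIntegral_congr_fun measurableSet_Ioo fun y hy => ?_
    have : 0 ≤ y - x := by linarith [hy.1]
    simp only
    rw [ofReal_norm_div_rpow _ this, enorm_smul, ← Real.rpow_neg this,
      Real.enorm_of_nonneg (Real.rpow_nonneg this _), mul_comm, ← enorm_neg, neg_sub]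

/-- `Λ_α(g)` only sees right end points `t < T`, whereas the Stieltjes integral uses `T`. The bound
passes to the limit `t ↑ T`, because `g(t-) = g(t) → g(T-)` and the primitive of the singular
integrand is continuous up to `T`. -/
theorem MemIntegrator.enorm_weylRight_le [CompleteSpace E] (hα : α < 1)
    {g : ℝ → E} (hg : MemIntegrator α T g) {x : ℝ} (hx : 0 < x) (hxT : x < T) :
    ‖weylRight (1 - α) T (subLeftLim g T) x‖ₑ ≤
      ENNReal.ofReal (Real.Gamma (1 - α)) * Lam α T g := by
  have hG : 0 < Real.Gamma (1 - α) := Real.Gamma_pos_of_pos (by linarith)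
  have hsup : ∀ t, x < t → t < T → ‖weylRight (1 - α) t (subLeftLim g t) x‖ₑ ≤
      ENNReal.ofReal (Real.Gamma (1 - α)) * Lam α T g := by
    intro t h1 h2
    unfold Lam
    rw [← mul_assoc, ← ENNReal.ofReal_mul hG.le, mul_inv_cancel₀ hG.ne', ENNReal.ofReal_one,
      one_mul]
    exact le_iSup_of_le x (le_iSup_of_le t (le_iSup_of_le ⟨hx, h1, h2⟩ le_rfl))
  have hint : IntegrableOn (fun y => ((y - x) ^ (2 - α))⁻¹ • (g x - g y)) (uIcc x T) := by
    rw [uIcc_of_le hxT.le, integrableOn_Icc_iff_integrableOn_Ioo]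
    exact hg.integrableOn hx hxT
  have hcont := intervalIntegral.continuousOn_primitive_interval hint T right_mem_uIcc
  have hT : Filter.Tendsto (fun t => weylRight (1 - α) t (subLeftLim g t) x)
      (nhdsWithin T (Iio T)) (nhds (weylRight (1 - α) T (subLeftLim g T) x)) := by
    rw [weylRight_subLeftLim]
    have h2 : Filter.Tendsto (fun t => (Real.Gamma α)⁻¹ •
      (((t - x) ^ (1 - α))⁻¹ • (g x - g t) +
        (1 - α) • ∫ y in x..t, ((y - x) ^ (2 - α))⁻¹ • (g x - g y)))
        (nhdsWithin T (Iio T)) (nhds ((Real.Gamma α)⁻¹ •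
      (((T - x) ^ (1 - α))⁻¹ • (g x - Function.leftLim g T) +
        (1 - α) • ∫ y in x..T, ((y - x) ^ (2 - α))⁻¹ • (g x - g y)))) := by
      refine Filter.Tendsto.const_smul (Filter.Tendsto.add (Filter.Tendsto.smul ?_ ?_)
        (Filter.Tendsto.const_smul ?_ _)) _
      · have hTx : 0 < T - x := sub_pos.2 hxT
        have : ContinuousAt (fun t => ((t - x) ^ (1 - α))⁻¹) T :=
          ContinuousAt.inv₀ ((continuousAt_id.sub continuousAt_const).rpow_const
            (Or.inl hTx.ne')) (Real.rpow_pos_of_pos hTx _).ne'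
        exact this.tendsto.mono_left nhdsWithin_le_nhds
      · exact tendsto_const_nhds.sub (hg.tendsto_leftLim hα (hx.trans hxT) le_rfl)
      · refine hcont.tendsto.mono_left ?_
        rw [uIcc_of_le hxT.le]
        exact nhdsWithin_le_of_mem (Filter.mem_of_superset (Ioo_mem_nhdsLT hxT)
          Ioo_subset_Icc_self)
    refine h2.congr' ?_
    filter_upwards [Ioo_mem_nhdsLT hxT] with t ht
    rw [weylRight_subLeftLim, hg.leftLim_eq hα (hx.trans ht.1) ht.2]
  refine le_of_tendsto hT.enorm ?_
  filter_upwards [Ioo_mem_nhdsLT hxT] with t ht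
  exact hsup t ht.1 ht.2

theorem MemIntegrator.aestronglyMeasurable_weylRight {g : ℝ → ℝ} (hg : MemIntegrator α T g) :
    AEStronglyMeasurable (weylRight (1 - α) T (subLeftLim g T)) (volume.restrict (Ioo 0 T)) := by
  have hm := measurable_indicator_of_domRestrict measurableSet_Icc hg.1
  set u := (Icc 0 T).indicator g with hu
  have hF : Measurable fun q : ℝ × ℝ => {q : ℝ × ℝ | q.1 < q.2 ∧ q.2 < T}.indicator
      (fun q : ℝ × ℝ => ((q.2 - q.1) ^ (2 - α))⁻¹ * (u q.1 - u q.2)) q := by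
    refine Measurable.indicator ?_ ((measurableSet_lt measurable_fst measurable_snd).inter
      (measurableSet_lt measurable_snd measurable_const))
    fun_prop
  have hI := hF.stronglyMeasurable.integral_prod_right' (ν := (volume : Measure ℝ))
  have : AEStronglyMeasurable (fun x => (Real.Gamma α)⁻¹ * (((T - x) ^ (1 - α))⁻¹ *
      (u x - Function.leftLim g T) + (1 - α) *
      ∫ y, {q : ℝ × ℝ | q.1 < q.2 ∧ q.2 < T}.indicator
      (fun q : ℝ × ℝ => ((q.2 - q.1) ^ (2 - α))⁻¹ * (u q.1 - u q.2)) (x, y)))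
      (volume.restrict (Ioo 0 T)) := by
    have := hI.measurable
    exact Measurable.aestronglyMeasurable (by fun_prop)
  refine this.congr ?_
  filter_upwards [ae_restrict_mem measurableSet_Ioo] with x hx
  rw [weylRight_subLeftLim]
  simp only [smul_eq_mul]
  have hux : u x = g x := indicator_of_mem (Ioo_subset_Icc_self hx) _
  rw [intervalIntegral.integral_of_le hx.2.le, integral_Ioc_eq_integral_Ioo, hux,
    ← integral_indicator measurableSet_Ioo]
  congr 4
  funext y
  by_cases hy : y ∈ Ioo x T
  · rw [indicator_of_mem hy, indicator_of_mem (show (x, y) ∈ {q : ℝ × ℝ | q.1 < q.2 ∧ q.2 < T}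
      from hy)]
    simp only
    rw [hux, show u y = g y from
      indicator_of_mem (show y ∈ Icc 0 T from ⟨(hx.1.trans hy.1).le, hy.2.le⟩) _]
  · rw [indicator_of_notMem hy, indicator_of_notMem
      (show (x, y) ∉ {q : ℝ × ℝ | q.1 < q.2 ∧ q.2 < T} from hy)]

end Integrator

/-! ### The basic estimate, linearity and existence of the scalar integral -/

section Stieltjes

variable {α T : ℝ} {u v g : ℝ → ℝ} {L : ℝ≥0∞}

/-- The factor `Γ(1-α)⁻¹` of the left derivative cancels `Γ(1-α)` in the bound for the right one.
The number `L` is kept abstract so that a scalar component of `g` can be estimated by `Λ_α` of the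
whole vector. -/
theorem lintegral_stieltjesIntegrand_le (hα0 : 0 ≤ α) (hα1 : α < 1)
    (hL : ∀ x, 0 < x → x < T → ‖weylRight (1 - α) T (subLeftLim g T) x‖ₑ ≤
      ENNReal.ofReal (Real.Gamma (1 - α)) * L) (hu : Measurable u) :
    ∫⁻ x in Ioo 0 T, ‖stieltjesIntegrand α T u g x‖ₑ ≤ L * weylMass α T u := by
  have hG : 0 < Real.Gamma (1 - α) := Real.Gamma_pos_of_pos (by linarith)
  unfold weylMass
  rw [← lintegral_const_mul _ (measurable_weylMassDensity hu)]
  refine setLIntegral_mono' measurableSet_Ioo fun x hx => ?_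
  unfold stieltjesIntegrand
  rw [enorm_mul]
  refine (mul_le_mul' (enorm_weylLeft_le hα0 hα1.le u hx.1) (hL x hx.1 hx.2)).trans (le_of_eq ?_)
  calc _ = (ENNReal.ofReal (Real.Gamma (1 - α))⁻¹ * ENNReal.ofReal (Real.Gamma (1 - α))) *
        (L * weylMassDensity α u x) := by ring
    _ = _ := by
      rw [← ENNReal.ofReal_mul (inv_nonneg.2 hG.le), inv_mul_cancel₀ hG.ne', ENNReal.ofReal_one,
        one_mul]

theorem integrableOn_stieltjesIntegrand (hα0 : 0 ≤ α) (hα1 : α < 1)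
    (hL : ∀ x, 0 < x → x < T → ‖weylRight (1 - α) T (subLeftLim g T) x‖ₑ ≤
      ENNReal.ofReal (Real.Gamma (1 - α)) * L) (hL' : L < ∞) (hg : MemIntegrator α T g)
    (hu : Measurable u) (hR : weylMass α T u < ∞) :
    IntegrableOn (stieltjesIntegrand α T u g) (Ioo 0 T) :=
  ⟨(aestronglyMeasurable_weylLeft hu).mul hg.aestronglyMeasurable_weylRight,
    (lintegral_stieltjesIntegrand_le hα0 hα1 hL hu).trans_lt (ENNReal.mul_lt_top hL' hR)⟩

theorem enorm_stieltjes_le (hα0 : 0 ≤ α) (hα1 : α < 1) (hT : 0 ≤ T)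
    (hL : ∀ x, 0 < x → x < T → ‖weylRight (1 - α) T (subLeftLim g T) x‖ₑ ≤
      ENNReal.ofReal (Real.Gamma (1 - α)) * L) (hu : Measurable u) :
    ‖stieltjes α T u g‖ₑ ≤ L * weylMass α T u := by
  unfold stieltjes
  rw [enorm_neg, intervalIntegral.integral_of_le hT, integral_Ioc_eq_integral_Ioo]
  exact (enorm_integral_le_lintegral_enorm _).trans (lintegral_stieltjesIntegrand_le hα0 hα1 hL hu)

theorem stieltjes_sub (hα0 : 0 ≤ α) (hα1 : α < 1) (hT : 0 ≤ T)
    (hL : ∀ x, 0 < x → x < T → ‖weylRight (1 - α) T (subLeftLim g T) x‖ₑ ≤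
      ENNReal.ofReal (Real.Gamma (1 - α)) * L) (hL' : L < ∞) (hg : MemIntegrator α T g)
    (hu : Measurable u) (hv : Measurable v) (hRu : weylMass α T u < ∞)
    (hRv : weylMass α T v < ∞) :
    stieltjes α T (fun x => u x - v x) g = stieltjes α T u g - stieltjes α T v g := by
  unfold stieltjes
  simp only [intervalIntegral.integral_of_le hT, integral_Ioc_eq_integral_Ioo]
  rw [neg_sub_neg, ← neg_sub, ← integral_sub
    (integrableOn_stieltjesIntegrand hα0 hα1 hL hL' hg hu hRu)
    (integrableOn_stieltjesIntegrand hα0 hα1 hL hL' hg hv hRv)]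
  congr 1
  refine integral_congr_ae ?_
  filter_upwards [ae_weylLeft_sub hu hv hRu hRv] with x hx
  unfold stieltjesIntegrand
  rw [hx, sub_mul]

theorem stieltjesExists_of_weylMass_lt_top (hα0 : 0 ≤ α) (hα1 : α < 1) (hT : 0 < T)
    (hL : ∀ x, 0 < x → x < T → ‖weylRight (1 - α) T (subLeftLim g T) x‖ₑ ≤
      ENNReal.ofReal (Real.Gamma (1 - α)) * L) (hL' : L < ∞) (hg : MemIntegrator α T g)
    (hu : Measurable u) (hR : weylMass α T u < ∞) : StieltjesExists α T u g := by
  refine ⟨ae_integrableOn_weylLeft hu hR, ?_, hg.exists_tendsto hα1 hT le_rfl,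
    integrableOn_stieltjesIntegrand hα0 hα1 hL hL' hg hu hR⟩
  filter_upwards [ae_restrict_mem measurableSet_Ioo] with x hx
  refine (hg.integrableOn hx.1 hx.2).congr_fun (fun y _ => ?_) measurableSet_Ioo
  simp only [smul_eq_mul]
  ring

end Stieltjes

/-! ### Scalar components of the integrator -/

section Components

variable {α T : ℝ} {m : ℕ}

theorem MemIntegrator.apply {g : ℝ → Vec m} (hg : MemIntegrator α T g) (j : Fin m) :
    MemIntegrator α T fun s => g s j := by
  refine ⟨?_, lt_of_le_of_lt (integratorNorm_mono fun s t => ?_) hg.2⟩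
  · exact (EuclideanSpace.proj j : Vec m →L[ℝ] ℝ).measurable.comp hg.1
  · exact PiLp.norm_apply_le (g t - g s) j

/-- Coordinate projections commute with the left limit and, by integrability, with the singular
integral. Hence the vector-valued `Λ_α(g)` bounds every component. -/
theorem MemIntegrator.weylRight_apply (hα : α < 1) {g : ℝ → Vec m} (hg : MemIntegrator α T g)
    (j : Fin m) {x : ℝ} (hx : 0 < x) (hxT : x < T) :
    weylRight (1 - α) T (subLeftLim (fun s => g s j) T) x =
      (weylRight (1 - α) T (subLeftLim g T) x) j := by
  have hlim : Function.leftLim (fun s => g s j) T = (Function.leftLim g T) j :=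
    leftLim_eq_of_tendsto
      (((EuclideanSpace.proj j : Vec m →L[ℝ] ℝ).continuous.tendsto _).comp
        (hg.tendsto_leftLim hα (hx.trans hxT) le_rfl))
  have hint := (EuclideanSpace.proj j : Vec m →L[ℝ] ℝ).integral_comp_comm
    (hg.integrableOn hx hxT)
  rw [weylRight_subLeftLim, weylRight_subLeftLim, hlim,
    intervalIntegral.integral_of_le hxT.le, integral_Ioc_eq_integral_Ioo,
    intervalIntegral.integral_of_le hxT.le, integral_Ioc_eq_integral_Ioo]
  simp only [EuclideanSpace.coe_proj, PiLp.smul_apply, PiLp.sub_apply] at hint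
  simp only [PiLp.smul_apply, PiLp.add_apply, PiLp.sub_apply, hint]

theorem MemIntegrator.enorm_weylRight_apply_le (hα : α < 1) {g : ℝ → Vec m}
    (hg : MemIntegrator α T g) (j : Fin m) (x : ℝ) (hx : 0 < x) (hxT : x < T) :
    ‖weylRight (1 - α) T (subLeftLim (fun s => g s j) T) x‖ₑ ≤
      ENNReal.ofReal (Real.Gamma (1 - α)) * Lam α T g := by
  rw [hg.weylRight_apply hα j hx hxT]
  refine le_trans ?_ (hg.enorm_weylRight_le hα hx hxT)
  rw [enorm_le_iff_norm_le]
  exact PiLp.norm_apply_le _ j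

end Components

/-! ### Matrix-valued integrands -/

section Vector

variable {α T : ℝ} {d m : ℕ}

/-- The vector of Stieltjes integrals `∑_j ∫_0^T u_{ij} dg^j`. -/
def youngIntegral (α T : ℝ) (g : ℝ → Vec m) (u : ℝ → Mat d m) : Vec d :=
  WithLp.toLp 2 fun i => ∑ j : Fin m, stieltjes α T (fun s => u s (i, j)) (fun s => g s j)

theorem enorm_le_sum_enorm (v : Vec d) : ‖v‖ₑ ≤ ∑ i, ‖v i‖ₑ := by
  have h : v = ∑ i, EuclideanSpace.single i (v i) := by
    ext k
    simp [Finset.sum_apply]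
  conv_lhs => rw [h]
  refine (enorm_sum_le _ _).trans (le_of_eq (Finset.sum_congr rfl fun i _ => ?_))
  rw [← ofReal_norm, PiLp.norm_single, ofReal_norm]

theorem measurable_mat_apply {u : ℝ → Mat d m} (hu : Measurable u) (p : Fin d × Fin m) :
    Measurable fun s => u s p :=
  (EuclideanSpace.proj p : Mat d m →L[ℝ] ℝ).measurable.comp hu

theorem weylMass_apply_le (u : ℝ → Mat d m) (p : Fin d × Fin m) :
    weylMass α T (fun s => u s p) ≤ weylMass α T u := by
  refine weylMass_mono (fun x => ?_) fun x y => ?_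
  · rw [enorm_le_iff_norm_le]
    exact PiLp.norm_apply_le _ p
  · rw [enorm_le_iff_norm_le]
    exact PiLp.norm_apply_le (u x - u y) p

theorem enorm_youngIntegral_le (hα0 : 0 ≤ α) (hα1 : α < 1) (hT : 0 ≤ T) {g : ℝ → Vec m}
    (hg : MemIntegrator α T g) {u : ℝ → Mat d m} (hu : Measurable u) :
    ‖youngIntegral α T g u‖ₑ ≤ (d * m : ℝ≥0∞) * (Lam α T g * weylMass α T u) := by
  refine (enorm_le_sum_enorm _).trans ?_
  calc ∑ i, ‖(youngIntegral α T g u) i‖ₑ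
      ≤ ∑ _i : Fin d, ∑ _j : Fin m, Lam α T g * weylMass α T u := by
        refine Finset.sum_le_sum fun i _ => (enorm_sum_le _ _).trans
          (Finset.sum_le_sum fun j _ => ?_)
        refine (enorm_stieltjes_le hα0 hα1 hT (hg.enorm_weylRight_apply_le hα1 j)
          (measurable_mat_apply hu _)).trans ?_
        gcongr
        exact weylMass_apply_le u _
    _ = _ := by simp [mul_assoc]

theorem youngIntegral_sub (hα0 : 0 < α) (hα1 : α < 1) (hT : 0 ≤ T) {g : ℝ → Vec m}
    (hg : MemIntegrator α T g) {u v : ℝ → Mat d m} (hu : Measurable u) (hv : Measurable v)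
    (hRu : weylMass α T u < ∞) (hRv : weylMass α T v < ∞) :
    youngIntegral α T g (fun x => u x - v x) = youngIntegral α T g u - youngIntegral α T g v := by
  ext i
  simp only [youngIntegral, PiLp.sub_apply, ← Finset.sum_sub_distrib]
  refine Finset.sum_congr rfl fun j _ => ?_
  exact stieltjes_sub hα0.le hα1 hT (hg.enorm_weylRight_apply_le hα1 j) (hg.Lam_lt_top hα0 hα1)
    (hg.apply j) (measurable_mat_apply hu _) (measurable_mat_apply hv _)
    ((weylMass_apply_le u _).trans_lt hRu) ((weylMass_apply_le v _).trans_lt hRv)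

end Vector

/-! ### The end point kernel against an exponential weight -/

section Kernel

variable {α s t : ℝ}

/-- The kernel `(r-s)^(-α) + (t-r)^(-α)`. -/
def endKernel (α s t r : ℝ) : ℝ≥0∞ :=
  ENNReal.ofReal ((r - s) ^ (-α)) + ENNReal.ofReal ((t - r) ^ (-α))

theorem measurable_endKernel : Measurable (endKernel α s t) :=
  (measurable_ofReal_sub_const_rpow _ _).add (measurable_ofReal_const_sub_rpow _ _)

/-- `∫_s^t Ψ(r) ((r-s)^(-α) + (t-r)^(-α)) dr`. -/
def endIntegral (α : ℝ) (Ψ : ℝ → ℝ≥0∞) (s t : ℝ) : ℝ≥0∞ :=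
  ∫⁻ r in Ioo s t, Ψ r * endKernel α s t r

/-- `∫_s^t exp(-λ(t-r)) ((r-s)^(-α) + (t-r)^(-α)) dr`. -/
def expIntegral (α lam s t : ℝ) : ℝ≥0∞ :=
  ∫⁻ r in Ioo s t, ENNReal.ofReal (Real.exp (-lam * (t - r))) * endKernel α s t r

theorem measurable_ofReal_exp_sub (lam t : ℝ) :
    Measurable fun r => ENNReal.ofReal (Real.exp (-lam * (t - r))) := by
  fun_prop

theorem measurable_exp_mul_endKernel (lam : ℝ) :
    Measurable fun r => ENNReal.ofReal (Real.exp (-lam * (t - r))) * endKernel α s t r :=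
  (measurable_ofReal_exp_sub lam t).mul measurable_endKernel

/-- Writing `exp(λr) = exp(λt) exp(-λ(t-r))` extracts the growth at the right end point, which the
weight `exp(-λt)` of `wExpNorm` will cancel. -/
theorem endIntegral_le {Ψ : ℝ → ℝ≥0∞} {M : ℝ≥0∞} {lam : ℝ}
    (h : ∀ r ∈ Ioo s t, Ψ r ≤ M * ENNReal.ofReal (Real.exp (lam * r))) :
    endIntegral α Ψ s t ≤ ENNReal.ofReal (Real.exp (lam * t)) * (M * expIntegral α lam s t) := by
  unfold endIntegral expIntegral
  rw [← lintegral_const_mul _ (measurable_exp_mul_endKernel lam),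
    ← lintegral_const_mul _ ((measurable_exp_mul_endKernel lam).const_mul M)]
  refine setLIntegral_mono' measurableSet_Ioo fun r hr => ?_
  refine (mul_le_mul' (h r hr) le_rfl).trans (le_of_eq ?_)
  have : ENNReal.ofReal (Real.exp (lam * r)) = ENNReal.ofReal (Real.exp (lam * t)) *
      ENNReal.ofReal (Real.exp (-lam * (t - r))) := by
    rw [← ENNReal.ofReal_mul (Real.exp_pos _).le, ← Real.exp_add]
    congr 2
    ring
  rw [this]
  ring

theorem setLIntegral_exp_le {lam : ℝ} (hl : 0 < lam) (s t : ℝ) :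
    ∫⁻ r in Ioo s t, ENNReal.ofReal (Real.exp (-lam * (t - r))) ≤ ENNReal.ofReal lam⁻¹ := by
  rw [setLIntegral_Ioo_comp_sub_left (fun r => ENNReal.ofReal (Real.exp (-lam * r)))]
  refine (lintegral_mono_set Ioo_subset_Ioi_self).trans ?_
  rw [← ofReal_integral_eq_lintegral_ofReal (integrableOn_exp_mul_Ioi (neg_lt_zero.2 hl) 0)
    (Filter.Eventually.of_forall fun _ => (Real.exp_pos _).le),
    integral_exp_mul_Ioi (neg_lt_zero.2 hl)]
  simp

/-- The bound for short intervals: the exponential is discarded. It is complemented by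
`expIntegral_le_lam`, which is uniform in the length. -/
theorem expIntegral_le_rpow (hα1 : α < 1) {lam : ℝ} (hl : 0 ≤ lam) (hst : s ≤ t) :
    expIntegral α lam s t ≤ ENNReal.ofReal (2 * ((t - s) ^ (1 - α) / (1 - α))) := by
  calc expIntegral α lam s t ≤ ∫⁻ r in Ioo s t, endKernel α s t r := by
        refine setLIntegral_mono' measurableSet_Ioo fun r hr => ?_
        calc _ ≤ 1 * endKernel α s t r := by
              gcongr
              rw [ENNReal.ofReal_le_one, Real.exp_le_one_iff]
              nlinarith [hr.2]
          _ = _ := one_mul _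
    _ = _ := by
      unfold endKernel
      rw [lintegral_add_left (measurable_ofReal_sub_const_rpow _ _),
        setLIntegral_Ioo_sub_right_rpow hα1 hst, setLIntegral_Ioo_sub_left_rpow hα1 hst, ← two_mul,
        ENNReal.ofReal_mul zero_le_two, ENNReal.ofReal_ofNat]

/-- Splitting at distance `1/λ` from the singularity: on `S` the exponential is at most `1`; off `S`
the power is at most `λ^α` while the exponential has integral at most `1/λ`. The function `ρ` is the
distance to either end point. -/
theorem setLIntegral_exp_mul_rpow_le (hα0 : 0 ≤ α) {lam : ℝ} (hl : 0 < lam) {ρ : ℝ → ℝ}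
    {S : Set ℝ} (hS : MeasurableSet S) (h : ∀ r ∈ Ioo s t, r ∉ S → lam⁻¹ ≤ ρ r) :
    ∫⁻ r in Ioo s t, ENNReal.ofReal (Real.exp (-lam * (t - r))) * ENNReal.ofReal (ρ r ^ (-α)) ≤
      (∫⁻ r in S, ENNReal.ofReal (ρ r ^ (-α))) + ENNReal.ofReal (lam ^ (α - 1)) := by
  have hsub : Ioo s t ⊆ (Ioo s t ∩ S) ∪ (Ioo s t ∩ Sᶜ) := by
    rw [← inter_union_distrib_left, union_compl_self, inter_univ]
  refine (lintegral_mono_set hsub).trans ((lintegral_union_le _ _ _).trans (add_le_add ?_ ?_))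
  · refine (setLIntegral_mono' (g := fun r => ENNReal.ofReal (ρ r ^ (-α)))
      (measurableSet_Ioo.inter hS) fun r hr => ?_).trans (lintegral_mono_set inter_subset_right)
    calc _ ≤ 1 * ENNReal.ofReal (ρ r ^ (-α)) := by
          gcongr
          rw [ENNReal.ofReal_le_one, Real.exp_le_one_iff]
          nlinarith [hr.1.2]
      _ = _ := one_mul _
  · calc _ ≤ ∫⁻ r in Ioo s t ∩ Sᶜ, ENNReal.ofReal (Real.exp (-lam * (t - r))) *
          ENNReal.ofReal (lam ^ α) := by
          refine setLIntegral_mono' (measurableSet_Ioo.inter hS.compl) fun r hr => ?_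
          gcongr
          calc ρ r ^ (-α) ≤ (lam⁻¹) ^ (-α) :=
                Real.rpow_le_rpow_of_nonpos (inv_pos.2 hl) (h r hr.1 hr.2) (by linarith)
            _ = lam ^ α := by rw [Real.inv_rpow hl.le, Real.rpow_neg hl.le, inv_inv]
      _ ≤ ∫⁻ r in Ioo s t, ENNReal.ofReal (Real.exp (-lam * (t - r))) *
          ENNReal.ofReal (lam ^ α) := lintegral_mono_set inter_subset_left
      _ ≤ ENNReal.ofReal lam⁻¹ * ENNReal.ofReal (lam ^ α) := by
          rw [lintegral_mul_const _ (measurable_ofReal_exp_sub lam t)]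
          gcongr
          exact setLIntegral_exp_le hl s t
      _ = _ := by
          rw [← ENNReal.ofReal_mul (inv_pos.2 hl).le, Real.rpow_sub_one hl.ne', div_eq_inv_mul]

theorem inv_rpow_div_eq {lam : ℝ} (hl : 0 < lam) (p c : ℝ) :
    lam⁻¹ ^ p / c = c⁻¹ * lam ^ (-p) := by
  rw [Real.inv_rpow hl.le, ← Real.rpow_neg hl.le, div_eq_inv_mul]

theorem expIntegral_le_lam (hα0 : 0 ≤ α) (hα1 : α < 1) {lam : ℝ} (hl : 0 < lam) :
    expIntegral α lam s t ≤ ENNReal.ofReal (2 * ((1 - α)⁻¹ + 1) * lam ^ (α - 1)) := by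
  have hl' : 0 < lam⁻¹ := inv_pos.2 hl
  have hα2 : 0 < 1 - α := by linarith
  have e1 : ENNReal.ofReal ((lam⁻¹) ^ (1 - α) / (1 - α)) + ENNReal.ofReal (lam ^ (α - 1)) =
      ENNReal.ofReal (((1 - α)⁻¹ + 1) * lam ^ (α - 1)) := by
    rw [inv_rpow_div_eq hl, neg_sub, ← ENNReal.ofReal_add, add_mul, one_mul]
    · positivity
    · positivity
  have h1 := setLIntegral_exp_mul_rpow_le (α := α) (s := s) (t := t) (ρ := fun r => r - s)
    hα0 hl (S := Ioo s (s + lam⁻¹)) measurableSet_Ioo fun r hr hrS => by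
      by_contra hc
      exact hrS ⟨hr.1, by linarith⟩
  have h2 := setLIntegral_exp_mul_rpow_le (α := α) (s := s) (t := t) (ρ := fun r => t - r)
    hα0 hl (S := Ioo (t - lam⁻¹) t) measurableSet_Ioo fun r hr hrS => by
      by_contra hc
      exact hrS ⟨by linarith, hr.2⟩
  rw [setLIntegral_Ioo_sub_right_rpow hα1 (by linarith), add_sub_cancel_left, e1] at h1
  rw [setLIntegral_Ioo_sub_left_rpow hα1 (by linarith), sub_sub_cancel, e1] at h2
  unfold expIntegral endKernel
  have hm : Measurable fun r =>
      ENNReal.ofReal (Real.exp (-lam * (t - r))) * ENNReal.ofReal ((r - s) ^ (-α)) :=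
    (measurable_ofReal_exp_sub lam t).mul (measurable_ofReal_sub_const_rpow _ _)
  simp_rw [mul_add (ENNReal.ofReal (Real.exp _))]
  rw [lintegral_add_left hm]
  refine (add_le_add h1 h2).trans (le_of_eq ?_)
  rw [← ENNReal.ofReal_add (by positivity) (by positivity)]
  congr 1
  ring

end Kernel

/-! ### Volterra integrals of dominated integrands -/

section Abstract

variable {α μ T : ℝ} {d m : ℕ}

/-- The integrands `φ_t` on `(0,t)` and their increments in `t` are dominated by `Ψ`. -/
structure VolterraBound (α μ T : ℝ) (φ : ℝ → ℝ → Mat d m) (Ψ : ℝ → ℝ≥0∞) : Prop where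
  meas : ∀ t ∈ Icc 0 T, Measurable ((Ioo 0 t).indicator (φ t))
  size : ∀ t ∈ Icc 0 T, ∀ r ∈ Ioo 0 t, ‖φ t r‖ₑ ≤ Ψ r
  incr : ∀ t ∈ Icc 0 T, ∀ r ∈ Ioo 0 t,
    ∫⁻ y in Ioo 0 r, ‖φ t r - φ t y‖ₑ * ENNReal.ofReal ((r - y) ^ (-(α + 1))) ≤ Ψ r
  size_time : ∀ s t, 0 ≤ s → s < t → t ≤ T → ∀ r ∈ Ioo 0 s,
    ‖φ t r - φ s r‖ₑ ≤ ENNReal.ofReal ((t - s) ^ μ) * Ψ r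
  incr_time : ∀ s t, 0 ≤ s → s < t → t ≤ T → ∀ r ∈ Ioo 0 s,
    ∫⁻ y in Ioo 0 r, ‖(φ t r - φ s r) - (φ t y - φ s y)‖ₑ *
      ENNReal.ofReal ((r - y) ^ (-(α + 1))) ≤ ENNReal.ofReal ((t - s) ^ μ) * Ψ r

/-- The increment term of the mass carries no end point weight; since `(r-s)^(-α) ≥ T^(-α)`, a
factor `T^α` puts it under the same kernel. The number `c` is `1` for the part on `(s,t)` and
`(t-s)^μ` for the time increment on `(0,s)`. -/
theorem weylMass_indicator_le_endIntegral {E : Type*} [NormedAddCommGroup E] [MeasurableSpace E]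
    [BorelSpace E] [SecondCountableTopology E] (hα : 0 < α) {s t : ℝ} (hs : 0 ≤ s) (htT : t ≤ T)
    {φ : ℝ → E} (hφ : Measurable ((Ioo s t).indicator φ)) {Ψ : ℝ → ℝ≥0∞} {c : ℝ≥0∞} (hc : c ≠ ∞)
    (h1 : ∀ r ∈ Ioo s t, ‖φ r‖ₑ ≤ c * Ψ r)
    (h2 : ∀ r ∈ Ioo s t, ∫⁻ y in Ioo 0 r, ‖φ r - φ y‖ₑ *
      ENNReal.ofReal ((r - y) ^ (-(α + 1))) ≤ c * Ψ r) :
    weylMass α T ((Ioo s t).indicator φ) ≤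
      ENNReal.ofReal (1 + α⁻¹ + T ^ α) * (c * endIntegral α Ψ s t) := by
  refine (weylMass_indicator_le hα hs hφ).trans ?_
  unfold endIntegral
  rw [← lintegral_const_mul' _ _ hc, ← lintegral_const_mul' _ _ ENNReal.ofReal_ne_top]
  refine setLIntegral_mono' measurableSet_Ioo fun r hr => ?_
  have hT : 0 < T := by linarith [hr.1, hr.2]
  have hαi : 0 < α⁻¹ := inv_pos.2 hα
  have hk : 1 ≤ ENNReal.ofReal (T ^ α) * endKernel α s t r := by
    refine le_trans ?_ (mul_le_mul_right (le_self_add : ENNReal.ofReal ((r - s) ^ (-α)) ≤ _) _)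
    rw [← ENNReal.ofReal_mul (Real.rpow_nonneg hT.le _), ENNReal.one_le_ofReal]
    have hrs : 0 < r - s := sub_pos.2 hr.1
    calc (1 : ℝ) = T ^ α * T ^ (-α) := by rw [← Real.rpow_add hT]; simp
      _ ≤ _ := by
        exact mul_le_mul_of_nonneg_left (Real.rpow_le_rpow_of_nonpos hrs
          (by linarith [hr.2]) (by linarith)) (Real.rpow_nonneg hT.le _)
  calc _ ≤ ENNReal.ofReal (1 + α⁻¹) * (c * Ψ r * endKernel α s t r) + c * Ψ r := by
        refine add_le_add (mul_le_mul_right (mul_le_mul' (h1 r hr) le_rfl) _)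
          ((lintegral_mono_set (Ioo_subset_Ioo_left hs)).trans (h2 r hr))
    _ ≤ ENNReal.ofReal (1 + α⁻¹) * (c * Ψ r * endKernel α s t r) +
        c * Ψ r * (ENNReal.ofReal (T ^ α) * endKernel α s t r) := by
        refine add_le_add le_rfl ?_
        calc c * Ψ r = c * Ψ r * 1 := (mul_one _).symm
          _ ≤ _ := mul_le_mul_right hk _
    _ = _ := by
        rw [ENNReal.ofReal_add (show 0 ≤ 1 + α⁻¹ by positivity) (show 0 ≤ T ^ α by positivity)]
        ring

variable {φ : ℝ → ℝ → Mat d m} {Ψ : ℝ → ℝ≥0∞}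

theorem VolterraBound.weylMass_le (h : VolterraBound α μ T φ Ψ) (hα : 0 < α) {t : ℝ}
    (ht : t ∈ Icc 0 T) : weylMass α T ((Ioo 0 t).indicator (φ t)) ≤
      ENNReal.ofReal (1 + α⁻¹ + T ^ α) * endIntegral α Ψ 0 t := by
  rw [← one_mul (endIntegral α Ψ 0 t)]
  exact weylMass_indicator_le_endIntegral hα le_rfl ht.2 (h.meas t ht) ENNReal.one_ne_top
    (fun r hr => by rw [one_mul]; exact h.size t ht r hr)
    (fun r hr => by rw [one_mul]; exact h.incr t ht r hr)

/-- The new stretch `(s,t)` carries the whole of `φ_t`, while on `(0,s)` only `φ_t - φ_s` survives,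
with its small factor `(t-s)^μ`. -/
theorem VolterraBound.weylMass_sub_le (h : VolterraBound α μ T φ Ψ) (hα : 0 < α) {s t : ℝ}
    (hs : 0 ≤ s) (hst : s < t) (htT : t ≤ T) :
    weylMass α T (fun r => (Ioo 0 t).indicator (φ t) r - (Ioo 0 s).indicator (φ s) r) ≤
      ENNReal.ofReal (1 + α⁻¹ + T ^ α) *
        (endIntegral α Ψ s t + ENNReal.ofReal ((t - s) ^ μ) * endIntegral α Ψ 0 s) := by
  have ht : t ∈ Icc 0 T := ⟨hs.trans hst.le, htT⟩
  have hs' : s ∈ Icc 0 T := ⟨hs, hst.le.trans htT⟩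
  have hsub1 : Ioo s t ⊆ Ioo 0 t := Ioo_subset_Ioo_left hs
  have hsub2 : Ioo 0 s ⊆ Ioo 0 t := Ioo_subset_Ioo_right hst.le
  have hm1 : Measurable ((Ioo s t).indicator (φ t)) := by
    have := (h.meas t ht).indicator (s := Ioo s t) measurableSet_Ioo
    rwa [indicator_indicator, inter_eq_self_of_subset_left hsub1] at this
  have hm2 : Measurable ((Ioo 0 s).indicator fun r => φ t r - φ s r) := by
    have := ((h.meas t ht).indicator (s := Ioo 0 s) measurableSet_Ioo).sub (h.meas s hs')
    rw [indicator_indicator, inter_eq_self_of_subset_left hsub2] at this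
    convert this using 1
    exact indicator_sub _ _ _
  -- The decomposition fails only at the point `r = s`, which belongs to neither open interval.
  have hae : (fun r => (Ioo 0 t).indicator (φ t) r - (Ioo 0 s).indicator (φ s) r) =ᵐ[volume]
      fun r => (Ioo s t).indicator (φ t) r + (Ioo 0 s).indicator (fun r => φ t r - φ s r) r := by
    filter_upwards [compl_mem_ae_iff.2 (measure_singleton (μ := volume) s)] with r hr
    have hr : r ≠ s := hr
    by_cases h1 : r ∈ Ioo 0 s
    · rw [indicator_of_mem h1, indicator_of_mem (hsub2 h1), indicator_of_mem h1,
        indicator_of_notMem (fun h => absurd h.1 (not_lt.2 h1.2.le)), zero_add]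
    · rw [indicator_of_notMem h1, indicator_of_notMem h1, sub_zero, add_zero]
      by_cases h2 : r ∈ Ioo s t
      · rw [indicator_of_mem h2, indicator_of_mem (hsub1 h2)]
      · rw [indicator_of_notMem h2, indicator_of_notMem]
        rintro ⟨h3, h4⟩
        rcases lt_or_gt_of_ne hr with h5 | h5
        · exact h1 ⟨h3, h5⟩
        · exact h2 ⟨h5, h4⟩
  rw [weylMass_congr_ae hae, mul_add]
  refine (weylMass_add_le hm1).trans (add_le_add ?_ ?_)
  · rw [← one_mul (endIntegral α Ψ s t)]
    exact weylMass_indicator_le_endIntegral hα hs htT hm1 ENNReal.one_ne_top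
      (fun r hr => by rw [one_mul]; exact h.size t ht r (hsub1 hr))
      (fun r hr => by rw [one_mul]; exact h.incr t ht r (hsub1 hr))
  · exact weylMass_indicator_le_endIntegral hα le_rfl hs'.2 hm2 ENNReal.ofReal_ne_top
      (fun r hr => h.size_time s t hs hst htT r hr)
      (fun r hr => h.incr_time s t hs hst htT r hr)

theorem VolterraBound.enorm_le (h : VolterraBound α μ T φ Ψ) (hα0 : 0 < α) (hα1 : α < 1)
    {g : ℝ → Vec m} (hg : MemIntegrator α T g) {t : ℝ} (ht : t ∈ Icc 0 T) :
    ‖youngIntegral α T g ((Ioo 0 t).indicator (φ t))‖ₑ ≤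
      Lam α T g * (ENNReal.ofReal (d * m * (1 + α⁻¹ + T ^ α)) * endIntegral α Ψ 0 t) := by
  have hT : 0 ≤ T := ht.1.trans ht.2
  have : 0 ≤ 1 + α⁻¹ + T ^ α := by positivity
  refine (enorm_youngIntegral_le hα0.le hα1 hT hg (h.meas t ht)).trans
    ((mul_le_mul_right (mul_le_mul_right (h.weylMass_le hα0 ht) _) _).trans (le_of_eq ?_))
  rw [ENNReal.ofReal_mul (by positivity), ENNReal.ofReal_mul (by positivity),
    ENNReal.ofReal_natCast, ENNReal.ofReal_natCast]
  ring

/-- Subtracting the two integrals needs finite masses. These are a separate hypothesis because `Ψ`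
may be infinite, as happens when `Δ(f) = ∞`. -/
theorem VolterraBound.enorm_sub_le (h : VolterraBound α μ T φ Ψ) (hα0 : 0 < α) (hα1 : α < 1)
    (hfin : ∀ t ∈ Icc 0 T, weylMass α T ((Ioo 0 t).indicator (φ t)) < ∞)
    {g : ℝ → Vec m} (hg : MemIntegrator α T g) {s t : ℝ}
    (hs : 0 ≤ s) (hst : s < t) (htT : t ≤ T) :
    ‖youngIntegral α T g ((Ioo 0 t).indicator (φ t)) -
        youngIntegral α T g ((Ioo 0 s).indicator (φ s))‖ₑ ≤
      Lam α T g * (ENNReal.ofReal (d * m * (1 + α⁻¹ + T ^ α)) *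
        (endIntegral α Ψ s t + ENNReal.ofReal ((t - s) ^ μ) * endIntegral α Ψ 0 s)) := by
  have ht : t ∈ Icc 0 T := ⟨hs.trans hst.le, htT⟩
  have hs' : s ∈ Icc 0 T := ⟨hs, hst.le.trans htT⟩
  have hT : 0 ≤ T := ht.1.trans ht.2
  have : 0 ≤ 1 + α⁻¹ + T ^ α := by positivity
  rw [← youngIntegral_sub hα0 hα1 hT hg (h.meas t ht) (h.meas s hs') (hfin t ht) (hfin s hs')]
  refine (enorm_youngIntegral_le hα0.le hα1 hT hg ((h.meas t ht).sub (h.meas s hs'))).trans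
    ((mul_le_mul_right (mul_le_mul_right (h.weylMass_sub_le hα0 hs hst htT) _) _).trans
      (le_of_eq ?_))
  rw [ENNReal.ofReal_mul (by positivity), ENNReal.ofReal_mul (by positivity),
    ENNReal.ofReal_natCast, ENNReal.ofReal_natCast]
  ring

end Abstract

/-! ### Hölder and exponentially weighted bounds -/

section Estimates

variable {α μ T : ℝ}

/-- The increment over `(s,t)` has exactly the order `(t-s)^(1-α)`; the time increment has order
`(t-s)^μ`, which is enough because `μ > 1-α`. -/
theorem VolterraBound.exists_holderNorm_le (d m : ℕ) (hT : 0 < T) (hα0 : 0 < α) (hα1 : α < 1)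
    (hμ : 1 - μ < α) : ∃ C : ℝ, 0 < C ∧ ∀ (g : ℝ → Vec m) (φ : ℝ → ℝ → Mat d m) (Ψ : ℝ → ℝ≥0∞)
      (M : ℝ≥0∞), MemIntegrator α T g → VolterraBound α μ T φ Ψ →
      (∀ t ∈ Icc 0 T, weylMass α T ((Ioo 0 t).indicator (φ t)) < ∞) →
      (∀ r ∈ Ioo 0 T, Ψ r ≤ M) →
      holderNorm (1 - α) T (fun t => youngIntegral α T g ((Ioo 0 t).indicator (φ t))) ≤
        Lam α T g * ENNReal.ofReal C * M := by
  have hα2 : 0 < 1 - α := by linarith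
  set D : ℝ := d * m * (1 + α⁻¹ + T ^ α) with hD
  have hD0 : 0 ≤ D := by positivity
  set c : ℝ := 2 * (1 - α)⁻¹ with hc
  have hc0 : 0 < c := by positivity
  -- The summands bound the sup norm and the Hölder quotient. The final `1` secures strict
  -- positivity, as `D` vanishes when `d` or `m` is `0`.
  refine ⟨D * (c * T ^ (1 - α) + (c + c * T ^ μ)) + 1, by positivity, ?_⟩
  intro g φ Ψ M hg h hfin hM
  have hJ : ∀ s t, 0 ≤ s → s ≤ t → t ≤ T →
      endIntegral α Ψ s t ≤ M * ENNReal.ofReal (c * (t - s) ^ (1 - α)) := by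
    intro s t hs hst htT
    have h1 := endIntegral_le (α := α) (s := s) (t := t) (Ψ := Ψ) (M := M) (lam := 0) fun r hr => by
      simpa using hM r ⟨hs.trans_lt hr.1, hr.2.trans_le htT⟩
    rw [zero_mul, Real.exp_zero, ENNReal.ofReal_one, one_mul] at h1
    refine h1.trans (mul_le_mul_right ((expIntegral_le_rpow hα1 le_rfl hst).trans (le_of_eq ?_)) M)
    congr 1
    rw [hc]; ring
  have hsup : supNorm T (fun t => youngIntegral α T g ((Ioo 0 t).indicator (φ t))) ≤
      Lam α T g * M * ENNReal.ofReal (D * (c * T ^ (1 - α))) := by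
    refine iSup₂_le fun t ht => (h.enorm_le hα0 hα1 hg ht).trans ?_
    rw [ENNReal.ofReal_mul hD0]
    calc _ ≤ Lam α T g * (ENNReal.ofReal D * (M * ENNReal.ofReal (c * T ^ (1 - α)))) := by
          refine mul_le_mul_right (mul_le_mul_right ((hJ 0 t le_rfl ht.1 ht.2).trans ?_) _) _
          rw [sub_zero]
          have h1 := ht.1
          have h2 := ht.2
          gcongr
      _ = _ := by ring
  have hincr : ∀ s t, 0 ≤ s ∧ s < t ∧ t ≤ T →
      ENNReal.ofReal (‖youngIntegral α T g ((Ioo 0 t).indicator (φ t)) -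
        youngIntegral α T g ((Ioo 0 s).indicator (φ s))‖ / (t - s) ^ (1 - α)) ≤
      Lam α T g * M * ENNReal.ofReal (D * (c + c * T ^ μ)) := by
    rintro s t ⟨hs, hst, htT⟩
    have hts : 0 < t - s := sub_pos.2 hst
    rw [ofReal_norm_div_rpow _ hts.le]
    have hE := h.enorm_sub_le hα0 hα1 hfin hg hs hst htT
    calc _ ≤ Lam α T g * (ENNReal.ofReal D * (M * ENNReal.ofReal (c * (t - s) ^ (1 - α)) +
          ENNReal.ofReal ((t - s) ^ μ) * (M * ENNReal.ofReal (c * (s - 0) ^ (1 - α))))) *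
            ENNReal.ofReal ((t - s) ^ (-(1 - α))) := by
          refine mul_le_mul_left (hE.trans ?_) _
          gcongr
          · exact hJ s t hs hst.le htT
          · exact hJ 0 s le_rfl hs (hst.le.trans htT)
      _ = Lam α T g * M * (ENNReal.ofReal D *
          (ENNReal.ofReal (c * (t - s) ^ (1 - α)) * ENNReal.ofReal ((t - s) ^ (-(1 - α))) +
            ENNReal.ofReal ((t - s) ^ μ) * ENNReal.ofReal (c * (s - 0) ^ (1 - α)) *
              ENNReal.ofReal ((t - s) ^ (-(1 - α))))) := by ring
      _ ≤ _ := by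
          rw [ENNReal.ofReal_mul hD0]
          have hp : 0 ≤ c * (t - s) ^ (1 - α) := by positivity
          have hq : 0 ≤ c * (s - 0) ^ (1 - α) := by
            rw [sub_zero]; positivity
          have hr : 0 ≤ (t - s) ^ μ := by positivity
          rw [← ENNReal.ofReal_mul hp, ← ENNReal.ofReal_mul hr, ← ENNReal.ofReal_mul
            (mul_nonneg hr hq), ← ENNReal.ofReal_add (by positivity) (by positivity)]
          refine mul_le_mul_right (mul_le_mul_right (ENNReal.ofReal_le_ofReal
            (add_le_add (le_of_eq ?_) ?_)) _) _
          · rw [mul_assoc, ← Real.rpow_add hts]; simp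
          · calc (t - s) ^ μ * (c * (s - 0) ^ (1 - α)) * (t - s) ^ (-(1 - α))
                = c * ((t - s) ^ (μ - (1 - α)) * s ^ (1 - α)) := by
                  rw [sub_eq_add_neg μ, Real.rpow_add hts, sub_zero]; ring
              _ ≤ c * (T ^ (μ - (1 - α)) * T ^ (1 - α)) := by
                  have h1 : 0 ≤ μ - (1 - α) := by linarith
                  have h2 : t - s ≤ T := by linarith
                  have h3 : s ≤ T := by linarith
                  gcongr
              _ = c * T ^ μ := by rw [← Real.rpow_add hT]; simp
  unfold holderNorm
  calc _ ≤ Lam α T g * M * ENNReal.ofReal (D * (c * T ^ (1 - α))) +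
        Lam α T g * M * ENNReal.ofReal (D * (c + c * T ^ μ)) :=
        add_le_add hsup (iSup_le fun s => iSup_le fun t => iSup_le fun hst => hincr s t hst)
    _ = Lam α T g * ENNReal.ofReal (D * (c * T ^ (1 - α) + (c + c * T ^ μ))) * M := by
        rw [← mul_add, ← ENNReal.ofReal_add (by positivity) (by positivity), ← mul_add]
        ring
    _ ≤ _ := by
        gcongr
        linarith

/-- The fractional integral over `s` is cut at `t - 1/λ`. Near `t`, `(t-s)^(1-α)` against
`(t-s)^(-α-1)` leaves `(t-s)^(-2α)`, integrable since `α < 1/2`, with value of order `λ^(2α-1)`.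
Farther away, `λ^(α-1)` meets a tail of order `λ^α`. The time increment only needs `μ > α`. -/
theorem VolterraBound.exists_wExpNorm_le (d m : ℕ) (hT : 0 < T) (hα0 : 0 < α) (hα1 : α < 1 / 2)
    (hμ : 1 - μ < α) : ∃ C : ℝ, 0 < C ∧ ∀ (g : ℝ → Vec m) (φ : ℝ → ℝ → Mat d m) (Ψ : ℝ → ℝ≥0∞)
      (M : ℝ≥0∞) (lam : ℝ), MemIntegrator α T g → VolterraBound α μ T φ Ψ →
      (∀ t ∈ Icc 0 T, weylMass α T ((Ioo 0 t).indicator (φ t)) < ∞) → 1 ≤ lam →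
      (∀ r ∈ Ioo 0 T, Ψ r ≤ M * ENNReal.ofReal (Real.exp (lam * r))) →
      wExpNorm α lam T (fun t => youngIntegral α T g ((Ioo 0 t).indicator (φ t))) ≤
        Lam α T g * ENNReal.ofReal (C / lam ^ (1 - 2 * α)) * M := by
  have hα2 : 0 < 1 - α := by linarith
  have hα3 : 0 < 1 - 2 * α := by linarith
  have hμα : 0 < μ - α := by linarith
  have hα4 : α < 1 := by linarith
  set D : ℝ := d * m * (1 + α⁻¹ + T ^ α) with hD
  have hD0 : 0 ≤ D := by positivity
  set c : ℝ := 2 * (1 - α)⁻¹ with hc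
  have hc0 : 0 < c := by positivity
  set c' : ℝ := 2 * ((1 - α)⁻¹ + 1) with hc'
  have hc'0 : 0 < c' := by positivity
  set b₁ : ℝ := c * (1 - 2 * α)⁻¹ with hb₁
  set b₂ : ℝ := c' * α⁻¹ with hb₂
  set b₃ : ℝ := c' * (T ^ (μ - α) / (μ - α)) with hb₃
  have hb₁0 : 0 < b₁ := by positivity
  have hb₂0 : 0 < b₂ := by positivity
  have hb₃0 : 0 < b₃ := by positivity
  -- `c'` accounts for the values, and `b₁`, `b₂`, `b₃` for the increments: near `t`, far from `t`,
  -- and in the time argument of the integrand.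
  refine ⟨D * (c' + (b₁ + b₂ + b₃)) + 1, by positivity, ?_⟩
  intro g φ Ψ M lam hg h hfin hlam hM
  have hl : 0 < lam := by linarith
  have hl' : 0 < lam⁻¹ := inv_pos.2 hl
  -- This is where `λ ≥ 1` is used: all contributions are brought to the slowest decay `λ^(2α-1)`.
  have hlα : lam ^ (α - 1) ≤ lam ^ (2 * α - 1) :=
    Real.rpow_le_rpow_of_exponent_le hlam (by linarith)
  set P : ℝ≥0∞ := Lam α T g * ENNReal.ofReal D * M with hP
  have hJ : ∀ s t, 0 ≤ s → t ≤ T → endIntegral α Ψ s t ≤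
      ENNReal.ofReal (Real.exp (lam * t)) * (M * expIntegral α lam s t) := fun s t hs htT =>
    endIntegral_le fun r hr => hM r ⟨hs.trans_lt hr.1, hr.2.trans_le htT⟩
  have hexp : ∀ t, ENNReal.ofReal (Real.exp (-lam * t)) * ENNReal.ofReal (Real.exp (lam * t)) = 1 := by
    intro t
    rw [← ENNReal.ofReal_mul (Real.exp_pos _).le, ← Real.exp_add]
    simp
  have hexp' : ∀ s t, s < t →
      ENNReal.ofReal (Real.exp (-lam * t)) * ENNReal.ofReal (Real.exp (lam * s)) ≤ 1 := by
    intro s t hst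
    rw [← ENNReal.ofReal_mul (Real.exp_pos _).le, ← Real.exp_add, ENNReal.ofReal_le_one,
      Real.exp_le_one_iff]
    nlinarith
  have hval : ∀ t ∈ Icc 0 T, ENNReal.ofReal (Real.exp (-lam * t)) *
      ‖youngIntegral α T g ((Ioo 0 t).indicator (φ t))‖ₑ ≤
        P * ENNReal.ofReal (c' * lam ^ (2 * α - 1)) := by
    intro t ht
    calc _ ≤ ENNReal.ofReal (Real.exp (-lam * t)) * (Lam α T g * (ENNReal.ofReal D *
          (ENNReal.ofReal (Real.exp (lam * t)) * (M * expIntegral α lam 0 t)))) := by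
          refine mul_le_mul_right ((h.enorm_le hα0 hα4 hg ht).trans ?_) _
          gcongr
          exact hJ 0 t le_rfl ht.2
      _ = (ENNReal.ofReal (Real.exp (-lam * t)) * ENNReal.ofReal (Real.exp (lam * t))) *
          (P * expIntegral α lam 0 t) := by rw [hP]; ring
      _ = P * expIntegral α lam 0 t := by rw [hexp, one_mul]
      _ ≤ _ := by
          refine mul_le_mul_right ((expIntegral_le_lam hα0.le hα4 hl).trans
            (ENNReal.ofReal_le_ofReal ?_)) _
          gcongr
  have hincr : ∀ s t, 0 ≤ s → s < t → t ≤ T → ENNReal.ofReal (Real.exp (-lam * t)) *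
      ‖youngIntegral α T g ((Ioo 0 t).indicator (φ t)) -
        youngIntegral α T g ((Ioo 0 s).indicator (φ s))‖ₑ ≤
        P * (expIntegral α lam s t + ENNReal.ofReal ((t - s) ^ μ) * expIntegral α lam 0 s) := by
    intro s t hs hst htT
    calc _ ≤ ENNReal.ofReal (Real.exp (-lam * t)) * (Lam α T g * (ENNReal.ofReal D *
          (ENNReal.ofReal (Real.exp (lam * t)) * (M * expIntegral α lam s t) +
          ENNReal.ofReal ((t - s) ^ μ) *
            (ENNReal.ofReal (Real.exp (lam * s)) * (M * expIntegral α lam 0 s))))) := by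
          refine mul_le_mul_right ((h.enorm_sub_le hα0 hα4 hfin hg hs hst htT).trans ?_) _
          gcongr
          · exact hJ s t hs htT
          · exact hJ 0 s le_rfl (hst.le.trans htT)
      _ = (ENNReal.ofReal (Real.exp (-lam * t)) * ENNReal.ofReal (Real.exp (lam * t))) *
          (P * expIntegral α lam s t) +
          (ENNReal.ofReal (Real.exp (-lam * t)) * ENNReal.ofReal (Real.exp (lam * s))) *
            (P * (ENNReal.ofReal ((t - s) ^ μ) * expIntegral α lam 0 s)) := by rw [hP]; ring
      _ ≤ 1 * (P * expIntegral α lam s t) +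
            1 * (P * (ENNReal.ofReal ((t - s) ^ μ) * expIntegral α lam 0 s)) :=
          add_le_add (mul_le_mul_left (hexp t).le _) (mul_le_mul_left (hexp' s t hst) _)
      _ = _ := by ring
  have hint : ∀ t ∈ Icc 0 T, ∫⁻ s in Ioo 0 t, ENNReal.ofReal (Real.exp (-lam * t)) *
      ENNReal.ofReal (‖youngIntegral α T g ((Ioo 0 t).indicator (φ t)) -
        youngIntegral α T g ((Ioo 0 s).indicator (φ s))‖ / (t - s) ^ (α + 1)) ≤
        P * ENNReal.ofReal ((b₁ + b₂ + b₃) * lam ^ (2 * α - 1)) := by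
    intro t ht
    set B₁ : ℝ → ℝ≥0∞ := (Ioo (t - lam⁻¹) t).indicator fun s =>
      ENNReal.ofReal c * ENNReal.ofReal ((t - s) ^ (-(2 * α))) with hB₁
    set B₂ : ℝ → ℝ≥0∞ := (Iic (t - lam⁻¹)).indicator fun s =>
      ENNReal.ofReal (c' * lam ^ (α - 1)) * ENNReal.ofReal ((t - s) ^ (-(α + 1))) with hB₂
    set B₃ : ℝ → ℝ≥0∞ := fun s =>
      ENNReal.ofReal (c' * lam ^ (α - 1)) * ENNReal.ofReal ((t - s) ^ (-(1 + α - μ))) with hB₃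
    have hB₁m : Measurable B₁ := ((measurable_ofReal_const_sub_rpow _ _).const_mul _).indicator
      measurableSet_Ioo
    have hB₂m : Measurable B₂ := ((measurable_ofReal_const_sub_rpow _ _).const_mul _).indicator
      measurableSet_Iic
    have hB₃m : Measurable B₃ := (measurable_ofReal_const_sub_rpow _ _).const_mul _
    have hpt : ∀ s ∈ Ioo 0 t, ENNReal.ofReal (Real.exp (-lam * t)) *
      ENNReal.ofReal (‖youngIntegral α T g ((Ioo 0 t).indicator (φ t)) -
        youngIntegral α T g ((Ioo 0 s).indicator (φ s))‖ / (t - s) ^ (α + 1)) ≤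
        P * (B₁ s + B₂ s + B₃ s) := by
      intro s hs
      have hts : 0 < t - s := sub_pos.2 hs.2
      have h12 : expIntegral α lam s t * ENNReal.ofReal ((t - s) ^ (-(α + 1))) ≤
          B₁ s + B₂ s := by
        rcases le_or_gt s (t - lam⁻¹) with hcase | hcase
        · refine le_trans ?_ le_add_self
          rw [hB₂, indicator_of_mem (show s ∈ Iic (t - lam⁻¹) from hcase)]
          gcongr
          exact expIntegral_le_lam hα0.le hα4 hl
        · refine le_trans ?_ le_self_add
          rw [hB₁, indicator_of_mem (show s ∈ Ioo (t - lam⁻¹) t from ⟨hcase, hs.2⟩)]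
          refine (mul_le_mul_left (expIntegral_le_rpow hα4 hl.le hs.2.le) _).trans (le_of_eq ?_)
          have e : (t - s) ^ (-(2 * α)) = (t - s) ^ (1 - α) * (t - s) ^ (-(α + 1)) := by
            rw [← Real.rpow_add hts]; congr 1; ring
          rw [e, ← ENNReal.ofReal_mul hc0.le, ← ENNReal.ofReal_mul (by positivity), hc]
          congr 1
          ring
      have h3 : ENNReal.ofReal ((t - s) ^ μ) * expIntegral α lam 0 s *
          ENNReal.ofReal ((t - s) ^ (-(α + 1))) ≤ B₃ s := by
        have e : (t - s) ^ (-(1 + α - μ)) = (t - s) ^ μ * (t - s) ^ (-(α + 1)) := by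
          rw [← Real.rpow_add hts]; congr 1; ring
        rw [hB₃]
        simp only
        rw [e, ENNReal.ofReal_mul (Real.rpow_nonneg hts.le _)]
        calc _ ≤ ENNReal.ofReal ((t - s) ^ μ) * ENNReal.ofReal (c' * lam ^ (α - 1)) *
              ENNReal.ofReal ((t - s) ^ (-(α + 1))) := by
              gcongr
              exact expIntegral_le_lam hα0.le hα4 hl
          _ = _ := by ring
      rw [ofReal_norm_div_rpow _ hts.le, ← mul_assoc]
      refine (mul_le_mul_left (hincr s t hs.1.le hs.2 ht.2) _).trans ?_
      rw [mul_assoc, add_mul]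
      exact mul_le_mul_right (add_le_add h12 h3) _
    have hI₁ : ∫⁻ s in Ioo 0 t, B₁ s ≤ ENNReal.ofReal (b₁ * lam ^ (2 * α - 1)) := by
      refine (setLIntegral_le_lintegral _ _).trans (le_of_eq ?_)
      rw [lintegral_indicator measurableSet_Ioo,
        lintegral_const_mul _ (measurable_ofReal_const_sub_rpow _ _),
        setLIntegral_Ioo_sub_left_rpow (by linarith) (by linarith), sub_sub_cancel,
        inv_rpow_div_eq hl, neg_sub, ← ENNReal.ofReal_mul hc0.le, ← mul_assoc]
    have hI₂ : ∫⁻ s in Ioo 0 t, B₂ s ≤ ENNReal.ofReal (b₂ * lam ^ (2 * α - 1)) := by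
      refine (setLIntegral_le_lintegral _ _).trans (le_of_eq ?_)
      rw [lintegral_indicator measurableSet_Iic,
        lintegral_const_mul _ (measurable_ofReal_const_sub_rpow _ _),
        ← setLIntegral_congr Iio_ae_eq_Iic,
        setLIntegral_Iio_sub_left_rpow hα0 (by linarith), sub_sub_cancel,
        inv_rpow_div_eq hl, neg_neg, ← ENNReal.ofReal_mul (by positivity),
        show 2 * α - 1 = (α - 1) + α by ring, Real.rpow_add hl]
      congr 1
      ring
    have hI₃ : ∫⁻ s in Ioo 0 t, B₃ s ≤ ENNReal.ofReal (b₃ * lam ^ (2 * α - 1)) := by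
      rw [hB₃, lintegral_const_mul _ (measurable_ofReal_const_sub_rpow _ _),
        setLIntegral_Ioo_sub_left_rpow (by linarith) ht.1, ← ENNReal.ofReal_mul (by positivity)]
      refine ENNReal.ofReal_le_ofReal ?_
      rw [show 1 - (1 + α - μ) = μ - α by ring, sub_zero]
      calc c' * lam ^ (α - 1) * (t ^ (μ - α) / (μ - α))
          ≤ c' * lam ^ (2 * α - 1) * (T ^ (μ - α) / (μ - α)) := by
            have := ht.1
            have := ht.2
            gcongr
        _ = _ := by rw [hb₃]; ring
    calc _ ≤ ∫⁻ s in Ioo 0 t, P * (B₁ s + B₂ s + B₃ s) :=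
          setLIntegral_mono' measurableSet_Ioo hpt
      _ = P * ((∫⁻ s in Ioo 0 t, B₁ s) + (∫⁻ s in Ioo 0 t, B₂ s) + ∫⁻ s in Ioo 0 t, B₃ s) := by
          have hBm : Measurable fun s => B₁ s + B₂ s + B₃ s := (hB₁m.add hB₂m).add hB₃m
          rw [lintegral_const_mul _ hBm,
            lintegral_add_right _ hB₃m, lintegral_add_right _ hB₂m]
      _ ≤ P * (ENNReal.ofReal (b₁ * lam ^ (2 * α - 1)) + ENNReal.ofReal (b₂ * lam ^ (2 * α - 1)) +
          ENNReal.ofReal (b₃ * lam ^ (2 * α - 1))) :=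
          mul_le_mul_right (add_le_add (add_le_add hI₁ hI₂) hI₃) _
      _ = _ := by
          rw [← ENNReal.ofReal_add (by positivity) (by positivity),
            ← ENNReal.ofReal_add (by positivity) (by positivity), add_mul, add_mul]
  refine iSup₂_le fun t ht => ?_
  unfold wDensity
  rw [mul_add, ← lintegral_const_mul' _ _ ENNReal.ofReal_ne_top]
  refine (add_le_add (hval t ht) (hint t ht)).trans ?_
  rw [← mul_add, ← ENNReal.ofReal_add (by positivity) (by positivity), hP]
  calc _ = Lam α T g * (ENNReal.ofReal D * ENNReal.ofReal (c' * lam ^ (2 * α - 1) +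
        (b₁ + b₂ + b₃) * lam ^ (2 * α - 1))) * M := by ring
    _ ≤ _ := by
        rw [← ENNReal.ofReal_mul hD0]
        gcongr
        rw [div_eq_mul_inv, ← Real.rpow_neg hl.le, neg_sub, ← add_mul, ← mul_assoc]
        gcongr
        linarith

/-- The fractional integrand is at most a constant times `(t-s)^(-2α)`, integrable because `α <
1/2`; measurability comes from continuity. -/
theorem memW_of_memHolder {d : ℕ} (hα0 : 0 < α) (hα1 : α < 1 / 2) {u : ℝ → Vec d}
    (hu : MemHolder (1 - α) T u) : MemW α T u := by
  set A := holderNorm (1 - α) T u with hA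
  have hAtop : A ≠ ∞ := hu.ne
  have hinc : ∀ s t, 0 ≤ s → s < t → t ≤ T →
      ENNReal.ofReal (‖u t - u s‖ / (t - s) ^ (1 - α)) ≤ A := by
    intro s t hs hst ht
    refine le_trans ?_ (le_add_self : _ ≤ holderNorm (1 - α) T u)
    exact le_iSup_of_le s (le_iSup_of_le t (le_iSup_of_le ⟨hs, hst, ht⟩ le_rfl))
  have hnorm : ∀ s t, 0 ≤ s → s < t → t ≤ T → ‖u t - u s‖ ≤ A.toReal * (t - s) ^ (1 - α) := by
    intro s t hs hst ht
    have h := hinc s t hs hst ht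
    rw [ENNReal.ofReal_le_iff_le_toReal hAtop] at h
    exact (div_le_iff₀ (Real.rpow_pos_of_pos (sub_pos.2 hst) _)).1 h
  constructor
  · have hα2 : 0 ≤ 1 - α := by linarith
    have hH : HolderOnWith A.toNNReal ⟨1 - α, hα2⟩ u (Icc 0 T) := by
      intro x hx y hy
      wlog hxy : x < y generalizing x y
      · rcases eq_or_lt_of_le (not_lt.1 hxy) with rfl | h
        · simp
        · rw [edist_comm, edist_comm x y]
          exact this y hy x hx h
      have h := hnorm x y hx.1 hxy hy.2
      have hyx : 0 < y - x := sub_pos.2 hxy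
      rw [edist_comm, edist_comm x y, edist_dist, edist_dist, dist_eq_norm, dist_eq_norm,
        Real.norm_of_nonneg hyx.le, ENNReal.ofReal_rpow_of_pos hyx, ENNReal.coe_toNNReal hAtop,
        ← ENNReal.ofReal_toReal hAtop, ← ENNReal.ofReal_mul ENNReal.toReal_nonneg]
      exact ENNReal.ofReal_le_ofReal h
    have hpos : (0 : NNReal) < ⟨1 - α, hα2⟩ := NNReal.coe_pos.1 (show 0 < 1 - α by linarith)
    exact (continuousOn_iff_continuous_domRestrict.1 (hH.continuousOn hpos)).measurable
  · refine lt_of_le_of_lt (iSup₂_le fun t ht => ?_) (ENNReal.add_lt_top.2 ⟨hu,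
      ENNReal.mul_lt_top hu (ENNReal.ofReal_lt_top (r := T ^ (1 - 2 * α) / (1 - 2 * α)))⟩)
    refine add_le_add ?_ ?_
    · refine le_trans ?_ (le_self_add : _ ≤ holderNorm (1 - α) T u)
      exact le_iSup₂_of_le t ht le_rfl
    · calc _ ≤ ∫⁻ s in Ioo 0 t, A * ENNReal.ofReal ((t - s) ^ (-(2 * α))) := by
            refine setLIntegral_mono' measurableSet_Ioo fun s hs => ?_
            have hts : 0 < t - s := sub_pos.2 hs.2
            have h := hinc s t hs.1.le hs.2 ht.2
            refine le_trans (le_of_eq ?_) (mul_le_mul_left h _)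
            rw [← ENNReal.ofReal_mul (by positivity)]
            congr 1
            rw [div_mul_eq_mul_div, div_eq_div_iff (by positivity) (by positivity), mul_assoc,
              ← Real.rpow_add hts]
            congr 2
            ring
        _ ≤ _ := by
            rw [lintegral_const_mul _ (measurable_ofReal_const_sub_rpow _ _),
              setLIntegral_Ioo_sub_left_rpow (by linarith) ht.1, sub_zero]
            have h1 : 0 < 1 - 2 * α := by linarith
            have := ht.1
            have := ht.2
            gcongr

end Estimates

/-! ### From partial derivatives to the four-point estimate -/

section Partials

variable {d : ℕ} {E : Type*} [NormedAddCommGroup E] [NormedSpace ℝ E]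

/-- The candidate derivative `v ↦ ∑_i v_i ∂_i A(x)`. -/
def partialDeriv (A : Vec d → E) (x : Vec d) : Vec d →L[ℝ] E :=
  ∑ i, (EuclideanSpace.proj i : Vec d →L[ℝ] ℝ).smulRight
    (lineDeriv ℝ A x (EuclideanSpace.single i 1))

theorem partialDeriv_apply (A : Vec d → E) (x v : Vec d) :
    partialDeriv A x v = ∑ i, v i • lineDeriv ℝ A x (EuclideanSpace.single i 1) := by
  simp [partialDeriv]

theorem norm_le_norm_of_abs_apply_le {v w : Vec d} (h : ∀ i, |v i| ≤ |w i|) : ‖v‖ ≤ ‖w‖ := by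
  rw [EuclideanSpace.norm_eq, EuclideanSpace.norm_eq]
  refine Real.sqrt_le_sqrt (Finset.sum_le_sum fun i _ => ?_)
  rw [Real.norm_eq_abs, Real.norm_eq_abs]
  exact pow_le_pow_left₀ (abs_nonneg _) (h i) 2

theorem hasDerivAt_comp_line {A : Vec d → E} {z w : Vec d} {θ : ℝ} {L : E}
    (h : HasLineDerivAt ℝ A L (z + θ • w) w) : HasDerivAt (fun θ' : ℝ => A (z + θ' • w)) L θ := by
  have h0 : HasDerivAt (fun t : ℝ => A (z + θ • w + t • w)) L (θ - θ) := by
    rw [sub_self]; exact h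
  have h1 := h0.comp_sub_const θ θ
  refine h1.congr_of_eventuallyEq (Filter.Eventually.of_forall fun θ' => ?_)
  simp only
  congr 1
  rw [add_assoc, ← add_smul]
  congr 2
  ring

/-- First order Taylor estimate from Hölder continuity of the partial derivatives, along a set of
coordinates. -/
theorem norm_taylor_finset_le {A : Vec d → E} {x v : Vec d} {κ δ : ℝ} (hδ : 0 ≤ δ) (hκ : 0 ≤ κ)
    (hdiff : ∀ y i, LineDifferentiableAt ℝ A y (EuclideanSpace.single i 1))
    (hhol : ∀ y, ‖y - x‖ ≤ ‖v‖ → ∀ i, ‖lineDeriv ℝ A y (EuclideanSpace.single i 1) -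
      lineDeriv ℝ A x (EuclideanSpace.single i 1)‖ ≤ κ * ‖y - x‖ ^ δ) (s : Finset (Fin d)) :
    ‖A (x + ∑ i ∈ s, v i • EuclideanSpace.single i (1 : ℝ)) - A x -
      ∑ i ∈ s, v i • lineDeriv ℝ A x (EuclideanSpace.single i 1)‖ ≤
      s.card * (‖v‖ * (κ * ‖v‖ ^ δ)) := by
  induction s using Finset.induction_on with
  | empty => simp
  | insert i s hi ih =>
    set z := x + ∑ j ∈ s, v j • EuclideanSpace.single j (1 : ℝ) with hz
    set e : Vec d := EuclideanSpace.single i (1 : ℝ) with he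
    -- Along the coordinate path each coordinate of the displacement is at most that of `v` in
    -- absolute value, so the path stays in the ball of radius `‖v‖` where the Hölder bound is
    -- available.
    have hin : ∀ θ ∈ Icc (0 : ℝ) 1, ‖z + θ • (v i • e) - x‖ ≤ ‖v‖ := by
      intro θ hθ
      refine norm_le_norm_of_abs_apply_le fun k => ?_
      have hsum : (∑ j ∈ s, v j • EuclideanSpace.single j (1 : ℝ)) k =
          if k ∈ s then v k else 0 := by
        rw [WithLp.ofLp_sum, Finset.sum_apply]
        simp
      have : (z + θ • (v i • e) - x) k = (if k ∈ s then v k else 0) + if k = i then θ * v i else 0 := by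
        rw [hz, add_sub_right_comm, add_sub_cancel_left, PiLp.add_apply, hsum, he]
        simp
      rw [this]
      by_cases hk : k = i
      · subst hk
        rw [if_neg hi, if_pos rfl, zero_add, abs_mul, abs_of_nonneg hθ.1]
        exact mul_le_of_le_one_left (abs_nonneg _) hθ.2
      · rw [if_neg hk, add_zero]
        split_ifs
        · exact le_rfl
        · simp
    -- With the linear part subtracted, the derivative is `v i` times an increment of the `i`-th
    -- partial derivative, hence of order `‖v‖^(1+δ)`.
    have hmv := norm_image_sub_le_of_norm_deriv_le_segment_01' (C := ‖v‖ * (κ * ‖v‖ ^ δ))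
      (f := fun θ : ℝ => A (z + θ • (v i • e)) - θ • (v i • lineDeriv ℝ A x e))
      (f' := fun θ => v i • lineDeriv ℝ A (z + θ • (v i • e)) e - (1 : ℝ) • (v i • lineDeriv ℝ A x e))
      (fun θ _ => (HasDerivAt.sub (hasDerivAt_comp_line ((hdiff _ i).hasLineDerivAt.smul (v i)))
        ((hasDerivAt_id θ).smul_const _)).hasDerivWithinAt)
      (fun θ hθ => by
        have hθ' : θ ∈ Icc (0 : ℝ) 1 := ⟨hθ.1, hθ.2.le⟩
        rw [one_smul, ← smul_sub, norm_smul]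
        refine mul_le_mul (PiLp.norm_apply_le v i) ((hhol _ (hin θ hθ') i).trans ?_)
          (norm_nonneg _) (norm_nonneg _)
        exact mul_le_mul_of_nonneg_left (Real.rpow_le_rpow (norm_nonneg _) (hin θ hθ') hδ) hκ)
    simp only [one_smul, zero_smul, add_zero, sub_zero] at hmv
    rw [Finset.sum_insert hi, Finset.sum_insert hi, Finset.card_insert_of_notMem hi]
    have hx : x + (v i • e + ∑ j ∈ s, v j • EuclideanSpace.single j (1 : ℝ)) = z + v i • e := by
      rw [hz]; abel
    rw [hx]
    calc _ = ‖(A z - A x - ∑ j ∈ s, v j • lineDeriv ℝ A x (EuclideanSpace.single j 1)) +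
          (A (z + v i • e) - v i • lineDeriv ℝ A x e - A z)‖ := by congr 1; abel
      _ ≤ s.card * (‖v‖ * (κ * ‖v‖ ^ δ)) + ‖v‖ * (κ * ‖v‖ ^ δ) := (norm_add_le _ _).trans
          (add_le_add ih hmv)
      _ = _ := by push_cast; ring

/-- A function whose partial derivatives exist and are locally Hölder continuous is Fréchet
differentiable. -/
theorem hasFDerivAt_partialDeriv {A : Vec d → E} {δ : ℝ} (hδ : 0 < δ) {κ : ℝ → ℝ}
    (hdiff : ∀ y i, LineDifferentiableAt ℝ A y (EuclideanSpace.single i 1))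
    (hhol : ∀ N, 0 ≤ N → ∀ x y, ‖x‖ ≤ N → ‖y‖ ≤ N → ∀ i : Fin d,
      ‖lineDeriv ℝ A x (EuclideanSpace.single i 1) -
        lineDeriv ℝ A y (EuclideanSpace.single i 1)‖ ≤ κ N * ‖x - y‖ ^ δ) (x : Vec d) :
    HasFDerivAt A (partialDeriv A x) x := by
  rw [hasFDerivAt_iff_isLittleO_nhds_zero, Asymptotics.isLittleO_iff]
  intro c hc
  -- The radius `‖x‖ + 1` covers all displacements `‖v‖ < 1`; the maximum is needed since `κ`
  -- carries no sign assumption.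
  set k := max (κ (‖x‖ + 1)) 0 with hk
  have hk0 : 0 ≤ k := le_max_right _ _
  have hlim : Filter.Tendsto (fun v : Vec d => d * (k * ‖v‖ ^ δ)) (nhds 0) (nhds 0) := by
    have : Continuous fun v : Vec d => d * (k * ‖v‖ ^ δ) :=
      continuous_const.mul (continuous_const.mul (continuous_norm.rpow_const
        fun _ => Or.inr hδ.le))
    have h := this.tendsto 0
    simpa [Real.zero_rpow hδ.ne'] using h
  filter_upwards [hlim.eventually (gt_mem_nhds hc), Metric.ball_mem_nhds (0 : Vec d) one_pos]
    with v hv hv1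
  rw [mem_ball_zero_iff] at hv1
  have hT := norm_taylor_finset_le (A := A) (x := x) (v := v) hδ.le hk0 hdiff (fun y hy i => by
    refine (hhol (‖x‖ + 1) (by positivity) y x ?_ (by linarith) i).trans ?_
    · calc ‖y‖ = ‖x + (y - x)‖ := by rw [add_sub_cancel]
        _ ≤ _ := (norm_add_le _ _).trans (by linarith)
    · exact mul_le_mul_of_nonneg_right (le_max_left _ _) (by positivity)) Finset.univ
  have hv' : ∑ i, v i • EuclideanSpace.single i (1 : ℝ) = v := by
    ext k
    rw [WithLp.ofLp_sum, Finset.sum_apply]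
    simp
  rw [hv', ← partialDeriv_apply, Finset.card_univ, Fintype.card_fin] at hT
  refine hT.trans ?_
  calc (d : ℝ) * (‖v‖ * (k * ‖v‖ ^ δ)) = d * (k * ‖v‖ ^ δ) * ‖v‖ := by ring
    _ ≤ _ := mul_le_mul_of_nonneg_right hv.le (norm_nonneg _)

theorem norm_segment_le {x y : Vec d} {N θ : ℝ} (hx : ‖x‖ ≤ N) (hy : ‖y‖ ≤ N)
    (hθ : θ ∈ Icc (0 : ℝ) 1) : ‖y + θ • (x - y)‖ ≤ N := by
  have h : y + θ • (x - y) = (1 - θ) • y + θ • x := by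
    rw [sub_smul, smul_sub, one_smul]; abel
  rw [h]
  refine (norm_add_le _ _).trans ?_
  rw [norm_smul, norm_smul, Real.norm_of_nonneg hθ.1, Real.norm_of_nonneg (sub_nonneg.2 hθ.2)]
  nlinarith [hθ.1, hθ.2]

/-- Estimate of the mixed difference `A(x₁) - A(x₂) - (B(y₁) - B(y₂))`. -/
theorem norm_mixed_difference_le {A B : Vec d → E} {N K b κ δ : ℝ} (hK : 0 ≤ K) (hκ : 0 ≤ κ)
    (hδ0 : 0 < δ) (hδ1 : δ ≤ 1)
    (hA : ∀ x, HasFDerivAt A (partialDeriv A x) x) (hB : ∀ x, HasFDerivAt B (partialDeriv B x) x)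
    (hLip : ∀ x y, ‖B x - B y‖ ≤ K * ‖x - y‖)
    (hAB : ∀ x, ∀ i : Fin d, ‖lineDeriv ℝ A x (EuclideanSpace.single i 1) -
        lineDeriv ℝ B x (EuclideanSpace.single i 1)‖ ≤ b)
    (hhol : ∀ x y, ‖x‖ ≤ N → ‖y‖ ≤ N → ∀ i : Fin d,
      ‖lineDeriv ℝ B x (EuclideanSpace.single i 1) -
        lineDeriv ℝ B y (EuclideanSpace.single i 1)‖ ≤ κ * ‖x - y‖ ^ δ)
    {x₁ x₂ y₁ y₂ : Vec d} (hx₁ : ‖x₁‖ ≤ N) (hx₂ : ‖x₂‖ ≤ N) (hy₁ : ‖y₁‖ ≤ N) (hy₂ : ‖y₂‖ ≤ N) :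
    ‖(A x₁ - A x₂) - (B y₁ - B y₂)‖ ≤ d * (K * ‖(x₁ - x₂) - (y₁ - y₂)‖ +
      ‖x₁ - x₂‖ * (b + κ * (‖x₁ - y₁‖ ^ δ + ‖x₂ - y₂‖ ^ δ))) := by
  set p : ℝ → Vec d := fun θ => x₂ + θ • (x₁ - x₂) with hp
  set q : ℝ → Vec d := fun θ => y₂ + θ • (y₁ - y₂) with hq
  have hpd : ∀ θ, HasDerivAt p (x₁ - x₂) θ := fun θ => by
    have h := ((hasDerivAt_id θ).smul_const (x₁ - x₂)).const_add x₂
    rwa [one_smul] at h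
  have hqd : ∀ θ, HasDerivAt q (y₁ - y₂) θ := fun θ => by
    have h := ((hasDerivAt_id θ).smul_const (y₁ - y₂)).const_add y₂
    rwa [one_smul] at h
  have hlipB : LipschitzWith K.toNNReal B := LipschitzWith.of_dist_le_mul fun x y => by
    rw [dist_eq_norm, dist_eq_norm, Real.coe_toNNReal _ hK]
    exact hLip x y
  have hBd : ∀ x i, ‖lineDeriv ℝ B x (EuclideanSpace.single i 1)‖ ≤ K := fun x i => by
    have h := norm_lineDeriv_le_of_lipschitz ℝ hlipB (x₀ := x) (v := EuclideanSpace.single i 1)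
    rwa [PiLp.norm_single, norm_one, mul_one, Real.coe_toNNReal _ hK] at h
  -- `p θ - q θ` is a convex combination of `x₁ - y₁` and `x₂ - y₂`, and `r ↦ r^δ` is subadditive
  -- for `δ ≤ 1`.
  have hpq : ∀ θ ∈ Icc (0 : ℝ) 1, ‖p θ - q θ‖ ^ δ ≤ ‖x₁ - y₁‖ ^ δ + ‖x₂ - y₂‖ ^ δ := by
    intro θ hθ
    refine le_trans ?_ (Real.rpow_add_le_add_rpow (norm_nonneg _) (norm_nonneg _) hδ0.le hδ1)
    refine Real.rpow_le_rpow (norm_nonneg _) ?_ hδ0.le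
    have h : p θ - q θ = θ • (x₁ - y₁) + (1 - θ) • (x₂ - y₂) := by
      simp only [hp, hq, sub_smul, smul_sub, one_smul]; abel
    rw [h]
    refine (norm_add_le _ _).trans ?_
    rw [norm_smul, norm_smul, Real.norm_of_nonneg hθ.1, Real.norm_of_nonneg (sub_nonneg.2 hθ.2)]
    exact add_le_add (mul_le_of_le_one_left (norm_nonneg _) hθ.2)
      (mul_le_of_le_one_left (norm_nonneg _) (by linarith [hθ.1]))
  -- Both differences are the change of `A ∘ p - B ∘ q` over `[0,1]`. Its derivative is a sum over
  -- `d` coordinates, whence the factor `d`.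
  have hmv := norm_image_sub_le_of_norm_deriv_le_segment_01'
    (C := d * (K * ‖(x₁ - x₂) - (y₁ - y₂)‖ +
      ‖x₁ - x₂‖ * (b + κ * (‖x₁ - y₁‖ ^ δ + ‖x₂ - y₂‖ ^ δ))))
    (f := fun θ : ℝ => A (p θ) - B (q θ))
    (f' := fun θ => partialDeriv A (p θ) (x₁ - x₂) - partialDeriv B (q θ) (y₁ - y₂))
    (fun θ _ => (((hA (p θ)).comp_hasDerivAt θ (hpd θ)).sub
      ((hB (q θ)).comp_hasDerivAt θ (hqd θ))).hasDerivWithinAt)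
    (fun θ hθ => by
      have hθ' : θ ∈ Icc (0 : ℝ) 1 := ⟨hθ.1, hθ.2.le⟩
      rw [partialDeriv_apply, partialDeriv_apply, ← Finset.sum_sub_distrib]
      refine (norm_sum_le _ _).trans ?_
      refine (Finset.sum_le_card_nsmul _ _ _ fun i _ => ?_).trans_eq
        (by rw [Finset.card_univ, Fintype.card_fin, nsmul_eq_mul])
      set LA := lineDeriv ℝ A (p θ) (EuclideanSpace.single i 1) with hLA
      set LB := lineDeriv ℝ B (q θ) (EuclideanSpace.single i 1) with hLB
      have hAB' : ‖LA - LB‖ ≤ b + κ * (‖x₁ - y₁‖ ^ δ + ‖x₂ - y₂‖ ^ δ) := by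
        refine (norm_sub_le_norm_sub_add_norm_sub _
          (lineDeriv ℝ B (p θ) (EuclideanSpace.single i 1)) _).trans (add_le_add (hAB _ i) ?_)
        refine (hhol (p θ) (q θ) (norm_segment_le hx₁ hx₂ hθ')
          (norm_segment_le hy₁ hy₂ hθ') i).trans ?_
        exact mul_le_mul_of_nonneg_left (hpq θ hθ') hκ
      -- Exchanging directions first gives `(x₁-x₂) - (y₁-y₂)` against a partial derivative bounded
      -- by `K`; the remainder compares `∂_i A` at `p θ` with `∂_i B` at `q θ`.
      calc ‖(x₁ - x₂) i • LA - (y₁ - y₂) i • LB‖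
          = ‖((x₁ - x₂) - (y₁ - y₂)) i • LB + (x₁ - x₂) i • (LA - LB)‖ := by
            congr 1
            rw [show ((x₁ - x₂) - (y₁ - y₂)) i = (x₁ - x₂) i - (y₁ - y₂) i from rfl, sub_smul,
              smul_sub]
            abel
        _ ≤ ‖((x₁ - x₂) - (y₁ - y₂)) i‖ * ‖LB‖ + ‖(x₁ - x₂) i‖ * ‖LA - LB‖ := by
            refine (norm_add_le _ _).trans_eq ?_
            rw [norm_smul, norm_smul]
        _ ≤ ‖(x₁ - x₂) - (y₁ - y₂)‖ * K +
            ‖x₁ - x₂‖ * (b + κ * (‖x₁ - y₁‖ ^ δ + ‖x₂ - y₂‖ ^ δ)) := by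
            refine add_le_add (mul_le_mul (PiLp.norm_apply_le _ i) (hBd _ i) (norm_nonneg _)
              (norm_nonneg _)) (mul_le_mul (PiLp.norm_apply_le _ i) hAB' (norm_nonneg _)
              (norm_nonneg _))
        _ = _ := by ring)
  have e : (A x₁ - A x₂) - (B y₁ - B y₂) = (A (p 1) - B (q 1)) - (A (p 0) - B (q 0)) := by
    simp only [hp, hq, one_smul, zero_smul, add_zero, add_sub_cancel]
    abel
  rw [e]
  exact hmv

end Partials

/-! ### Fractional integrals of dominated increments -/

section Norms

variable {E : Type*} [NormedAddCommGroup E] {α T : ℝ}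

theorem wExpNorm_congr {lam : ℝ} {f h : ℝ → E} (hfh : ∀ t ∈ Icc 0 T, f t = h t) :
    wExpNorm α lam T f = wExpNorm α lam T h := by
  unfold wExpNorm
  refine iSup_congr fun t => iSup_congr fun ht => ?_
  unfold wDensity
  rw [hfh t ht, setLIntegral_congr_fun measurableSet_Ioo fun s hs => ?_]
  rw [hfh s ⟨hs.1.le, hs.2.le.trans ht.2⟩]

theorem wExpNorm_zero (lam : ℝ) : wExpNorm α lam T (fun _ => (0 : E)) = 0 := by
  simp [wExpNorm, wDensity]

theorem wDensity_le_wNorm (f : ℝ → E) {t : ℝ} (ht : t ∈ Icc 0 T) :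
    wDensity α f t ≤ wNorm α T f :=
  le_iSup₂_of_le (f := fun t (_ : t ∈ Icc 0 T) => wDensity α f t) t ht le_rfl

theorem wDensity_le_wExpNorm (f : ℝ → E) (lam : ℝ) {t : ℝ} (ht : t ∈ Icc 0 T) :
    wDensity α f t ≤ wExpNorm α lam T f * ENNReal.ofReal (Real.exp (lam * t)) := by
  have h : ENNReal.ofReal (Real.exp (-lam * t)) * wDensity α f t ≤ wExpNorm α lam T f :=
    le_iSup₂_of_le (f := fun t (_ : t ∈ Icc 0 T) =>
      ENNReal.ofReal (Real.exp (-lam * t)) * wDensity α f t) t ht le_rfl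
  refine le_trans (le_of_eq ?_) (mul_le_mul_left h _)
  rw [mul_right_comm, ← ENNReal.ofReal_mul (Real.exp_pos _).le, ← Real.exp_add]
  simp

theorem norm_le_of_supNorm_le {f : ℝ → E} {N : ℝ} (hN : 0 ≤ N)
    (h : supNorm T f ≤ ENNReal.ofReal N) {t : ℝ} (ht : t ∈ Icc 0 T) : ‖f t‖ ≤ N := by
  have h1 : ‖f t‖ₑ ≤ ENNReal.ofReal N :=
    (le_iSup₂_of_le (f := fun t (_ : t ∈ Icc 0 T) => ‖f t‖ₑ) t ht le_rfl).trans h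
  rwa [← ofReal_norm, ENNReal.ofReal_le_ofReal_iff hN] at h1

theorem lintegral_le_deltaFun (f : ℝ → E) (δ : ℝ) {t : ℝ} (ht : t ∈ Icc 0 T) :
    ∫⁻ s in Ioo 0 t, ENNReal.ofReal (‖f t - f s‖ ^ δ / (t - s) ^ (α + 1)) ≤ deltaFun α δ T f :=
  le_iSup₂_of_le (f := fun t (_ : t ∈ Icc 0 T) =>
    ∫⁻ s in Ioo 0 t, ENNReal.ofReal (‖f t - f s‖ ^ δ / (t - s) ^ (α + 1))) t ht le_rfl

theorem MemW.aemeasurable [MeasurableSpace E] {f : ℝ → E} (hf : MemW α T f) {r : ℝ} (hr : r ≤ T) :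
    AEMeasurable f (volume.restrict (Ioo 0 r)) := by
  refine (measurable_indicator_of_domRestrict measurableSet_Icc hf.1).aemeasurable.congr ?_
  filter_upwards [ae_restrict_mem measurableSet_Ioo] with y hy
  exact indicator_of_mem (show y ∈ Icc 0 T from ⟨hy.1.le, hy.2.le.trans hr⟩) f

theorem setLIntegral_rpow_gap_le {β r : ℝ} (hβ : α < β) (hr : r ∈ Icc 0 T) :
    ∫⁻ y in Ioo 0 r, ENNReal.ofReal ((r - y) ^ (-(1 + α - β))) ≤
      ENNReal.ofReal (T ^ (β - α) / (β - α)) := by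
  rw [setLIntegral_Ioo_sub_left_rpow (by linarith) hr.1]
  refine ENNReal.ofReal_le_ofReal ?_
  rw [show 1 - (1 + α - β) = β - α by ring, sub_zero]
  have h1 := hr.1
  have h2 := hr.2
  have h3 : 0 < β - α := by linarith
  gcongr

theorem rpow_gap_eq {β x : ℝ} (hx : 0 < x) : x ^ (-(1 + α - β)) = x ^ β / x ^ (α + 1) := by
  rw [← Real.rpow_sub hx]; congr 1; ring

/-- Increments dominated by those of `f` and a power of the distance. -/
theorem lintegral_increment_le {F : Type*} [NormedAddCommGroup F] {f : ℝ → E} {D : ℝ → F}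
    {β K c r : ℝ} (hβ : α < β) (hK : 0 ≤ K) (hc : 0 ≤ c) (hr : r ∈ Icc 0 T)
    (hD : ∀ y ∈ Ioo 0 r, ‖D y‖ ≤ c * (K * (‖f r - f y‖ + (r - y) ^ β))) :
    ∫⁻ y in Ioo 0 r, ‖D y‖ₑ * ENNReal.ofReal ((r - y) ^ (-(α + 1))) ≤
      ENNReal.ofReal c * (ENNReal.ofReal (K * (1 + T ^ (β - α) / (β - α))) *
        (1 + wDensity α f r)) := by
  have hc0 : 0 ≤ T ^ (β - α) / (β - α) :=
    div_nonneg (Real.rpow_nonneg (hr.1.trans hr.2) _) (by linarith)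
  calc _ ≤ ∫⁻ y in Ioo 0 r, ENNReal.ofReal c * (ENNReal.ofReal K *
        (ENNReal.ofReal (‖f r - f y‖ / (r - y) ^ (α + 1)) +
          ENNReal.ofReal ((r - y) ^ (-(1 + α - β))))) := by
        refine setLIntegral_mono' measurableSet_Ioo fun y hy => ?_
        have hry : 0 < r - y := sub_pos.2 hy.2
        rw [← ofReal_norm_div_rpow _ hry.le, ← ENNReal.ofReal_add (by positivity) (by positivity),
          ← ENNReal.ofReal_mul hK, ← ENNReal.ofReal_mul hc]
        refine ENNReal.ofReal_le_ofReal ?_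
        rw [rpow_gap_eq hry, ← add_div, ← mul_div_assoc, ← mul_div_assoc]
        exact div_le_div_of_nonneg_right (hD y hy) (by positivity)
    _ = ENNReal.ofReal c * (ENNReal.ofReal K *
        ((∫⁻ y in Ioo 0 r, ENNReal.ofReal (‖f r - f y‖ / (r - y) ^ (α + 1))) +
          ∫⁻ y in Ioo 0 r, ENNReal.ofReal ((r - y) ^ (-(1 + α - β))))) := by
        rw [lintegral_const_mul' _ _ ENNReal.ofReal_ne_top,
          lintegral_const_mul' _ _ ENNReal.ofReal_ne_top,
          lintegral_add_right _ (measurable_ofReal_const_sub_rpow _ _)]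
    _ ≤ ENNReal.ofReal c * (ENNReal.ofReal K *
        (wDensity α f r + ENNReal.ofReal (T ^ (β - α) / (β - α)))) := by
        gcongr
        · exact le_add_self
        · exact setLIntegral_rpow_gap_le hβ hr
    _ ≤ ENNReal.ofReal c * (ENNReal.ofReal K *
        ((1 + wDensity α f r) + ENNReal.ofReal (T ^ (β - α) / (β - α)) * (1 + wDensity α f r))) := by
        gcongr
        · exact le_add_self
        · exact le_mul_of_one_le_right zero_le le_self_add
    _ = _ := by
        rw [ENNReal.ofReal_mul hK, ENNReal.ofReal_add zero_le_one hc0, ENNReal.ofReal_one]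
        ring

/-- Increments dominated by the right-hand side of the mixed difference estimate. -/
theorem lintegral_mixed_increment_le [MeasurableSpace E] [BorelSpace E]
    [SecondCountableTopology E] {F : Type*} [NormedAddCommGroup F] {f h : ℝ → E} {D : ℝ → F}
    {β δ K κ n c r : ℝ} (hβ : α < β) (hK : 0 ≤ K) (hκ : 0 ≤ κ) (hn : 0 ≤ n) (hc : 0 ≤ c)
    (hr : r ∈ Icc 0 T) (hf : MemW α T f) (hh : MemW α T h)
    (hD : ∀ y ∈ Ioo 0 r, ‖D y‖ ≤ c * (n * (K * ‖(f r - h r) - (f y - h y)‖ +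
      ‖f r - h r‖ * (K * (r - y) ^ β + κ * (‖f r - f y‖ ^ δ + ‖h r - h y‖ ^ δ))))) :
    ∫⁻ y in Ioo 0 r, ‖D y‖ₑ * ENNReal.ofReal ((r - y) ^ (-(α + 1))) ≤
      ENNReal.ofReal c * (ENNReal.ofReal (n * (K + K * (T ^ (β - α) / (β - α)) + κ)) *
        (1 + deltaFun α δ T f + deltaFun α δ T h) * wDensity α (fun t => f t - h t) r) := by
  have hc0 : 0 ≤ T ^ (β - α) / (β - α) :=
    div_nonneg (Real.rpow_nonneg (hr.1.trans hr.2) _) (by linarith)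
  set c₀ := T ^ (β - α) / (β - α) with hc₀
  set w : ℝ → E := fun t => f t - h t with hw
  have hfm := hf.aemeasurable hr.2
  have hhm := hh.aemeasurable hr.2
  have ham : AEMeasurable (fun y => ENNReal.ofReal (‖w r - w y‖ / (r - y) ^ (α + 1)))
      (volume.restrict (Ioo 0 r)) := by
    have : AEMeasurable w (volume.restrict (Ioo 0 r)) := hfm.sub hhm
    fun_prop
  have hem : AEMeasurable (fun y => ENNReal.ofReal (‖f r - f y‖ ^ δ / (r - y) ^ (α + 1)))
      (volume.restrict (Ioo 0 r)) := by
    fun_prop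
  set W := wDensity α w r with hW
  set Δ := deltaFun α δ T f + deltaFun α δ T h with hΔ
  calc _ ≤ ∫⁻ y in Ioo 0 r, ENNReal.ofReal c * (ENNReal.ofReal n * (ENNReal.ofReal K *
        ENNReal.ofReal (‖w r - w y‖ / (r - y) ^ (α + 1)) + ‖w r‖ₑ * (ENNReal.ofReal K *
          ENNReal.ofReal ((r - y) ^ (-(1 + α - β))) + ENNReal.ofReal κ *
          (ENNReal.ofReal (‖f r - f y‖ ^ δ / (r - y) ^ (α + 1)) +
            ENNReal.ofReal (‖h r - h y‖ ^ δ / (r - y) ^ (α + 1)))))) := by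
        refine setLIntegral_mono' measurableSet_Ioo fun y hy => ?_
        have hry : 0 < r - y := sub_pos.2 hy.2
        rw [← ofReal_norm_div_rpow _ hry.le, ← ofReal_norm,
          ← ENNReal.ofReal_add (p := ‖f r - f y‖ ^ δ / (r - y) ^ (α + 1)) (by positivity)
            (by positivity), ← ENNReal.ofReal_mul hκ, ← ENNReal.ofReal_mul hK,
          ← ENNReal.ofReal_mul hK, ← ENNReal.ofReal_add (by positivity) (by positivity),
          ← ENNReal.ofReal_mul (norm_nonneg _),
          ← ENNReal.ofReal_add (by positivity) (by positivity), ← ENNReal.ofReal_mul hn,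
          ← ENNReal.ofReal_mul hc]
        refine ENNReal.ofReal_le_ofReal ?_
        refine (div_le_div_of_nonneg_right (hD y hy) (by positivity)).trans (le_of_eq ?_)
        rw [rpow_gap_eq hry]
        ring
    _ = ENNReal.ofReal c * (ENNReal.ofReal n * (ENNReal.ofReal K *
        (∫⁻ y in Ioo 0 r, ENNReal.ofReal (‖w r - w y‖ / (r - y) ^ (α + 1))) +
          ‖w r‖ₑ * (ENNReal.ofReal K *
          (∫⁻ y in Ioo 0 r, ENNReal.ofReal ((r - y) ^ (-(1 + α - β)))) + ENNReal.ofReal κ *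
          ((∫⁻ y in Ioo 0 r, ENNReal.ofReal (‖f r - f y‖ ^ δ / (r - y) ^ (α + 1))) +
            ∫⁻ y in Ioo 0 r, ENNReal.ofReal (‖h r - h y‖ ^ δ / (r - y) ^ (α + 1)))))) := by
        rw [lintegral_const_mul' _ _ ENNReal.ofReal_ne_top,
          lintegral_const_mul' _ _ ENNReal.ofReal_ne_top,
          lintegral_add_left' (ham.const_mul _), lintegral_const_mul' _ _ ENNReal.ofReal_ne_top,
          lintegral_const_mul' _ _ enorm_ne_top,
          lintegral_add_left ((measurable_ofReal_const_sub_rpow _ _).const_mul _),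
          lintegral_const_mul' _ _ ENNReal.ofReal_ne_top,
          lintegral_const_mul' _ _ ENNReal.ofReal_ne_top, lintegral_add_left' hem]
    -- `W` bounds both the increment integral of `f - h` and the value `‖f r - h r‖`. That value
    -- multiplies the integrals of `‖f r - f y‖^δ` and `‖h r - h y‖^δ`, which is how `Δ` enters.
    _ ≤ ENNReal.ofReal c * (ENNReal.ofReal n * (ENNReal.ofReal K * W +
          W * (ENNReal.ofReal K * ENNReal.ofReal c₀ + ENNReal.ofReal κ * Δ))) := by
        gcongr
        · exact le_add_self
        · exact le_self_add
        · exact setLIntegral_rpow_gap_le hβ hr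
        · exact add_le_add (lintegral_le_deltaFun f δ hr) (lintegral_le_deltaFun h δ hr)
    _ ≤ ENNReal.ofReal c * (ENNReal.ofReal n * (ENNReal.ofReal K * (W * (1 + Δ)) +
          W * (ENNReal.ofReal K * (ENNReal.ofReal c₀ * (1 + Δ)) + ENNReal.ofReal κ * (1 + Δ)))) := by
        gcongr
        · exact le_mul_of_one_le_right zero_le le_self_add
        · exact le_mul_of_one_le_right zero_le le_self_add
        · exact le_add_self
    _ = _ := by
        rw [ENNReal.ofReal_mul hn, ENNReal.ofReal_add (by positivity) hκ,
          ENNReal.ofReal_add hK (by positivity), ENNReal.ofReal_mul hK, hΔ]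
        ring

end Norms

/-! ### Verification of the domination under (H1) -/

section Hypothesis

variable {d m : ℕ} {T α β μ δ K : ℝ} {KN : ℝ → ℝ} {σ : ℝ → ℝ → Vec d → Mat d m}

/-- Regularity in `(s,x)` shared by `σ` and `∂_t σ`. -/
structure SpatialRegularity (T β δ K : ℝ) (KN : ℝ → ℝ) (F : ℝ → ℝ → Vec d → Mat d m) : Prop where
  diff : ∀ t ∈ Icc 0 T, ∀ s ∈ Icc 0 T, ∀ x, ∀ i : Fin d,
    LineDifferentiableAt ℝ (F t s) x (EuclideanSpace.single i 1)
  lip : ∀ t ∈ Icc 0 T, ∀ s ∈ Icc 0 T, ∀ x y, ‖F t s x - F t s y‖ ≤ K * ‖x - y‖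
  holder : ∀ t ∈ Icc 0 T, ∀ s₁ ∈ Icc 0 T, ∀ s₂ ∈ Icc 0 T, ∀ x,
    ‖F t s₁ x - F t s₂ x‖ ≤ K * |s₁ - s₂| ^ β
  holder_dx : ∀ N, 0 ≤ N → ∀ t ∈ Icc 0 T, ∀ s ∈ Icc 0 T, ∀ x y, ‖x‖ ≤ N → ‖y‖ ≤ N →
    ∀ i : Fin d, ‖dx i F t s x - dx i F t s y‖ ≤ KN N * ‖x - y‖ ^ δ
  holder_s_dx : ∀ t ∈ Icc 0 T, ∀ s₁ ∈ Icc 0 T, ∀ s₂ ∈ Icc 0 T, ∀ x, ∀ i : Fin d,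
    ‖dx i F t s₁ x - dx i F t s₂ x‖ ≤ K * |s₁ - s₂| ^ β

theorem HypH1.spatialRegularity (h : HypH1 T β μ δ K KN σ) :
    SpatialRegularity T β δ K KN σ where
  diff := h.exists_dx
  lip t ht s hs x y := (le_add_of_nonneg_right (norm_nonneg _)).trans (h.lip_x t ht s hs x y)
  holder t ht s₁ h₁ s₂ h₂ x :=
    (le_add_of_nonneg_right (norm_nonneg _)).trans (h.holder_s t ht s₁ h₁ s₂ h₂ x)
  holder_dx N hN t ht s hs x y hx hy i :=
    (le_add_of_nonneg_right (norm_nonneg _)).trans (h.holder_x N hN t ht s hs x y hx hy i)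
  holder_s_dx t ht s₁ h₁ s₂ h₂ x i :=
    (le_add_of_nonneg_left (norm_nonneg _)).trans (h.holder_s_dx t ht s₁ h₁ s₂ h₂ x i)

theorem HypH1.spatialRegularity_dt (h : HypH1 T β μ δ K KN σ) :
    SpatialRegularity T β δ K KN (dt T σ) where
  diff := h.exists_dxdt
  lip t ht s hs x y := (le_add_of_nonneg_left (norm_nonneg _)).trans (h.lip_x t ht s hs x y)
  holder t ht s₁ h₁ s₂ h₂ x :=
    (le_add_of_nonneg_left (norm_nonneg _)).trans (h.holder_s t ht s₁ h₁ s₂ h₂ x)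
  holder_dx N hN t ht s hs x y hx hy i :=
    (le_add_of_nonneg_left (norm_nonneg _)).trans (h.holder_x N hN t ht s hs x y hx hy i)
  holder_s_dx t ht s₁ h₁ s₂ h₂ x i :=
    (le_add_of_nonneg_right (norm_nonneg _)).trans (h.holder_s_dx t ht s₁ h₁ s₂ h₂ x i)

/-- The sign of `K` is forced by Hölder continuity in `t` between the distinct times `0` and `T`;
that condition is indexed by a coordinate, so `d ≥ 1` is needed. -/
theorem HypH1.K_nonneg (h : HypH1 T β μ δ K KN σ) (hd : 1 ≤ d) (hT : 0 < T) : 0 ≤ K := by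
  have h1 := h.holder_t T ⟨hT.le, le_rfl⟩ 0 ⟨le_rfl, hT.le⟩ 0 ⟨le_rfl, hT.le⟩ 0 ⟨0, hd⟩
  have h2 : 0 ≤ K * |T - 0| ^ μ := le_trans (by positivity) h1
  rw [sub_zero, abs_of_pos hT] at h2
  exact nonneg_of_mul_nonneg_left h2 (Real.rpow_pos_of_pos hT _)

theorem HypH1.hasDerivWithinAt (h : HypH1 T β μ δ K KN σ) {t s : ℝ} (ht : t ∈ Icc 0 T)
    (hs : s ∈ Icc 0 T) (x : Vec d) :
    HasDerivWithinAt (fun τ => σ τ s x) (dt T σ t s x) (Icc 0 T) t :=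
  (h.exists_dt t ht s hs x).hasDerivWithinAt

theorem HypH1.measurable_indicator (h : HypH1 T β μ δ K KN σ) {f : ℝ → Vec d}
    (hf : Measurable ((Icc 0 T).domRestrict f)) {t : ℝ} (ht : t ∈ Icc 0 T) :
    Measurable ((Ioo 0 t).indicator fun r => σ t r (f r)) := by
  have h1 : Measurable ((Icc 0 T).domRestrict fun r => σ t r (f r)) :=
    h.meas.comp ((measurable_const (a := (⟨t, ht⟩ : Icc (0 : ℝ) T))).prodMk
      (measurable_id.prodMk hf))
  have h2 := (measurable_indicator_of_domRestrict measurableSet_Icc h1).indicator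
    (measurableSet_Ioo (a := (0 : ℝ)) (b := t))
  rwa [indicator_indicator, inter_eq_self_of_subset_left
    (Ioo_subset_Icc_self.trans (Icc_subset_Icc_right ht.2))] at h2

/-- The four-point estimate for `A = F t r` and `B = F t y`, whose partial derivatives differ by at
most `K |r-y|^β`. -/
theorem SpatialRegularity.norm_mixed_le {F : ℝ → ℝ → Vec d → Mat d m}
    (h : SpatialRegularity T β δ K KN F) (hK : 0 ≤ K) (hδ0 : 0 < δ) (hδ1 : δ ≤ 1) {N : ℝ}
    (hN : 0 ≤ N) (hκ : 0 ≤ KN N) {t r y : ℝ} (ht : t ∈ Icc 0 T) (hr : r ∈ Icc 0 T)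
    (hy : y ∈ Icc 0 T) {x₁ x₂ y₁ y₂ : Vec d} (hx₁ : ‖x₁‖ ≤ N) (hx₂ : ‖x₂‖ ≤ N) (hy₁ : ‖y₁‖ ≤ N)
    (hy₂ : ‖y₂‖ ≤ N) :
    ‖(F t r x₁ - F t r x₂) - (F t y y₁ - F t y y₂)‖ ≤ d * (K * ‖(x₁ - x₂) - (y₁ - y₂)‖ +
      ‖x₁ - x₂‖ * (K * |r - y| ^ β + KN N * (‖x₁ - y₁‖ ^ δ + ‖x₂ - y₂‖ ^ δ))) :=
  norm_mixed_difference_le hK hκ hδ0 hδ1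
    (hasFDerivAt_partialDeriv hδ0 (h.diff t ht r hr) fun N hN => h.holder_dx N hN t ht r hr)
    (hasFDerivAt_partialDeriv hδ0 (h.diff t ht y hy) fun N hN => h.holder_dx N hN t ht y hy)
    (h.lip t ht y hy) (h.holder_s_dx t ht r hr y hy) (h.holder_dx N hN t ht y hy) hx₁ hx₂ hy₁ hy₂

/-- Converts the factor `t-s` given by the mean value inequality in time into the factor `(t-s)^μ`
required by `VolterraBound`. -/
theorem sub_le_rpow_mul {s t : ℝ} (hs : 0 ≤ s) (hst : s < t) (htT : t ≤ T) (hμ : μ ≤ 1) :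
    t - s ≤ (t - s) ^ μ * T ^ (1 - μ) := by
  have hts : 0 < t - s := sub_pos.2 hst
  calc t - s = (t - s) ^ μ * (t - s) ^ (1 - μ) := by rw [← Real.rpow_add hts]; simp
    _ ≤ _ := by
      have : t - s ≤ T := by linarith
      have : 0 ≤ 1 - μ := by linarith
      gcongr

/-- Linear growth of `σ`, with constants depending only on `K`, `T` and a bound on `|σ(0,0,0)|`. -/
theorem HypH1.norm_le (h : HypH1 T β μ δ K KN σ) (hd : 1 ≤ d) (hT : 0 < T) {t r : ℝ}
    (ht : t ∈ Icc 0 T) (hr : r ∈ Icc 0 T) (x : Vec d) :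
    ‖σ t r x‖ ≤ K * ‖x‖ + (‖σ 0 0 0‖ + K * T ^ μ + K * T ^ β) := by
  have hK := h.K_nonneg hd hT
  have h0 : (0 : ℝ) ∈ Icc 0 T := ⟨le_rfl, hT.le⟩
  have h1 := h.spatialRegularity.lip t ht r hr x 0
  have h2 := (le_add_of_nonneg_right (norm_nonneg _)).trans (h.holder_t t ht 0 h0 r hr 0 ⟨0, hd⟩)
  have h3 := h.spatialRegularity.holder 0 h0 r hr 0 h0 0
  rw [sub_zero] at h1
  rw [sub_zero, abs_of_nonneg ht.1] at h2
  rw [sub_zero, abs_of_nonneg hr.1] at h3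
  have h4 : K * t ^ μ ≤ K * T ^ μ := mul_le_mul_of_nonneg_left
    (Real.rpow_le_rpow ht.1 ht.2 h.mu_pos.le) hK
  have h5 : K * r ^ β ≤ K * T ^ β := mul_le_mul_of_nonneg_left
    (Real.rpow_le_rpow hr.1 hr.2 h.beta_pos.le) hK
  have h6 : σ t r x = (σ t r x - σ t r 0) + (σ t r 0 - σ 0 r 0) + (σ 0 r 0 - σ 0 0 0) + σ 0 0 0 := by
    abel
  rw [h6]
  refine (norm_add_le _ _).trans ?_
  refine (add_le_add (norm_add₃_le) le_rfl).trans ?_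
  linarith

theorem SpatialRegularity.norm_increment_le {F : ℝ → ℝ → Vec d → Mat d m}
    (hF : SpatialRegularity T β δ K KN F) {t r y : ℝ} (ht : t ∈ Icc 0 T) (hr : r ∈ Icc 0 T)
    (hy : y ∈ Icc 0 T) (hyr : y ≤ r) (x z : Vec d) :
    ‖F t r x - F t y z‖ ≤ K * (‖x - z‖ + (r - y) ^ β) := by
  have h1 := hF.lip t ht r hr x z
  have h2 := hF.holder t ht r hr y hy z
  rw [abs_of_nonneg (sub_nonneg.2 hyr)] at h2
  refine (norm_sub_le_norm_sub_add_norm_sub _ (F t r z) _).trans ?_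
  linarith

/-- The constant in `HypH1.volterraBound`. -/
def growthConst (T α β μ K S : ℝ) : ℝ :=
  (K + (S + K * T ^ μ + K * T ^ β) + K * (1 + T ^ (β - α) / (β - α))) * (1 + T ^ (1 - μ))

/-- Sizes come from linear growth and from Hölder continuity in `t`. Increments in `r` come from
regularity in `(s,x)`: the Hölder part contributes `(r-y)^(β-α-1)`, integrable since `β > α`. -/
theorem HypH1.volterraBound (h : HypH1 T β μ δ K KN σ) (hd : 1 ≤ d) (hT : 0 < T)
    (hαβ : α < β) {S : ℝ} (hS : ‖σ 0 0 0‖ ≤ S) {f : ℝ → Vec d} (hf : MemW α T f) :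
    VolterraBound α μ T (fun t r => σ t r (f r))
      (fun r => ENNReal.ofReal (growthConst T α β μ K S) * (1 + wDensity α f r)) := by
  have hK := h.K_nonneg hd hT
  have hS0 : 0 ≤ S := (norm_nonneg _).trans hS
  have hβα : 0 < β - α := by linarith
  have hTμ : 0 ≤ T ^ (1 - μ) := by positivity
  set b₁ := K + (S + K * T ^ μ + K * T ^ β) with hb₁
  set b₂ := K * (1 + T ^ (β - α) / (β - α)) with hb₂
  have hb₁0 : 0 ≤ b₁ := by positivity
  have hb₂0 : 0 ≤ b₂ := by positivity
  have hB : growthConst T α β μ K S = (b₁ + b₂) * (1 + T ^ (1 - μ)) := rfl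
  have hKb : K ≤ b₁ := by
    have : 0 ≤ S + K * T ^ μ + K * T ^ β := by positivity
    linarith
  have hb₁B : b₁ ≤ growthConst T α β μ K S := by rw [hB]; nlinarith
  have hb₂B : b₂ ≤ growthConst T α β μ K S := by rw [hB]; nlinarith
  have hb₂B' : T ^ (1 - μ) * b₂ ≤ growthConst T α β μ K S := by rw [hB]; nlinarith
  have hmem : ∀ {t r : ℝ}, t ∈ Icc 0 T → r ∈ Ioo 0 t → r ∈ Icc 0 T := fun ht hr =>
    ⟨hr.1.le, hr.2.le.trans ht.2⟩
  constructor
  · exact fun t ht => h.measurable_indicator hf.1 ht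
  · intro t ht r hr
    have h1 := h.norm_le hd hT ht (hmem ht hr) (f r)
    calc ‖σ t r (f r)‖ₑ = ENNReal.ofReal ‖σ t r (f r)‖ := (ofReal_norm _).symm
      _ ≤ ENNReal.ofReal (b₁ * (1 + ‖f r‖)) := by
          refine ENNReal.ofReal_le_ofReal (h1.trans ?_)
          have h2 : 0 ≤ (S + K * T ^ μ + K * T ^ β) * ‖f r‖ := by positivity
          rw [hb₁]
          nlinarith
      _ = ENNReal.ofReal b₁ * (1 + ‖f r‖ₑ) := by
          rw [ENNReal.ofReal_mul hb₁0, ENNReal.ofReal_add zero_le_one (norm_nonneg _),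
            ENNReal.ofReal_one, ofReal_norm]
      _ ≤ _ := by
          gcongr
          exact le_self_add
  · intro t ht r hr
    refine (lintegral_increment_le (c := 1) (f := f) hαβ hK zero_le_one (hmem ht hr)
      fun y hy => ?_).trans ?_
    · rw [one_mul]
      exact h.spatialRegularity.norm_increment_le ht (hmem ht hr)
        (hmem ht ⟨hy.1, hy.2.trans hr.2⟩) hy.2.le _ _
    · rw [ENNReal.ofReal_one, one_mul]
      gcongr
  · intro s t hs hst htT r hr
    have ht : t ∈ Icc 0 T := ⟨hs.trans hst.le, htT⟩
    have hs' : s ∈ Icc 0 T := ⟨hs, hst.le.trans htT⟩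
    have h2 := (le_add_of_nonneg_right (norm_nonneg _)).trans
      (h.holder_t t ht s hs' r (hmem hs' hr) (f r) ⟨0, hd⟩)
    rw [abs_of_nonneg (sub_nonneg.2 hst.le)] at h2
    calc _ = ENNReal.ofReal ‖σ t r (f r) - σ s r (f r)‖ := (ofReal_norm _).symm
      _ ≤ ENNReal.ofReal ((t - s) ^ μ * K) := ENNReal.ofReal_le_ofReal (by linarith)
      _ = ENNReal.ofReal ((t - s) ^ μ) * (ENNReal.ofReal K * 1) := by
          rw [ENNReal.ofReal_mul (Real.rpow_nonneg (sub_nonneg.2 hst.le) _), mul_one]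
      _ ≤ _ := by
          gcongr
          · exact hKb.trans hb₁B
          · exact le_self_add
  · intro s t hs hst htT r hr
    have ht : t ∈ Icc 0 T := ⟨hs.trans hst.le, htT⟩
    have hs' : s ∈ Icc 0 T := ⟨hs, hst.le.trans htT⟩
    have hr' := hmem hs' hr
    have hts : 0 ≤ t - s := sub_nonneg.2 hst.le
    refine (lintegral_increment_le (c := t - s) (f := f) hαβ hK hts hr' fun y hy => ?_).trans ?_
    · have hy' := hmem hs' ⟨hy.1, hy.2.trans hr.2⟩
      -- The increment in `r` is frozen and differentiated in time, so that its change from `s` to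
      -- `t` is bounded by the same increment of `∂_t σ`.
      have hmv := (convex_Icc 0 T).norm_image_sub_le_of_norm_hasDerivWithin_le
        (f := fun τ => σ τ r (f r) - σ τ y (f y))
        (fun τ hτ => (h.hasDerivWithinAt hτ hr' (f r)).sub (h.hasDerivWithinAt hτ hy' (f y)))
        (fun τ hτ => h.spatialRegularity_dt.norm_increment_le hτ hr' hy' hy.2.le (f r) (f y))
        hs' ht
      rw [Real.norm_of_nonneg hts] at hmv
      refine le_trans (le_of_eq ?_) (hmv.trans_eq (mul_comm _ _))
      congr 1
      abel
    · calc _ ≤ ENNReal.ofReal ((t - s) ^ μ * T ^ (1 - μ)) *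
            (ENNReal.ofReal b₂ * (1 + wDensity α f r)) := by
            gcongr
            exact sub_le_rpow_mul hs hst htT h.mu_le
        _ = ENNReal.ofReal ((t - s) ^ μ) * (ENNReal.ofReal (T ^ (1 - μ) * b₂) *
            (1 + wDensity α f r)) := by
            rw [ENNReal.ofReal_mul (Real.rpow_nonneg hts _), ENNReal.ofReal_mul hTμ]
            ring
        _ ≤ _ := by gcongr

/-- The constant in `HypH1.volterraBound_sub`. -/
def lipschitzConst (d : ℕ) (T α β μ K κ : ℝ) : ℝ :=
  (K + d * (K + K * (T ^ (β - α) / (β - α)) + κ)) * (1 + T ^ (1 - μ))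

/-- Sizes come from the Lipschitz bounds and fractional increments from the four-point estimate,
applied to `σ` at fixed time and to `∂_t σ` for time increments. The dominating function is allowed
to be infinite. -/
theorem HypH1.volterraBound_sub (h : HypH1 T β μ δ K KN σ) (hd : 1 ≤ d) (hT : 0 < T)
    (hαβ : α < β) {N : ℝ} (hN : 0 ≤ N) {f g : ℝ → Vec d} (hf : MemW α T f) (hg : MemW α T g)
    (hfN : ∀ t ∈ Icc 0 T, ‖f t‖ ≤ N) (hgN : ∀ t ∈ Icc 0 T, ‖g t‖ ≤ N) :
    VolterraBound α μ T (fun t r => σ t r (f r) - σ t r (g r))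
      (fun r => ENNReal.ofReal (lipschitzConst d T α β μ K (KN N)) *
        (1 + deltaFun α δ T f + deltaFun α δ T g) * wDensity α (fun t => f t - g t) r) := by
  have hK := h.K_nonneg hd hT
  have hκ : 0 ≤ KN N := (h.KN_pos N hN).le
  have hβα : 0 < β - α := by linarith
  have hTμ : 0 ≤ T ^ (1 - μ) := by positivity
  set Δ := 1 + deltaFun α δ T f + deltaFun α δ T g with hΔ
  have hΔ1 : 1 ≤ Δ := by rw [hΔ, add_assoc]; exact le_self_add
  set W := wDensity α (fun t => f t - g t) with hW
  have hwW : ∀ r, ‖f r - g r‖ₑ ≤ W r := fun r => le_self_add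
  set b₂ := d * (K + K * (T ^ (β - α) / (β - α)) + KN N) with hb₂
  have hb₂0 : 0 ≤ b₂ := by positivity
  set B := lipschitzConst d T α β μ K (KN N) with hBdef
  have hB : B = (K + b₂) * (1 + T ^ (1 - μ)) := rfl
  have hKB : K ≤ B := by rw [hB]; nlinarith
  have hKB' : T ^ (1 - μ) * K ≤ B := by rw [hB]; nlinarith
  have hb₂B : b₂ ≤ B := by rw [hB]; nlinarith
  have hb₂B' : T ^ (1 - μ) * b₂ ≤ B := by rw [hB]; nlinarith
  have hmem : ∀ {t r : ℝ}, t ∈ Icc 0 T → r ∈ Ioo 0 t → r ∈ Icc 0 T := fun ht hr =>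
    ⟨hr.1.le, hr.2.le.trans ht.2⟩
  constructor
  · intro t ht
    rw [show ((Ioo 0 t).indicator fun r => σ t r (f r) - σ t r (g r)) =
      fun r => (Ioo 0 t).indicator (fun r => σ t r (f r)) r -
        (Ioo 0 t).indicator (fun r => σ t r (g r)) r from indicator_sub _ _ _]
    exact (h.measurable_indicator hf.1 ht).sub (h.measurable_indicator hg.1 ht)
  · intro t ht r hr
    have h1 := h.spatialRegularity.lip t ht r (hmem ht hr) (f r) (g r)
    calc _ = ENNReal.ofReal ‖σ t r (f r) - σ t r (g r)‖ := (ofReal_norm _).symm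
      _ ≤ ENNReal.ofReal (K * ‖f r - g r‖) := ENNReal.ofReal_le_ofReal h1
      _ = ENNReal.ofReal K * 1 * ‖f r - g r‖ₑ := by
          rw [ENNReal.ofReal_mul hK, ofReal_norm, mul_one]
      _ ≤ _ := by
          gcongr
          exact hwW r
  · intro t ht r hr
    refine (lintegral_mixed_increment_le (c := 1) (n := d) (δ := δ) hαβ hK hκ (Nat.cast_nonneg d)
      zero_le_one (hmem ht hr) hf hg fun y hy => ?_).trans ?_
    · have hy' := hmem ht ⟨hy.1, hy.2.trans hr.2⟩
      have hm := h.spatialRegularity.norm_mixed_le hK h.delta_pos h.delta_le hN hκ ht (hmem ht hr)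
        hy' (hfN r (hmem ht hr)) (hgN r (hmem ht hr)) (hfN y hy') (hgN y hy')
      rw [abs_of_nonneg (sub_nonneg.2 hy.2.le)] at hm
      rwa [one_mul]
    · rw [ENNReal.ofReal_one, one_mul]
      gcongr
  · intro s t hs hst htT r hr
    have ht : t ∈ Icc 0 T := ⟨hs.trans hst.le, htT⟩
    have hs' : s ∈ Icc 0 T := ⟨hs, hst.le.trans htT⟩
    have hr' := hmem hs' hr
    have hts : 0 ≤ t - s := sub_nonneg.2 hst.le
    have hmv := (convex_Icc 0 T).norm_image_sub_le_of_norm_hasDerivWithin_le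
      (f := fun τ => σ τ r (f r) - σ τ r (g r))
      (fun τ hτ => (h.hasDerivWithinAt hτ hr' (f r)).sub (h.hasDerivWithinAt hτ hr' (g r)))
      (fun τ hτ => h.spatialRegularity_dt.lip τ hτ r hr' (f r) (g r)) hs' ht
    rw [Real.norm_of_nonneg hts] at hmv
    calc _ = ENNReal.ofReal ‖σ t r (f r) - σ t r (g r) - (σ s r (f r) - σ s r (g r))‖ :=
          (ofReal_norm _).symm
      _ ≤ ENNReal.ofReal ((t - s) ^ μ * (T ^ (1 - μ) * K * ‖f r - g r‖)) := by
          refine ENNReal.ofReal_le_ofReal (hmv.trans ?_)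
          have h3 := mul_le_mul_of_nonneg_left (sub_le_rpow_mul hs hst htT h.mu_le)
            (mul_nonneg hK (norm_nonneg (f r - g r)))
          linarith
      _ = ENNReal.ofReal ((t - s) ^ μ) * (ENNReal.ofReal (T ^ (1 - μ) * K) * 1 *
            ‖f r - g r‖ₑ) := by
          rw [ENNReal.ofReal_mul (Real.rpow_nonneg hts _),
            ENNReal.ofReal_mul (mul_nonneg hTμ hK), ofReal_norm, mul_one]
      _ ≤ _ := by
          gcongr
          exact hwW r
  · intro s t hs hst htT r hr
    have ht : t ∈ Icc 0 T := ⟨hs.trans hst.le, htT⟩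
    have hs' : s ∈ Icc 0 T := ⟨hs, hst.le.trans htT⟩
    have hr' := hmem hs' hr
    have hts : 0 ≤ t - s := sub_nonneg.2 hst.le
    refine (lintegral_mixed_increment_le (c := t - s) (n := d) (δ := δ) hαβ hK hκ
      (Nat.cast_nonneg d) hts hr' hf hg fun y hy => ?_).trans ?_
    · have hy' := hmem hs' ⟨hy.1, hy.2.trans hr.2⟩
      -- The whole four-point difference is differentiated in time, reducing to the four-point
      -- estimate for `∂_t σ`.
      have hmv := (convex_Icc 0 T).norm_image_sub_le_of_norm_hasDerivWithin_le
        (f := fun τ => (σ τ r (f r) - σ τ r (g r)) - (σ τ y (f y) - σ τ y (g y)))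
        (fun τ hτ => ((h.hasDerivWithinAt hτ hr' (f r)).sub (h.hasDerivWithinAt hτ hr' (g r))).sub
          ((h.hasDerivWithinAt hτ hy' (f y)).sub (h.hasDerivWithinAt hτ hy' (g y))))
        (fun τ hτ => h.spatialRegularity_dt.norm_mixed_le hK h.delta_pos h.delta_le hN hκ hτ hr'
          hy' (hfN r hr') (hgN r hr') (hfN y hy') (hgN y hy'))
        hs' ht
      rw [Real.norm_of_nonneg hts, abs_of_nonneg (sub_nonneg.2 hy.2.le)] at hmv
      refine le_trans (le_of_eq ?_) (hmv.trans_eq (mul_comm _ _))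
      congr 1
      abel
    · calc _ ≤ ENNReal.ofReal ((t - s) ^ μ * T ^ (1 - μ)) *
            (ENNReal.ofReal b₂ * Δ * W r) := by
            gcongr
            exact sub_le_rpow_mul hs hst htT h.mu_le
        _ = ENNReal.ofReal ((t - s) ^ μ) * (ENNReal.ofReal (T ^ (1 - μ) * b₂) * Δ * W r) := by
            rw [ENNReal.ofReal_mul (Real.rpow_nonneg hts _), ENNReal.ofReal_mul hTμ]
            ring
        _ ≤ _ := by gcongr

/-- Taking `λ = 0`, the dominating function is bounded through `wNorm α T f`, which is finite by
membership in `W_0^{α,∞}`. -/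
theorem HypH1.weylMass_lt_top (h : HypH1 T β μ δ K KN σ) (hd : 1 ≤ d) (hT : 0 < T)
    (hα0 : 0 < α) (hα1 : α < 1) (hαβ : α < β) {f : ℝ → Vec d} (hf : MemW α T f) {t : ℝ}
    (ht : t ∈ Icc 0 T) : weylMass α T ((Ioo 0 t).indicator fun r => σ t r (f r)) < ∞ := by
  have hb := h.volterraBound (α := α) hd hT hαβ le_rfl hf
  refine (hb.weylMass_le hα0 ht).trans_lt (ENNReal.mul_lt_top ENNReal.ofReal_lt_top ?_)
  have h1 := endIntegral_le (α := α) (s := 0) (t := t) (lam := 0)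
    (Ψ := fun r => ENNReal.ofReal (growthConst T α β μ K ‖σ 0 0 0‖) * (1 + wDensity α f r))
    (M := ENNReal.ofReal (growthConst T α β μ K ‖σ 0 0 0‖) * (1 + wNorm α T f)) fun r hr => by
      rw [zero_mul, Real.exp_zero, ENNReal.ofReal_one, mul_one]
      gcongr
      exact wDensity_le_wNorm f ⟨hr.1.le, hr.2.le.trans ht.2⟩
  refine h1.trans_lt (ENNReal.mul_lt_top ENNReal.ofReal_lt_top (ENNReal.mul_lt_top
    (ENNReal.mul_lt_top ENNReal.ofReal_lt_top (ENNReal.add_lt_top.2 ⟨ENNReal.one_lt_top, hf.2⟩))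
    ((expIntegral_le_rpow hα1 le_rfl ht.1).trans_lt ENNReal.ofReal_lt_top)))

theorem HypH1.volterraExists (h : HypH1 T β μ δ K KN σ) (hd : 1 ≤ d) (hT : 0 < T)
    (hα0 : 0 < α) (hα1 : α < 1) (hαβ : α < β) {g : ℝ → Vec m} (hg : MemIntegrator α T g)
    {f : ℝ → Vec d} (hf : MemW α T f) {t : ℝ} (ht : t ∈ Icc 0 T) :
    VolterraExists α T σ g f t := fun i j =>
  stieltjesExists_of_weylMass_lt_top hα0.le hα1 hT (hg.enorm_weylRight_apply_le hα1 j)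
    (hg.Lam_lt_top hα0 hα1) (hg.apply j)
    (measurable_mat_apply (h.measurable_indicator hf.1 ht) (i, j))
    ((weylMass_apply_le _ (i, j)).trans_lt (h.weylMass_lt_top hd hT hα0 hα1 hαβ hf ht))

theorem HypH1.volterra_sub (h : HypH1 T β μ δ K KN σ) (hd : 1 ≤ d) (hT : 0 < T)
    (hα0 : 0 < α) (hα1 : α < 1) (hαβ : α < β) {g : ℝ → Vec m} (hg : MemIntegrator α T g)
    {f k : ℝ → Vec d} (hf : MemW α T f) (hk : MemW α T k) {t : ℝ} (ht : t ∈ Icc 0 T) :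
    volterra α T σ g f t - volterra α T σ g k t =
      youngIntegral α T g ((Ioo 0 t).indicator fun r => σ t r (f r) - σ t r (k r)) := by
  have h1 := youngIntegral_sub hα0 hα1 hT.le hg (h.measurable_indicator hf.1 ht)
    (h.measurable_indicator hk.1 ht) (h.weylMass_lt_top hd hT hα0 hα1 hαβ hf ht)
    (h.weylMass_lt_top hd hT hα0 hα1 hαβ hk ht)
  rw [show ((Ioo 0 t).indicator fun r => σ t r (f r) - σ t r (k r)) =
    fun r => (Ioo 0 t).indicator (fun r => σ t r (f r)) r -
      (Ioo 0 t).indicator (fun r => σ t r (k r)) r from indicator_sub _ _ _]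
  exact h1.symm

/-- Finiteness is taken from the two integrands separately, since the bound of
`HypH1.volterraBound_sub` is void when `Δ` is infinite. -/
theorem HypH1.weylMass_sub_lt_top (h : HypH1 T β μ δ K KN σ) (hd : 1 ≤ d) (hT : 0 < T)
    (hα0 : 0 < α) (hα1 : α < 1) (hαβ : α < β) {f k : ℝ → Vec d} (hf : MemW α T f)
    (hk : MemW α T k) {t : ℝ} (ht : t ∈ Icc 0 T) :
    weylMass α T ((Ioo 0 t).indicator fun r => σ t r (f r) - σ t r (k r)) < ∞ := by
  rw [show ((Ioo 0 t).indicator fun r => σ t r (f r) - σ t r (k r)) =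
    fun r => (Ioo 0 t).indicator (fun r => σ t r (f r)) r -
      (Ioo 0 t).indicator (fun r => σ t r (k r)) r from indicator_sub _ _ _]
  exact (weylMass_sub_le (h.measurable_indicator hf.1 ht)).trans_lt (ENNReal.add_lt_top.2
    ⟨h.weylMass_lt_top hd hT hα0 hα1 hαβ hf ht, h.weylMass_lt_top hd hT hα0 hα1 hαβ hk ht⟩)

end Hypothesis

/-! ### Assembly of the growth and Lipschitz estimates -/

section Main

variable {T α β μ K : ℝ}

theorem exists_growth_constants (d m : ℕ) (hd : 1 ≤ d) (hT : 0 < T) (hα0 : 0 < α)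
    (hα1 : α < 1 / 2) (hαβ : α < β) (hαμ : 1 - μ < α) (S : ℝ) :
    ∃ d₃ d₄ : ℝ, 0 < d₃ ∧ 0 < d₄ ∧
      ∀ (δ : ℝ) (KN : ℝ → ℝ) (σ : ℝ → ℝ → Vec d → Mat d m),
        HypH1 T β μ δ K KN σ → ‖σ 0 0 0‖ ≤ S →
        ∀ g : ℝ → Vec m, MemIntegrator α T g →
        ∀ f : ℝ → Vec d, MemW α T f →
          holderNorm (1 - α) T (volterra α T σ g f)
            ≤ Lam α T g * ENNReal.ofReal d₃ * (1 + wNorm α T f) ∧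
          ∀ lam : ℝ, 1 ≤ lam →
            wExpNorm α lam T (volterra α T σ g f)
              ≤ Lam α T g * ENNReal.ofReal (d₄ / lam ^ (1 - 2 * α)) *
                (1 + wExpNorm α lam T f) := by
  have hα2 : α < 1 := by linarith
  obtain ⟨C₁, hC₁, h₁⟩ := VolterraBound.exists_holderNorm_le d m hT hα0 hα2 hαμ
  obtain ⟨C₂, hC₂, h₂⟩ := VolterraBound.exists_wExpNorm_le d m hT hα0 hα1 hαμ
  -- The constant is fixed before any `σ` is given, so `K` may still be negative here; the maximum
  -- ensures positivity.
  set B := max (growthConst T α β μ K S) 1 with hB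
  have hB0 : 0 < B := lt_max_of_lt_right one_pos
  have hBB : ENNReal.ofReal (growthConst T α β μ K S) ≤ ENNReal.ofReal B :=
    ENNReal.ofReal_le_ofReal (le_max_left _ _)
  refine ⟨C₁ * B, C₂ * B, by positivity, by positivity, ?_⟩
  intro δ KN σ h hS g hg f hf
  have hb := h.volterraBound (α := α) hd hT hαβ hS hf
  have hfin := fun t (ht : t ∈ Icc 0 T) => h.weylMass_lt_top hd hT hα0 hα2 hαβ hf ht
  refine ⟨?_, fun lam hlam => ?_⟩
  · refine (h₁ g _ _ (ENNReal.ofReal B * (1 + wNorm α T f)) hg hb hfin fun r hr => ?_).trans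
      (le_of_eq ?_)
    · exact mul_le_mul' hBB (add_le_add le_rfl (wDensity_le_wNorm f ⟨hr.1.le, hr.2.le⟩))
    · rw [ENNReal.ofReal_mul hC₁.le]
      ring
  · have hl : 0 < lam := by linarith
    refine (h₂ g _ _ (ENNReal.ofReal B * (1 + wExpNorm α lam T f)) lam hg hb hfin hlam
      fun r hr => ?_).trans (le_of_eq ?_)
    · rw [mul_assoc, add_mul, one_mul]
      refine mul_le_mul' hBB (add_le_add ?_ (wDensity_le_wExpNorm f lam ⟨hr.1.le, hr.2.le⟩))
      rw [ENNReal.one_le_ofReal, Real.one_le_exp_iff]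
      exact mul_nonneg hl.le hr.1.le
    · rw [mul_div_right_comm, ENNReal.ofReal_mul (by positivity)]
      ring

theorem exists_lipschitz_constant (d m : ℕ) (hd : 1 ≤ d) (hT : 0 < T) (hα0 : 0 < α)
    (hα1 : α < 1 / 2) (hαβ : α < β) (hαμ : 1 - μ < α) (κ : ℝ) :
    ∃ C : ℝ, 0 < C ∧ ∀ (N δ : ℝ) (KN : ℝ → ℝ) (σ : ℝ → ℝ → Vec d → Mat d m), 0 ≤ N →
        HypH1 T β μ δ K KN σ → KN N = κ →
        ∀ g : ℝ → Vec m, MemIntegrator α T g →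
        ∀ f h : ℝ → Vec d, MemW α T f → MemW α T h →
          supNorm T f ≤ ENNReal.ofReal N → supNorm T h ≤ ENNReal.ofReal N →
          ∀ lam : ℝ, 1 ≤ lam →
            wExpNorm α lam T (fun t => volterra α T σ g f t - volterra α T σ g h t)
              ≤ Lam α T g * ENNReal.ofReal (C / lam ^ (1 - 2 * α)) *
                (1 + deltaFun α δ T f + deltaFun α δ T h) *
                wExpNorm α lam T (fun t => f t - h t) := by
  have hα2 : α < 1 := by linarith
  obtain ⟨C, hC, hest⟩ := VolterraBound.exists_wExpNorm_le d m hT hα0 hα1 hαμ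
  set B := max (lipschitzConst d T α β μ K κ) 1 with hB
  have hB0 : 0 < B := lt_max_of_lt_right one_pos
  have hBB : ENNReal.ofReal (lipschitzConst d T α β μ K κ) ≤ ENNReal.ofReal B :=
    ENNReal.ofReal_le_ofReal (le_max_left _ _)
  refine ⟨C * B, by positivity, ?_⟩
  intro N δ KN σ hN hσ hκ g hg f h hf hh hfN hhN lam hlam
  have hl : 0 < lam := by linarith
  have hb := hσ.volterraBound_sub (α := α) hd hT hαβ hN hf hh
    (fun t ht => norm_le_of_supNorm_le hN hfN ht) (fun t ht => norm_le_of_supNorm_le hN hhN ht)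
  rw [hκ] at hb
  have hfin := fun t (ht : t ∈ Icc 0 T) => hσ.weylMass_sub_lt_top hd hT hα0 hα2 hαβ hf hh ht
  rw [wExpNorm_congr fun t ht => hσ.volterra_sub hd hT hα0 hα2 hαβ hg hf hh ht]
  refine (hest g _ _ (ENNReal.ofReal B * (1 + deltaFun α δ T f + deltaFun α δ T h) *
    wExpNorm α lam T (fun t => f t - h t)) lam hg hb hfin hlam fun r hr => ?_).trans (le_of_eq ?_)
  · rw [mul_assoc _ (wExpNorm α lam T _)]
    exact mul_le_mul' (mul_le_mul' hBB le_rfl)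
      (wDensity_le_wExpNorm (fun t => f t - h t) lam ⟨hr.1.le, hr.2.le⟩)
  · rw [mul_div_right_comm, ENNReal.ofReal_mul (by positivity)]
    ring

end Main

end VolterraYoung

end

open VolterraYoung in
theorem mainTheorem4 (d m : ℕ) (hd : 1 ≤ d) (hm : 1 ≤ m) (T α β μ K : ℝ) (hT : 0 < T)
    (hα0 : 0 < α) (hα1 : α < 1 / 2) (hαβ : α < β) (hαμ : 1 - μ < α) :
    (∀ S : ℝ, ∃ d₃ d₄ : ℝ, 0 < d₃ ∧ 0 < d₄ ∧
      ∀ (δ : ℝ) (KN : ℝ → ℝ) (σ : ℝ → ℝ → Vec d → Mat d m),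
        HypH1 T β μ δ K KN σ → ‖σ 0 0 0‖ ≤ S →
        ∀ g : ℝ → Vec m, MemIntegrator α T g →
        ∀ f : ℝ → Vec d, MemW α T f →
          (∀ t ∈ Icc 0 T, VolterraExists α T σ g f t) ∧
          MemHolder (1 - α) T (volterra α T σ g f) ∧
          holderNorm (1 - α) T (volterra α T σ g f)
            ≤ Lam α T g * ENNReal.ofReal d₃ * (1 + wNorm α T f) ∧
          ∀ lam : ℝ, 1 ≤ lam →
            wExpNorm α lam T (volterra α T σ g f)
              ≤ Lam α T g * ENNReal.ofReal (d₄ / lam ^ (1 - 2 * α)) *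
                (1 + wExpNorm α lam T f)) ∧
    (∀ u : ℝ → Vec d, MemHolder (1 - α) T u → MemW α T u) ∧
    (∀ N κ : ℝ, ∃ dN : ℝ, 0 < dN ∧
      ∀ (δ : ℝ) (KN : ℝ → ℝ) (σ : ℝ → ℝ → Vec d → Mat d m),
        HypH1 T β μ δ K KN σ → KN N = κ →
        ∀ g : ℝ → Vec m, MemIntegrator α T g →
        ∀ f h : ℝ → Vec d, MemW α T f → MemW α T h →
          supNorm T f ≤ ENNReal.ofReal N → supNorm T h ≤ ENNReal.ofReal N →
          ∀ lam : ℝ, 1 ≤ lam →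
            wExpNorm α lam T (fun t => volterra α T σ g f t - volterra α T σ g h t)
              ≤ Lam α T g * ENNReal.ofReal (dN / lam ^ (1 - 2 * α)) *
                (1 + deltaFun α δ T f + deltaFun α δ T h) *
                wExpNorm α lam T (fun t => f t - h t)) := by
  have hα2 : α < 1 := by linarith
  refine ⟨fun S => ?_, fun u hu => memW_of_memHolder hα0 hα1 hu, fun N κ => ?_⟩
  · obtain ⟨d₃, d₄, h₃, h₄, hest⟩ := exists_growth_constants d m hd hT hα0 hα1 hαβ hαμ S
    refine ⟨d₃, d₄, h₃, h₄, fun δ KN σ hσ hS g hg f hf => ?_⟩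
    obtain ⟨h1, h2⟩ := hest δ KN σ hσ hS g hg f hf
    refine ⟨fun t ht => hσ.volterraExists hd hT hα0 hα2 hαβ hg hf ht, h1.trans_lt ?_, h1, h2⟩
    exact ENNReal.mul_lt_top (ENNReal.mul_lt_top (hg.Lam_lt_top hα0 hα2) ENNReal.ofReal_lt_top)
      (ENNReal.add_lt_top.2 ⟨ENNReal.one_lt_top, hf.2⟩)
  · rcases le_or_gt 0 N with hN | hN
    · obtain ⟨C, hC, hest⟩ := exists_lipschitz_constant d m hd hT hα0 hα1 hαβ hαμ κ
      exact ⟨C, hC, fun δ KN σ hσ hκ => hest N δ KN σ hN hσ hκ⟩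
    · refine ⟨1, one_pos, fun δ KN σ hσ _ g hg f h hf hh hfN hhN lam hlam => ?_⟩
      rw [ENNReal.ofReal_of_nonpos hN.le, ← ENNReal.ofReal_zero] at hfN hhN
      have hzero : wExpNorm α lam T (fun t => f t - h t) = 0 := by
        rw [← wExpNorm_zero (E := Vec d) (α := α) (T := T) lam]
        refine wExpNorm_congr fun t ht => ?_
        rw [norm_le_zero_iff.1 (norm_le_of_supNorm_le le_rfl hfN ht),
          norm_le_zero_iff.1 (norm_le_of_supNorm_le le_rfl hhN ht), sub_zero]
      obtain ⟨C, hC, hest⟩ := exists_lipschitz_constant d m hd hT hα0 hα1 hαβ hαμ (KN 0)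
      have := hest 0 δ KN σ le_rfl hσ rfl g hg f h hf hh hfN hhN lam hlam
      rw [hzero, mul_zero] at this ⊢
      exact this
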